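/- \textbf{Lemma.} There are one program, for the random access machine described below, and constants $C, D\in\mathbb{N}$ with the following property. Let $K$ be a field with a primitive root of unity $\omega$ of order $2^t$ (for example $K=\mathbb{C}$, or $K=\mathbb{Z}/q\mathbb{Z}$ with a prime $q\equiv 1 \pmod{2^t}$). Let $a=(a_0,\dots,a_n)$ and $b=(b_0,\dots,b_n)$ be sequences in $K$. Let $P\subset\mathbb{R}^2$ be a nondegenerate triangle with arbitrary real vertices $v_0,v_1,v_2$ and perimeter $p$, where $2(p+1)\le 2^t$; $P$ consists of its interior together with an arbitrary choice of its three open edges and of its three vertices. Then the program computes all the partial sums \[ c_k=\sum_{\substack{i+j=k\\ (i,j)\in P\cap\mathbb{Z}^2,\ 0\le i,j\le n}} a_i b_j \qquad (k\in\mathbb{Z}) \] in time at most $C\cdot\max\{1,\ p(\log p)^2\}$, that is, in $\mathcal{O}\left(p(\log p)^2\right)$ time. \emph{Machine.} The machine has integer registers and arrays, real registers, and arrays of elements of $K$, with random access (arrays are indexed by integers). At unit cost each, it performs $+,-,\cdot$ and division with remainder on integers of absolute value at most $\left(n+2+\left\lceil\sum_i\|v_i\|\right\rceil\right)^{D}$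 (no larger integer may occur during the run); $+,-,\cdot,/$, comparison and rounding down to an integer on real numbers; $+,-,\cdot$ on elements of $K$; and memory accesses, tests and assignments. Elements of $K$ do not influence the control flow. The program does not depend on $K$, $\omega$, $t$, the sequences or the triangle. Initially the memory contains $n$, the coordinates of the vertices, six bits telling which open edges and vertices belong to $P$, the sequences $a$ and $b$, the precomputed table of the roots of unity $\omega^{2^{t-s}}$ (of order $2^s$) for $0\le s\le t$, and the element $\tfrac12\in K$; everything else is $0$. At the end, cell $k$ of a designated output array contains $c_k$ for every $k\in\mathbb{Z}$. -/

import Mathlib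

/-!
The machine is a random access machine with three kinds of data.

* Integers (addresses, counters, control): integer registers and integer arrays. Every integer
  produced during a run has to fit into a machine word, that is, to have absolute value at most
  the word bound `W`; otherwise the run does not exist.
* Real numbers, which only serve the geometry of the input: finitely many registers with exact
  field operations, comparison, and rounding down to a machine word.
* Elements of a coefficient field `K`: arrays with random access, on which the only operations are
  addition, subtraction and multiplication. They never influence the control flow.

A program is a structured command. It is built without reference to `K`, to the word bound or to
the input. Each operation, memory access, test and assignment costs one unit of time.
-/

/-- The state of the machine. Arrays are numbered by `ℕ`, cells by `ℤ`. -/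
structure MachineState (K : Type*) where
  /-- integer registers -/
  ireg : ℕ → ℤ
  /-- integer arrays -/
  iarr : ℕ → ℤ → ℤ
  /-- real registers -/
  rreg : ℕ → ℝ
  /-- arrays of coefficients -/
  karr : ℕ → ℤ → K

/-- Integer expressions; `load m e` reads cell `e` of integer array `m`. -/
inductive IntExp where
  | const (c : ℤ)
  | reg (x : ℕ)
  | load (m : ℕ) (e : IntExp)
  | add (e f : IntExp)
  | sub (e f : IntExp)
  | mul (e f : IntExp)
  | div (e f : IntExp)
  | mod (e f : IntExp)

/-- Real expressions. -/
inductive RealExp where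
  | ofInt (e : IntExp)
  | reg (x : ℕ)
  | add (e f : RealExp)
  | sub (e f : RealExp)
  | mul (e f : RealExp)
  | div (e f : RealExp)

/-- Coefficient expressions; `load m e` reads cell `e` of coefficient array `m`. -/
inductive CoeffExp where
  | zero
  | one
  | load (m : ℕ) (e : IntExp)
  | add (e f : CoeffExp)
  | sub (e f : CoeffExp)
  | mul (e f : CoeffExp)

/-- Tests; there are none on coefficients. -/
inductive TestExp where
  | intLT (e f : IntExp)
  | realLT (e f : RealExp)
  | not (b : TestExp)
  | and (b c : TestExp)

namespace IntExp

variable {K : Type*}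

/-- The value of an integer expression (`div` and `mod` are division with remainder). -/
def eval (s : MachineState K) : IntExp → ℤ
  | const c => c
  | reg x => s.ireg x
  | load m e => s.iarr m (eval s e)
  | add e f => eval s e + eval s f
  | sub e f => eval s e - eval s f
  | mul e f => eval s e * eval s f
  | div e f => eval s e / eval s f
  | mod e f => eval s e % eval s f

/-- All intermediate values fit into a machine word and no division by zero occurs. -/
def Valid (W : ℕ) (s : MachineState K) : IntExp → Prop
  | const c => |c| ≤ W
  | reg x => |s.ireg x| ≤ W
  | load m e => Valid W s e ∧ |s.iarr m (eval s e)| ≤ W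
  | add e f => Valid W s e ∧ Valid W s f ∧ |eval s e + eval s f| ≤ W
  | sub e f => Valid W s e ∧ Valid W s f ∧ |eval s e - eval s f| ≤ W
  | mul e f => Valid W s e ∧ Valid W s f ∧ |eval s e * eval s f| ≤ W
  | div e f => Valid W s e ∧ Valid W s f ∧ eval s f ≠ 0 ∧ |eval s e / eval s f| ≤ W
  | mod e f => Valid W s e ∧ Valid W s f ∧ eval s f ≠ 0 ∧ |eval s e % eval s f| ≤ W

/-- The number of operations and accesses in the evaluation. -/
def cost : IntExp → ℕ
  | const _ => 1
  | reg _ => 1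
  | load _ e => cost e + 1
  | add e f => cost e + cost f + 1
  | sub e f => cost e + cost f + 1
  | mul e f => cost e + cost f + 1
  | div e f => cost e + cost f + 1
  | mod e f => cost e + cost f + 1

end IntExp

namespace RealExp

variable {K : Type*}

/-- The value of a real expression. -/
noncomputable def eval (s : MachineState K) : RealExp → ℝ
  | ofInt e => (e.eval s : ℝ)
  | reg x => s.rreg x
  | add e f => eval s e + eval s f
  | sub e f => eval s e - eval s f
  | mul e f => eval s e * eval s f
  | div e f => eval s e / eval s f

/-- The integer parts are valid and no division by zero occurs. -/
def Valid (W : ℕ) (s : MachineState K) : RealExp → Prop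
  | ofInt e => e.Valid W s
  | reg _ => True
  | add e f => Valid W s e ∧ Valid W s f
  | sub e f => Valid W s e ∧ Valid W s f
  | mul e f => Valid W s e ∧ Valid W s f
  | div e f => Valid W s e ∧ Valid W s f ∧ eval s f ≠ 0

/-- The number of operations and accesses in the evaluation. -/
def cost : RealExp → ℕ
  | ofInt e => e.cost + 1
  | reg _ => 1
  | add e f => cost e + cost f + 1
  | sub e f => cost e + cost f + 1
  | mul e f => cost e + cost f + 1
  | div e f => cost e + cost f + 1

end RealExp

namespace CoeffExp

variable {K : Type*}

/-- The value of a coefficient expression. -/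
def eval [Field K] (s : MachineState K) : CoeffExp → K
  | zero => 0
  | one => 1
  | load m e => s.karr m (e.eval s)
  | add e f => eval s e + eval s f
  | sub e f => eval s e - eval s f
  | mul e f => eval s e * eval s f

/-- All addresses are valid integer expressions. -/
def Valid (W : ℕ) (s : MachineState K) : CoeffExp → Prop
  | zero => True
  | one => True
  | load _ e => e.Valid W s
  | add e f => Valid W s e ∧ Valid W s f
  | sub e f => Valid W s e ∧ Valid W s f
  | mul e f => Valid W s e ∧ Valid W s f

/-- The number of operations and accesses in the evaluation. -/
def cost : CoeffExp → ℕ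
  | zero => 1
  | one => 1
  | load _ e => e.cost + 1
  | add e f => cost e + cost f + 1
  | sub e f => cost e + cost f + 1
  | mul e f => cost e + cost f + 1

end CoeffExp

namespace TestExp

variable {K : Type*}

/-- The test succeeds in the state `s`. -/
def Holds (s : MachineState K) : TestExp → Prop
  | intLT e f => e.eval s < f.eval s
  | realLT e f => e.eval s < f.eval s
  | not b => ¬ Holds s b
  | and b c => Holds s b ∧ Holds s c

/-- All expressions in the test are valid. -/
def Valid (W : ℕ) (s : MachineState K) : TestExp → Prop
  | intLT e f => e.Valid W s ∧ f.Valid W s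
  | realLT e f => e.Valid W s ∧ f.Valid W s
  | not b => Valid W s b
  | and b c => Valid W s b ∧ Valid W s c

/-- The number of operations and accesses in the evaluation. -/
def cost : TestExp → ℕ
  | intLT e f => e.cost + f.cost + 1
  | realLT e f => e.cost + f.cost + 1
  | not b => cost b + 1
  | and b c => cost b + cost c + 1

end TestExp

/-- Programs. -/
inductive Program where
  | skip
  /-- `ireg x := e` -/
  | setInt (x : ℕ) (e : IntExp)
  /-- `iarr m [i] := e` -/
  | storeInt (m : ℕ) (i e : IntExp)
  /-- `rreg x := r` -/
  | setReal (x : ℕ) (r : RealExp)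
  /-- `ireg x := ⌊r⌋` -/
  | setFloor (x : ℕ) (r : RealExp)
  /-- `karr m [i] := d` -/
  | storeCoeff (m : ℕ) (i : IntExp) (d : CoeffExp)
  | seq (c d : Program)
  | ite (b : TestExp) (c d : Program)
  | while (b : TestExp) (c : Program)

/-- `Runs W c s T s'`: on a machine with word bound `W`, the program `c` started in the state `s`
halts in the state `s'` after exactly `T` units of time. -/
inductive Runs {K : Type*} [Field K] (W : ℕ) :
    Program → MachineState K → ℕ → MachineState K → Prop
  | skip (s : MachineState K) : Runs W Program.skip s 1 s
  | setInt (s : MachineState K) (x : ℕ) (e : IntExp) (he : e.Valid W s) :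
      Runs W (Program.setInt x e) s (e.cost + 1)
        { s with ireg := Function.update s.ireg x (e.eval s) }
  | storeInt (s : MachineState K) (m : ℕ) (i e : IntExp) (hi : i.Valid W s) (he : e.Valid W s) :
      Runs W (Program.storeInt m i e) s (i.cost + e.cost + 1)
        { s with
          iarr := Function.update s.iarr m (Function.update (s.iarr m) (i.eval s) (e.eval s)) }
  | setReal (s : MachineState K) (x : ℕ) (r : RealExp) (hr : r.Valid W s) :
      Runs W (Program.setReal x r) s (r.cost + 1)
        { s with rreg := Function.update s.rreg x (r.eval s) }
  | setFloor (s : MachineState K) (x : ℕ) (r : RealExp) (hr : r.Valid W s)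
      (hW : |⌊r.eval s⌋| ≤ W) :
      Runs W (Program.setFloor x r) s (r.cost + 1)
        { s with ireg := Function.update s.ireg x ⌊r.eval s⌋ }
  | storeCoeff (s : MachineState K) (m : ℕ) (i : IntExp) (d : CoeffExp)
      (hi : i.Valid W s) (hd : d.Valid W s) :
      Runs W (Program.storeCoeff m i d) s (i.cost + d.cost + 1)
        { s with
          karr := Function.update s.karr m (Function.update (s.karr m) (i.eval s) (d.eval s)) }
  | seq {c d : Program} {s s' s'' : MachineState K} {T T' : ℕ}
      (hc : Runs W c s T s') (hd : Runs W d s' T' s'') :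
      Runs W (Program.seq c d) s (T + T') s''
  | ite_true {b : TestExp} {c d : Program} {s s' : MachineState K} {T : ℕ}
      (hv : b.Valid W s) (hb : b.Holds s) (hc : Runs W c s T s') :
      Runs W (Program.ite b c d) s (b.cost + 1 + T) s'
  | ite_false {b : TestExp} {c d : Program} {s s' : MachineState K} {T : ℕ}
      (hv : b.Valid W s) (hb : ¬ b.Holds s) (hd : Runs W d s T s') :
      Runs W (Program.ite b c d) s (b.cost + 1 + T) s'
  | while_false {b : TestExp} {c : Program} {s : MachineState K}
      (hv : b.Valid W s) (hb : ¬ b.Holds s) :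
      Runs W (Program.while b c) s (b.cost + 1) s
  | while_true {b : TestExp} {c : Program} {s s' s'' : MachineState K} {T T' : ℕ}
      (hv : b.Valid W s) (hb : b.Holds s) (hc : Runs W c s T s')
      (hw : Runs W (Program.while b c) s' T' s'') :
      Runs W (Program.while b c) s (b.cost + 1 + T + T') s''

/-- The Euclidean plane. -/
abbrev Plane : Type := EuclideanSpace ℝ (Fin 2)

/-- A nondegenerate triangle in the plane, given by its three vertices. -/
abbrev PlaneTriangle : Type := Affine.Triangle ℝ Plane

namespace PlaneTriangle

/-- The perimeter. -/
noncomputable def perimeter (P : PlaneTriangle) : ℝ :=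
  dist (P.points 0) (P.points 1) + dist (P.points 1) (P.points 2) + dist (P.points 2) (P.points 0)

/-- The open edge opposite to the vertex `i` (without its end points). -/
def openEdge (P : PlaneTriangle) (i : Fin 3) : Set Plane :=
  openSegment ℝ (P.points (i + 1)) (P.points (i + 2))

/-- The triangle as a set of points: the interior, together with the open edges opposite to the
vertices in `E` and with the vertices in `V`. -/
def region (P : PlaneTriangle) (E V : Finset (Fin 3)) : Set Plane :=
  P.interior ∪ (⋃ i ∈ E, P.openEdge i) ∪ P.points '' V

/-- The size of the numbers in an instance with index bound `n`. -/
noncomputable def size (P : PlaneTriangle) (n : ℕ) : ℕ :=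
  n + 2 + ⌈∑ i, ‖P.points i‖⌉₊

end PlaneTriangle

open Classical in
/-- The diagonal sum `∑ a_i b_j` over all lattice points `(i, j)` of `S` with `i + j = k`, where
`i` and `j` run through the index set `{0, …, n}` of the sequences. -/
noncomputable def diagonalSum {K : Type*} [Field K] {n : ℕ} (a b : Fin (n + 1) → K)
    (S : Set Plane) (k : ℤ) : K :=
  ∑ x : Fin (n + 1) × Fin (n + 1) with
    ((x.1 : ℕ) : ℤ) + ((x.2 : ℕ) : ℤ) = k ∧ !₂[((x.1 : ℕ) : ℝ), ((x.2 : ℕ) : ℝ)] ∈ S,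
    a x.1 * b x.2

/-- The array that holds a finite sequence in the cells `0, …, n` and `0` in all other cells. -/
def arrayOf {K : Type*} [Field K] {n : ℕ} (a : Fin (n + 1) → K) (i : ℤ) : K :=
  if h : 0 ≤ i ∧ i.toNat < n + 1 then a ⟨i.toNat, h.2⟩ else 0

/-- The table of roots of unity: cell `s` holds `ω ^ (2 ^ (t - s))` for `0 ≤ s ≤ t`. If `ω` is a
primitive root of unity of order `2 ^ t`, then cell `s` holds one of order `2 ^ s`. -/
def rootTable {K : Type*} [Field K] (t : ℕ) (ω : K) (s : ℤ) : K :=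
  if 0 ≤ s ∧ s ≤ t then ω ^ (2 ^ (t - s.toNat)) else 0

/-- The initial state. Integer register `0` holds `n`, registers `1, 2, 3` and `4, 5, 6` say which
open edges and which vertices belong to the triangle; real registers `0, …, 5` hold the
coordinates of the vertices; coefficient arrays `0` and `1` hold the two sequences, array `2` the
table of roots of unity, and cell `0` of array `3` the number `1 / 2`. The rest is zero. -/
noncomputable def initialState {K : Type*} [Field K] {n : ℕ} (a b : Fin (n + 1) → K)
    (P : PlaneTriangle) (E V : Finset (Fin 3)) (t : ℕ) (ω : K) : MachineState K where
  ireg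
    | 0 => (n : ℤ)
    | 1 => if 0 ∈ E then 1 else 0
    | 2 => if 1 ∈ E then 1 else 0
    | 3 => if 2 ∈ E then 1 else 0
    | 4 => if 0 ∈ V then 1 else 0
    | 5 => if 1 ∈ V then 1 else 0
    | 6 => if 2 ∈ V then 1 else 0
    | _ => 0
  iarr _ _ := 0
  rreg
    | 0 => P.points 0 0
    | 1 => P.points 0 1
    | 2 => P.points 1 0
    | 3 => P.points 1 1
    | 4 => P.points 2 0
    | 5 => P.points 2 1
    | _ => 0
  karr
    | 0 => arrayOf a
    | 1 => arrayOf b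
    | 2 => rootTable t ω
    | 3 => fun i => if i = 0 then 2⁻¹ else 0
    | _ => fun _ => 0

/-! The triangle is cut into squares by a quadtree. Let `(X, Y)` be the pair of least rounded
coordinates of the vertices and `2 ^ m` the least power of two for which the square of side `2 ^ m`
at `(X, Y)` covers the triangle; then `2 ^ m < p + 2`. A square whose lattice points all lie in the
interior contributes the product of a block of `a` and a block of `b`, shifted by the sum of its
corner coordinates. A square on the outer side of one edge contributes nothing. Any other square is
split into four, down to single points, whose membership is decided exactly, edges and vertices
included. Each square is classified by the signs of the three barycentric coordinates at its
corners, which suffices because these functions are affine.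

Products of blocks of length `2 ^ r` are computed by a fast Fourier transform of length `2 ^ (r +
1)` in time `O(2 ^ r * (r + 1))` (`fftUnsteps_mul`, `haltsIn_convolve`). The transform leaves its
values in permuted order, but the inverse undoes it step by step, so no reordering is needed. The
existence of a primitive root of order `2 ^ t` makes `2` invertible.

Running time: a square is split only if the line through one of the edges crosses it. A line crosses
at most `2 * M` cells of an `M × M` grid, because it is monotone (`crossCount_le`). Hence there are
`O(2 ^ (m - j))` visited squares of side `2 ^ j`, each costing `O(2 ^ j * (j + 1))` apart from its
descendants. Every level costs `O(2 ^ m * (m + 1))`, and all levels together `O(2 ^ m * (m + 1) ^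
2)` (`treeCost_le`), which is `O(p (log p) ^ 2)` or bounded (`two_pow_mul_sq_le`).

On the machine the recursion is a loop with an explicit stack. `rounds_square` shows by induction on
the level that finitely many rounds remove a square with all its descendants, add its contribution
to the output array, and leave the rest of the stack intact. -/

set_option linter.unusedSimpArgs false
set_option linter.unusedSectionVars false

/-! ### The fast Fourier transform and its inverse, as algebra. -/

section FastFourierTransform

variable {K : Type*} [Field K]

/-- One decimation step: each block of length `2 * k` is split into the sums and the twisted
differences of its halves. -/
def fftStage (k : ℕ) (z : K) (A : ℕ → K) (x : ℕ) : K :=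
  if x % (k + k) < k then A x + A (x + k)
  else (A (x - k) - A x) * z ^ (x % (k + k) - k)

/-- The inverse of `fftStage`. -/
def fftUnstage (k : ℕ) (z half : K) (A : ℕ → K) (x : ℕ) : K :=
  if x % (k + k) < k then (A x - z ^ (k - x % (k + k)) * A (x + k)) * half
  else (A (x - k) + z ^ (k - (x % (k + k) - k)) * A x) * half

/-- The first `j` steps of the transform of length `2 ^ n`. -/
def fftSteps (rt : ℕ → K) (n : ℕ) : ℕ → (ℕ → K) → ℕ → K
  | 0, A => A
  | j + 1, A => fftStage (2 ^ (n - (j + 1))) (rt (n - j)) (fftSteps rt n j A)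

/-- The first `j` steps of the inverse transform. -/
def fftUnsteps (rt : ℕ → K) (half : K) : ℕ → (ℕ → K) → ℕ → K
  | 0, A => A
  | j + 1, A => fftUnstage (2 ^ j) (rt (j + 1)) half (fftUnsteps rt half j A)

theorem sum_range_double {M : Type*} [AddCommMonoid M] (f : ℕ → M) (m : ℕ) :
    ∑ v ∈ Finset.range (2 * m), f v = ∑ v ∈ Finset.range m, (f (2 * v) + f (2 * v + 1)) := by
  induction m with
  | zero => simp
  | succ m ih =>
    rw [Nat.mul_succ, Finset.sum_range_succ, Finset.sum_range_succ, Finset.sum_range_succ, ih,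
      add_assoc]

/-- As `L` is a multiple of the block length, a block that begins below `L` also ends below `L`; so
the partner of an entry in a lower half is in range. -/
theorem add_lt_of_mod_lt {x k L : ℕ} (hk : k + k ∣ L) (hx : x < L) (h : x % (k + k) < k) :
    x + k < L := by
  obtain ⟨c, rfl⟩ := hk
  have h1 := Nat.div_add_mod x (k + k)
  have hq : x / (k + k) < c := Nat.div_lt_of_lt_mul hx
  have h2 : (k + k) * (x / (k + k) + 1) ≤ (k + k) * c := Nat.mul_le_mul_left _ hq
  rw [Nat.mul_add, Nat.mul_one] at h2
  omega

/-- Blocks do not leave the range below `L`. This matters because the machine arrays are controlled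
only there. -/
theorem fftUnstage_congr {k L : ℕ} (hk : k + k ∣ L) (z half : K) {A B : ℕ → K}
    (h : ∀ x < L, A x = B x) : ∀ x < L, fftUnstage k z half A x = fftUnstage k z half B x := by
  intro x hx
  unfold fftUnstage
  split_ifs with h1
  · rw [h x hx, h _ (add_lt_of_mod_lt hk hx h1)]
  · rw [h x hx, h (x - k) (by omega)]

theorem fftUnsteps_congr {n : ℕ} (rt : ℕ → K) (half : K) {A B : ℕ → K}
    (h : ∀ x < 2 ^ n, A x = B x) :
    ∀ j ≤ n, ∀ x < 2 ^ n, fftUnsteps rt half j A x = fftUnsteps rt half j B x := by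
  intro j
  induction j with
  | zero => intro _; exact h
  | succ j ih =>
    intro hj
    refine fftUnstage_congr ?_ _ _ (ih (by omega))
    rw [← mul_two, ← pow_succ]
    exact pow_dvd_pow 2 hj

/-- From `z ^ k = -1` it follows that `z ^ (k - i)` is minus the inverse of the twist `z ^ i`. This
accounts for the signs in `fftUnstage` and lets the inverse use the same table of powers, without
division. -/
theorem fftUnstage_fftStage {k : ℕ} (hk : 0 < k) {z half : K} (hz : z ^ k = -1)
    (hh : 2 * half = 1) (A : ℕ → K) (x : ℕ) :
    fftUnstage k z half (fftStage k z A) x = A x := by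
  have hm : x % (k + k) < k + k := Nat.mod_lt _ (by omega)
  have h0 := Nat.div_add_mod x (k + k)
  unfold fftUnstage
  split_ifs with h1
  · have h2 : (x + k) % (k + k) = x % (k + k) + k := by
      rw [← Nat.mod_add_mod, Nat.mod_eq_of_lt (by omega)]
    have h3 : z ^ (k - x % (k + k)) * z ^ (x % (k + k)) = -1 := by
      rw [← pow_add, Nat.sub_add_cancel h1.le, hz]
    simp only [fftStage, h1, h2, if_true, Nat.add_sub_cancel, if_neg (by omega : ¬ x % (k + k) + k < k)]
    linear_combination (-(A x - A (x + k)) * half) * h3 + A x * hh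
  · have hxk : k ≤ x := by
      have := Nat.mod_le x (k + k)
      omega
    have h2 : (x - k) % (k + k) = x % (k + k) - k := by
      have : x - k = (x % (k + k) - k) + (k + k) * (x / (k + k)) := by omega
      rw [this, Nat.add_mul_mod_self_left, Nat.mod_eq_of_lt (by omega)]
    have h3 : z ^ (k - (x % (k + k) - k)) * z ^ (x % (k + k) - k) = -1 := by
      rw [← pow_add, Nat.sub_add_cancel (by omega), hz]
    simp only [fftStage, h1, h2, if_false, Nat.sub_add_cancel hxk,
      if_pos (by omega : x % (k + k) - k < k)]
    linear_combination ((A (x - k) - A x) * half) * h3 + A x * hh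

/-- The last forward step is undone first, so the order in which the transform leaves its values is
irrelevant. -/
theorem fftUnsteps_fftSteps {rt : ℕ → K} {half : K} {n : ℕ}
    (hrt : ∀ j < n, rt (j + 1) ^ 2 ^ j = -1) (hh : 2 * half = 1) (A : ℕ → K) :
    ∀ j ≤ n, fftUnsteps rt half j (fftSteps rt n n A) = fftSteps rt n (n - j) A := by
  intro j
  induction j with
  | zero => intro _; rfl
  | succ j ih =>
    intro hj
    have h1 : n - j = (n - (j + 1)) + 1 := by omega
    rw [fftUnsteps, ih (by omega), h1, fftSteps]
    have h2 : n - (n - (j + 1) + 1) = j := by omega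
    have h3 : n - (n - (j + 1)) = j + 1 := by omega
    rw [h2, h3]
    funext x
    exact fftUnstage_fftStage (by positivity) (hrt j hj) hh _ x

/-- Block `q` works towards evaluation at points attached to it: its entry `i` collects the terms
with index congruent to `i` modulo the block length. For `j = n` every entry is the value of the
polynomial `A` at one point. Only the independence of `ρ` from `A` is needed, not which root of
unity it is. -/
theorem fftSteps_eq_sum {rt : ℕ → K} {n : ℕ} (hrt : ∀ j < n, rt (j + 1) ^ 2 ^ j = -1) :
    ∀ j ≤ n, ∀ q < 2 ^ j, ∃ ρ : K, ∀ A : ℕ → K, ∀ i < 2 ^ (n - j),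
      fftSteps rt n j A (q * 2 ^ (n - j) + i) =
        ∑ v ∈ Finset.range (2 ^ j), A (i + 2 ^ (n - j) * v) * ρ ^ (i + 2 ^ (n - j) * v) := by
  intro j
  induction j with
  | zero =>
    intro _ q hq
    refine ⟨1, fun A i _ => ?_⟩
    obtain rfl : q = 0 := by simpa using hq
    simp [fftSteps]
  | succ j ih =>
    intro hj q' hq'
    obtain ⟨ρ, hρ⟩ := ih (by omega) (q' / 2) (by rw [pow_succ] at hq'; omega)
    have hz := hrt (n - (j + 1)) (by omega)
    have e1 : n - (j + 1) + 1 = n - j := by omega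
    rw [e1] at hz
    set z := rt (n - j)
    set h := 2 ^ (n - (j + 1)) with hh
    have hpos : 0 < h := by positivity
    have e2 : 2 ^ (n - j) = h + h := by rw [← e1, pow_succ]; omega
    rw [e2] at hρ
    -- The lower half of the parent block becomes the even block and keeps `ρ`; the upper half
    -- becomes the odd block and gets `ρ * z`.
    obtain ⟨q, hq | hq⟩ : ∃ q, q' = 2 * q ∨ q' = 2 * q + 1 := ⟨q' / 2, by omega⟩
    · have hq2 : q' / 2 = q := by omega
      rw [hq2] at hρ
      refine ⟨ρ, fun A i hi => ?_⟩
      have e3 : q' * h + i = q * (h + h) + i := by rw [hq]; ring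
      have e4 : (q * (h + h) + i) % (h + h) = i := by
        rw [mul_comm, Nat.mul_add_mod, Nat.mod_eq_of_lt (by omega)]
      rw [fftSteps, ← hh, fftStage, e3, e4, if_pos hi, hρ A i (by omega), add_assoc,
        hρ A (i + h) (by omega), pow_succ, mul_comm (2 ^ j), sum_range_double,
        ← Finset.sum_add_distrib]
      refine Finset.sum_congr rfl fun v _ => ?_
      have e5 : i + (h + h) * v = i + h * (2 * v) := by ring
      have e6 : i + h + (h + h) * v = i + h * (2 * v + 1) := by ring
      rw [e5, e6]
    · have hq2 : q' / 2 = q := by omega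
      rw [hq2] at hρ
      -- Since `z ^ h = -1`, the extra factor at index `i + h * w` is `z ^ i` for even `w` and `-z ^
      -- i` for odd `w`: the twisted difference.
      refine ⟨ρ * z, fun A i hi => ?_⟩
      have e3 : q' * h + i = q * (h + h) + (i + h) := by rw [hq]; ring
      have e4 : (q * (h + h) + (i + h)) % (h + h) = i + h := by
        rw [mul_comm, Nat.mul_add_mod, Nat.mod_eq_of_lt (by omega)]
      have e7 : q * (h + h) + (i + h) - h = q * (h + h) + i := by omega
      rw [fftSteps, ← hh, fftStage, e3, e4, if_neg (by omega), e7, hρ A i (by omega),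
        hρ A (i + h) (by omega), pow_succ, mul_comm (2 ^ j), sum_range_double,
        ← Finset.sum_sub_distrib, Finset.sum_mul]
      refine Finset.sum_congr rfl fun v _ => ?_
      have e5 : i + (h + h) * v = i + h * (2 * v) := by ring
      have e6 : i + h + (h + h) * v = i + h * (2 * v + 1) := by ring
      have e8 : z ^ (i + h * (2 * v)) = z ^ i := by
        rw [pow_add, pow_mul, hz]; simp
      have e9 : z ^ (i + h * (2 * v + 1)) = - z ^ i := by
        rw [pow_add, pow_mul, hz, pow_succ]; simp
      rw [e5, e6, Nat.add_sub_cancel, mul_pow, mul_pow, e8, e9]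
      ring

/-- The coefficients of the product of two polynomials with `m` coefficients. -/
def convolution (m : ℕ) (A B : ℕ → K) (x : ℕ) : K :=
  ∑ u ∈ Finset.range m, ∑ v ∈ Finset.range m, if u + v = x then A u * B v else 0

theorem sum_convolution_mul_pow (m : ℕ) (A B : ℕ → K) (ρ : K) :
    ∑ x ∈ Finset.range (2 * m), convolution m A B x * ρ ^ x =
      (∑ u ∈ Finset.range m, A u * ρ ^ u) * ∑ v ∈ Finset.range m, B v * ρ ^ v := by
  simp only [convolution, Finset.sum_mul]
  rw [Finset.sum_comm]
  refine Finset.sum_congr rfl fun u hu => ?_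
  rw [Finset.sum_comm, Finset.mul_sum]
  refine Finset.sum_congr rfl fun v hv => ?_
  rw [Finset.mem_range] at hu hv
  simp only [ite_mul, zero_mul]
  rw [Finset.sum_ite_eq, if_pos (Finset.mem_range.2 (by omega)), pow_add]
  ring

/-- Fast multiplication: transform, multiply pointwise, transform back. -/
theorem fftUnsteps_mul {rt : ℕ → K} {half : K} {r : ℕ}
    (hrt : ∀ j < r + 1, rt (j + 1) ^ 2 ^ j = -1) (hh : 2 * half = 1) {A B G : ℕ → K}
    (hA : ∀ x < 2 ^ (r + 1), 2 ^ r ≤ x → A x = 0) (hB : ∀ x < 2 ^ (r + 1), 2 ^ r ≤ x → B x = 0)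
    (hG : ∀ x < 2 ^ (r + 1), G x =
      fftSteps rt (r + 1) (r + 1) A x * fftSteps rt (r + 1) (r + 1) B x) :
    ∀ x < 2 ^ (r + 1), fftUnsteps rt half (r + 1) G x = convolution (2 ^ r) A B x := by
  -- Evaluation at a fixed point is multiplicative, and the product has degree below `2 ^ (r + 1)`;
  -- so the pointwise product is itself the transform of the convolution.
  have key : ∀ x < 2 ^ (r + 1), G x =
      fftSteps rt (r + 1) (r + 1) (convolution (2 ^ r) A B) x := by
    intro x hx
    obtain ⟨ρ, hρ⟩ := fftSteps_eq_sum hrt (r + 1) le_rfl x hx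
    simp only [Nat.sub_self, pow_zero, mul_one, one_mul, Nat.lt_one_iff, forall_eq, add_zero,
      zero_add] at hρ
    have cut : ∀ A : ℕ → K, (∀ x < 2 ^ (r + 1), 2 ^ r ≤ x → A x = 0) →
        ∑ v ∈ Finset.range (2 ^ (r + 1)), A v * ρ ^ v =
          ∑ v ∈ Finset.range (2 ^ r), A v * ρ ^ v := by
      intro A hA
      symm
      refine Finset.sum_subset (Finset.range_mono (by rw [pow_succ]; omega)) fun v hv hv' => ?_
      rw [hA v (Finset.mem_range.1 hv) (by simpa using hv'), zero_mul]
    rw [hG x hx, hρ, hρ, hρ, cut A hA, cut B hB, ← sum_convolution_mul_pow, pow_succ,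
      mul_comm (2 ^ r)]
  intro x hx
  rw [fftUnsteps_congr rt half key _ le_rfl x hx, fftUnsteps_fftSteps hrt hh _ _ le_rfl,
    Nat.sub_self, fftSteps]

end FastFourierTransform

/-! ### Reasoning about programs: untouched memory, time bounds, weakest preconditions, loops. -/

namespace Program

/-- Does the program contain an assignment to the integer register `y`? -/
def writesInt : Program → ℕ → Bool
  | setInt x _, y => x == y
  | setFloor x _, y => x == y
  | seq c d, y => writesInt c y || writesInt d y
  | ite _ c d, y => writesInt c y || writesInt d y
  | .while _ c, y => writesInt c y
  | _, _ => false

/-- Does the program contain an assignment to the integer array `y`? -/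
def writesIntArray : Program → ℕ → Bool
  | storeInt m _ _, y => m == y
  | seq c d, y => writesIntArray c y || writesIntArray d y
  | ite _ c d, y => writesIntArray c y || writesIntArray d y
  | .while _ c, y => writesIntArray c y
  | _, _ => false

/-- Does the program contain an assignment to the real register `y`? -/
def writesReal : Program → ℕ → Bool
  | setReal x _, y => x == y
  | seq c d, y => writesReal c y || writesReal d y
  | ite _ c d, y => writesReal c y || writesReal d y
  | .while _ c, y => writesReal c y
  | _, _ => false

/-- Does the program contain an assignment to the coefficient array `y`? -/
def writesCoeff : Program → ℕ → Bool
  | storeCoeff m _ _, y => m == y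
  | seq c d, y => writesCoeff c y || writesCoeff d y
  | ite _ c d, y => writesCoeff c y || writesCoeff d y
  | .while _ c, y => writesCoeff c y
  | _, _ => false

/-- An upper bound for the running time of a program without loops. -/
def maxCost : Program → ℕ
  | skip => 1
  | setInt _ e => e.cost + 1
  | storeInt _ i e => i.cost + e.cost + 1
  | setReal _ r => r.cost + 1
  | setFloor _ r => r.cost + 1
  | storeCoeff _ i d => i.cost + d.cost + 1
  | seq c d => maxCost c + maxCost d
  | ite b c d => b.cost + 1 + (maxCost c + maxCost d)
  | .while _ _ => 0

variable {K : Type*}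

/-- The states `s` and `s'` agree on everything the program does not write to. -/
structure Frame (c : Program) (s s' : MachineState K) : Prop where
  ireg : ∀ x, c.writesInt x = false → s'.ireg x = s.ireg x
  iarr : ∀ x, c.writesIntArray x = false → s'.iarr x = s.iarr x
  rreg : ∀ x, c.writesReal x = false → s'.rreg x = s.rreg x
  karr : ∀ x, c.writesCoeff x = false → s'.karr x = s.karr x

theorem Frame.refl (c : Program) (s : MachineState K) : Frame c s s :=
  ⟨fun _ _ => rfl, fun _ _ => rfl, fun _ _ => rfl, fun _ _ => rfl⟩

theorem Frame.trans {c : Program} {s s' s'' : MachineState K} (h : Frame c s s')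
    (h' : Frame c s' s'') : Frame c s s'' :=
  ⟨fun x hx => (h'.ireg x hx).trans (h.ireg x hx), fun x hx => (h'.iarr x hx).trans (h.iarr x hx),
    fun x hx => (h'.rreg x hx).trans (h.rreg x hx), fun x hx => (h'.karr x hx).trans (h.karr x hx)⟩

theorem Frame.of_le {c d : Program} {s s' : MachineState K} (h : Frame c s s')
    (hi : ∀ x, d.writesInt x = false → c.writesInt x = false)
    (ha : ∀ x, d.writesIntArray x = false → c.writesIntArray x = false)
    (hr : ∀ x, d.writesReal x = false → c.writesReal x = false)
    (hk : ∀ x, d.writesCoeff x = false → c.writesCoeff x = false) : Frame d s s' :=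
  ⟨fun x hx => h.ireg x (hi x hx), fun x hx => h.iarr x (ha x hx),
    fun x hx => h.rreg x (hr x hx), fun x hx => h.karr x (hk x hx)⟩

theorem Frame.seq_left {c d : Program} {s s' : MachineState K} (h : Frame c s s') :
    Frame (seq c d) s s' :=
  h.of_le (by simp +contextual [writesInt]) (by simp +contextual [writesIntArray])
    (by simp +contextual [writesReal]) (by simp +contextual [writesCoeff])

theorem Frame.seq_right {c d : Program} {s s' : MachineState K} (h : Frame d s s') :
    Frame (seq c d) s s' :=
  h.of_le (by simp +contextual [writesInt]) (by simp +contextual [writesIntArray])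
    (by simp +contextual [writesReal]) (by simp +contextual [writesCoeff])

theorem Frame.ite_left {b : TestExp} {c d : Program} {s s' : MachineState K} (h : Frame c s s') :
    Frame (ite b c d) s s' :=
  h.of_le (by simp +contextual [writesInt]) (by simp +contextual [writesIntArray])
    (by simp +contextual [writesReal]) (by simp +contextual [writesCoeff])

theorem Frame.ite_right {b : TestExp} {c d : Program} {s s' : MachineState K}
    (h : Frame d s s') : Frame (ite b c d) s s' :=
  h.of_le (by simp +contextual [writesInt]) (by simp +contextual [writesIntArray])
    (by simp +contextual [writesReal]) (by simp +contextual [writesCoeff])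

theorem Frame.while_body {b : TestExp} {c : Program} {s s' : MachineState K} (h : Frame c s s') :
    Frame (.while b c) s s' :=
  h.of_le (fun _ h => h) (fun _ h => h) (fun _ h => h) (fun _ h => h)

end Program

open Program

/-- Whether a program writes to a given place is read off from its syntax by a computable function,
so for concrete programs and places the side conditions of the frame close by `rfl`. -/
theorem Runs.frame {K : Type*} [Field K] {W : ℕ} {c : Program} {s s' : MachineState K} {T : ℕ}
    (h : Runs W c s T s') : Frame c s s' := by
  induction h with
  | skip s => exact Frame.refl _ _
  | setInt s x e he =>
    refine ⟨fun y hy => ?_, fun _ _ => rfl, fun _ _ => rfl, fun _ _ => rfl⟩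
    have : x ≠ y := by simpa [writesInt] using hy
    simp [Function.update_of_ne this.symm]
  | storeInt s m i e hi he =>
    refine ⟨fun _ _ => rfl, fun y hy => ?_, fun _ _ => rfl, fun _ _ => rfl⟩
    have : m ≠ y := by simpa [writesIntArray] using hy
    simp [Function.update_of_ne this.symm]
  | setReal s x r hr =>
    refine ⟨fun _ _ => rfl, fun _ _ => rfl, fun y hy => ?_, fun _ _ => rfl⟩
    have : x ≠ y := by simpa [writesReal] using hy
    simp [Function.update_of_ne this.symm]
  | setFloor s x r hr hW =>
    refine ⟨fun y hy => ?_, fun _ _ => rfl, fun _ _ => rfl, fun _ _ => rfl⟩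
    have : x ≠ y := by simpa [writesInt] using hy
    simp [Function.update_of_ne this.symm]
  | storeCoeff s m i d hi hd =>
    refine ⟨fun _ _ => rfl, fun _ _ => rfl, fun _ _ => rfl, fun y hy => ?_⟩
    have : m ≠ y := by simpa [writesCoeff] using hy
    simp [Function.update_of_ne this.symm]
  | seq _ _ hc hd => exact hc.seq_left.trans hd.seq_right
  | ite_true _ _ _ hc => exact hc.ite_left
  | ite_false _ _ _ hd => exact hd.ite_right
  | while_false _ _ => exact Frame.refl _ _
  | while_true _ _ _ _ hc hw => exact hc.while_body.trans hw

/-- From the state `s`, the program halts within `N` units of time, in a state with property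
`Q`. -/
def HaltsIn {K : Type*} [Field K] (W : ℕ) (c : Program) (s : MachineState K) (N : ℕ)
    (Q : MachineState K → Prop) : Prop :=
  ∃ T s', Runs W c s T s' ∧ T ≤ N ∧ Q s'

namespace HaltsIn

variable {K : Type*} [Field K] {W : ℕ} {c d : Program} {s : MachineState K} {N N' : ℕ}
  {Q Q' : MachineState K → Prop}

theorem mono (h : HaltsIn W c s N Q) (hN : N ≤ N') (hQ : ∀ s', Frame c s s' → Q s' → Q' s') :
    HaltsIn W c s N' Q' := by
  obtain ⟨T, s', hr, hT, hq⟩ := h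
  exact ⟨T, s', hr, hT.trans hN, hQ s' hr.frame hq⟩

theorem seq (h : HaltsIn W c s N Q)
    (h' : ∀ s', Frame c s s' → Q s' → HaltsIn W d s' N' Q') :
    HaltsIn W (Program.seq c d) s (N + N') Q' := by
  obtain ⟨T, s', hr, hT, hq⟩ := h
  obtain ⟨T', s'', hr', hT', hq'⟩ := h' s' hr.frame hq
  exact ⟨_, s'', hr.seq hr', add_le_add hT hT', hq'⟩

theorem ite {b : TestExp} (hv : b.Valid W s) (ht : b.Holds s → HaltsIn W c s N Q)
    (hf : ¬ b.Holds s → HaltsIn W d s N Q) :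
    HaltsIn W (Program.ite b c d) s (b.cost + 1 + N) Q := by
  by_cases hb : b.Holds s
  · obtain ⟨T, s', hr, hT, hq⟩ := ht hb
    exact ⟨_, s', .ite_true hv hb hr, by omega, hq⟩
  · obtain ⟨T, s', hr, hT, hq⟩ := hf hb
    exact ⟨_, s', .ite_false hv hb hr, by omega, hq⟩

end HaltsIn

namespace Program

variable {K : Type*} [Field K]

/-- The weakest precondition of a program without loops. -/
noncomputable def wp (W : ℕ) : Program → (MachineState K → Prop) → MachineState K → Prop
  | skip, Q, s => Q s
  | setInt x e, Q, s =>
    e.Valid W s ∧ Q { s with ireg := Function.update s.ireg x (e.eval s) }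
  | storeInt m i e, Q, s => i.Valid W s ∧ e.Valid W s ∧
    Q { s with
      iarr := Function.update s.iarr m (Function.update (s.iarr m) (i.eval s) (e.eval s)) }
  | setReal x r, Q, s =>
    r.Valid W s ∧ Q { s with rreg := Function.update s.rreg x (r.eval s) }
  | setFloor x r, Q, s => r.Valid W s ∧ |⌊r.eval s⌋| ≤ W ∧
    Q { s with ireg := Function.update s.ireg x ⌊r.eval s⌋ }
  | storeCoeff m i d, Q, s => i.Valid W s ∧ d.Valid W s ∧
    Q { s with
      karr := Function.update s.karr m (Function.update (s.karr m) (i.eval s) (d.eval s)) }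
  | seq c d, Q, s => wp W c (wp W d Q) s
  | ite b c d, Q, s =>
    b.Valid W s ∧ (b.Holds s → wp W c Q s) ∧ (¬ b.Holds s → wp W d Q s)
  | .while _ _, _, _ => False

/-- Loop-free code is verified by unfolding `wp` into arithmetic side conditions. The time `maxCost`
charges both branches of a conditional, so it does not depend on the state. -/
theorem wp.haltsIn {W : ℕ} {c : Program} {Q : MachineState K → Prop} {s : MachineState K}
    (h : wp W c Q s) : HaltsIn W c s c.maxCost Q := by
  induction c generalizing Q s with
  | skip => exact ⟨_, _, .skip s, le_rfl, h⟩
  | setInt x e => exact ⟨_, _, .setInt s x e h.1, le_rfl, h.2⟩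
  | storeInt m i e => exact ⟨_, _, .storeInt s m i e h.1 h.2.1, le_rfl, h.2.2⟩
  | setReal x r => exact ⟨_, _, .setReal s x r h.1, le_rfl, h.2⟩
  | setFloor x r => exact ⟨_, _, .setFloor s x r h.1 h.2.1, le_rfl, h.2.2⟩
  | storeCoeff m i d => exact ⟨_, _, .storeCoeff s m i d h.1 h.2.1, le_rfl, h.2.2⟩
  | seq c d hc hd => exact (hc h).seq fun s' _ h' => hd h'
  | ite b c d hc hd =>
    exact HaltsIn.ite h.1 (fun hb => (hc (h.2.1 hb)).mono (Nat.le_add_right _ _) fun _ _ h => h)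
      (fun hb => (hd (h.2.2 hb)).mono (Nat.le_add_left _ _) fun _ _ h => h)
  | _ => exact h.elim

/-- Some rounds of the loop `while b c` lead from `s` to `s'` in time `T`. -/
inductive Rounds (W : ℕ) (b : TestExp) (c : Program) :
    MachineState K → ℕ → MachineState K → Prop
  | refl (s : MachineState K) : Rounds W b c s 0 s
  | step {s s' s'' : MachineState K} {T T' : ℕ} (hv : b.Valid W s) (hb : b.Holds s)
      (hc : Runs W c s T s') (h : Rounds W b c s' T' s'') :
      Rounds W b c s (b.cost + 1 + T + T') s''

theorem Rounds.trans {W : ℕ} {b : TestExp} {c : Program} {s s' s'' : MachineState K} {T T' : ℕ}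
    (h : Rounds W b c s T s') (h' : Rounds W b c s' T' s'') :
    Rounds W b c s (T + T') s'' := by
  induction h with
  | refl s => rwa [Nat.zero_add]
  | step hv hb hc _ ih =>
    rw [Nat.add_assoc]
    exact .step hv hb hc (ih h')

theorem Rounds.frame {W : ℕ} {b : TestExp} {c : Program} {s s' : MachineState K} {T : ℕ}
    (h : Rounds W b c s T s') : Frame c s s' := by
  induction h with
  | refl s => exact Frame.refl _ _
  | step _ _ hc _ ih => exact hc.frame.trans ih

theorem Rounds.runs {W : ℕ} {b : TestExp} {c : Program} {s s' : MachineState K} {T : ℕ}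
    (h : Rounds W b c s T s') (hv : b.Valid W s') (hb : ¬ b.Holds s') :
    Runs W (.while b c) s (T + (b.cost + 1)) s' := by
  induction h with
  | refl s =>
    rw [Nat.zero_add]
    exact .while_false hv hb
  | step hv1 hb1 hc _ ih =>
    rw [Nat.add_assoc]
    exact .while_true hv1 hb1 hc (ih hv hb)

/-- A loop with a counted number of rounds. -/
theorem haltsIn_while {W : ℕ} {b : TestExp} {c : Program} {s : MachineState K} {N t : ℕ}
    (I : ℕ → MachineState K → Prop) (h0 : I 0 s)
    (hstep : ∀ i < N, ∀ s', Frame c s s' → I i s' →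
      b.Valid W s' ∧ b.Holds s' ∧ HaltsIn W c s' t (I (i + 1)))
    (hend : ∀ s', Frame c s s' → I N s' → b.Valid W s' ∧ ¬ b.Holds s') :
    HaltsIn W (.while b c) s (N * (b.cost + 1 + t) + (b.cost + 1)) (I N) := by
  have key : ∀ i ≤ N, ∃ T s', Rounds W b c s T s' ∧ T ≤ i * (b.cost + 1 + t) ∧ I i s' := by
    intro i
    induction i with
    | zero => exact fun _ => ⟨0, s, .refl s, by simp, h0⟩
    | succ i ih =>
      intro hi
      obtain ⟨T, s', hr, hT, hI⟩ := ih (by omega)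
      obtain ⟨hv, hb, T', s'', hr', hT', hI'⟩ := hstep i (by omega) s' hr.frame hI
      refine ⟨_, s'', hr.trans (.step hv hb hr' (.refl _)), ?_, hI'⟩
      rw [Nat.add_mul, Nat.one_mul]
      omega
  obtain ⟨T, s', hr, hT, hI⟩ := key N le_rfl
  obtain ⟨hv, hb⟩ := hend s' hr.frame hI
  exact ⟨_, s', hr.runs hv hb, by omega, hI⟩

/-- A loop whose counter, the integer register `18`, runs from `0` to the value of the register
`m` (exclusive). -/
def forTo (m : ℕ) (c : Program) : Program :=
  seq (setInt 18 (.const 0)) (.while (.intLT (.reg 18) (.reg m))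
    (seq c (setInt 18 (.add (.reg 18) (.const 1)))))

/-- Every round pays 4 for the test and 4 for the increment in addition to the body; the remaining 6
are the initialisation and the final failing test. The invariant sees coefficient arrays only, all
that the loop bodies below have to convey. -/
theorem haltsIn_forTo {W m : ℕ} {c : Program} {s : MachineState K} {N t : ℕ}
    (I : ℕ → (ℕ → ℤ → K) → Prop) (hN : s.ireg m = N) (hW : N + 1 ≤ W)
    (hm : m ≠ 18) (hc : c.writesInt m = false) (hc' : c.writesInt 18 = false)
    (h0 : I 0 s.karr)
    (hstep : ∀ i < N, ∀ s', Frame (forTo m c) s s' → s'.ireg 18 = i → I i s'.karr →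
      HaltsIn W c s' t (fun s'' => I (i + 1) s''.karr)) :
    HaltsIn W (forTo m c) s (N * (t + 8) + 6) (fun s' => I N s'.karr) := by
  have h1 : wp W (setInt 18 (.const 0)) (fun s' => s'.ireg 18 = 0 ∧ s'.karr = s.karr) s := by
    simp [wp, IntExp.Valid, IntExp.eval]
  refine (h1.haltsIn.seq (d := .while _ _) (N' := N * (t + 8) + 4) (Q' := fun s' => I N s'.karr)
    fun s1 f1 q1 => ?_).mono ?_ fun _ _ h => h
  · have hm1 : s1.ireg m = N := by
      rw [f1.ireg m (by simpa [writesInt] using hm.symm), hN]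
    refine (haltsIn_while (N := N) (t := t + 4)
      (fun i s' => s'.ireg 18 = i ∧ I i s'.karr) ⟨by simpa using q1.1, by rwa [q1.2]⟩
      ?_ ?_).mono ?_ fun s' _ h => h.2
    · rintro i hi s2 f2 ⟨hi2, hI⟩
      have hm2 : s2.ireg m = N := by
        rw [f2.ireg m (by simpa [writesInt, hc] using hm.symm), hm1]
      refine ⟨?_, ?_, ?_⟩
      · simp only [TestExp.Valid, IntExp.Valid, hi2, hm2, abs_le]
        omega
      · simpa [TestExp.Holds, IntExp.eval, hi2, hm2] using hi
      · have f3 : Frame (forTo m c) s s2 := f1.seq_left.trans (f2.while_body.seq_right)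
        refine (hstep i hi s2 f3 hi2 hI).seq fun s3 f4 hI' => ?_
        have h3 : s3.ireg 18 = i := by rw [f4.ireg 18 hc', hi2]
        have h4 : wp W (setInt 18 (.add (.reg 18) (.const 1)))
            (fun s' => s'.ireg 18 = ((i + 1 : ℕ) : ℤ) ∧ I (i + 1) s'.karr) s3 := by
          simp only [wp, IntExp.Valid, IntExp.eval, h3, Function.update_self, abs_le]
          refine ⟨by omega, by push_cast; rfl, hI'⟩
        exact h4.haltsIn
    · rintro s2 f2 ⟨hi2, -⟩
      have hm2 : s2.ireg m = N := by
        rw [f2.ireg m (by simpa [writesInt, hc] using hm.symm), hm1]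
      simp only [TestExp.Valid, TestExp.Holds, IntExp.eval, IntExp.Valid, hi2, hm2, abs_le]
      omega
    · simp only [TestExp.cost, IntExp.cost]
      apply le_of_eq
      ring
  · simp only [maxCost, IntExp.cost]
    omega

end Program

/-! ### The steps of the transform as loops of the machine. -/

namespace Program

/-! Fast convolution. Registers: `10`, `11` the corner of the square, `12` its size `2 ^ r`, `13` the
number `r`, `15` the length of the transform, `16` the half block length, `17` the number of the
root of unity. Arrays: `5`, `6` the operands, `7`, `8` their images, `9` powers of the root. -/

/-- Padding with zeros to twice the length prevents the cyclic product from wrapping around. -/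
def loadOperands : Program :=
  forTo 15 (ite (.intLT (.reg 18) (.reg 12))
    (seq (storeCoeff 5 (.reg 18) (.load 0 (.add (.reg 10) (.reg 18))))
      (storeCoeff 6 (.reg 18) (.load 1 (.add (.reg 11) (.reg 18)))))
    (seq (storeCoeff 5 (.reg 18) .zero) (storeCoeff 6 (.reg 18) .zero)))

/-- The power with exponent equal to the half block length is included: the inverse step needs it at
the start of each half. -/
def rootPowers : Program :=
  seq (storeCoeff 9 (.const 0) .one)
    (forTo 16 (storeCoeff 9 (.add (.reg 18) (.const 1)) (.mul (.load 9 (.reg 18)) (.load 2 (.reg 17)))))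

/-- The result goes to a second array, since both halves of a block need the old entries; `copyBack`
returns it afterwards. -/
def stageLow (src dst : ℕ) : Program :=
  storeCoeff dst (.reg 18) (.add (.load src (.reg 18)) (.load src (.add (.reg 18) (.reg 16))))

def stageHigh (src dst : ℕ) : Program :=
  storeCoeff dst (.reg 18) (.mul
    (.sub (.load src (.sub (.reg 18) (.reg 16))) (.load src (.reg 18)))
    (.load 9 (.sub (.reg 19) (.reg 16))))

def stage : Program :=
  forTo 15 (seq (setInt 19 (.mod (.reg 18) (.add (.reg 16) (.reg 16))))
    (ite (.intLT (.reg 19) (.reg 16)) (seq (stageLow 5 7) (stageLow 6 8))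
      (seq (stageHigh 5 7) (stageHigh 6 8))))

def unstage : Program :=
  forTo 15 (seq (setInt 19 (.mod (.reg 18) (.add (.reg 16) (.reg 16))))
    (ite (.intLT (.reg 19) (.reg 16))
      (storeCoeff 7 (.reg 18) (.mul
        (.sub (.load 5 (.reg 18)) (.mul (.load 9 (.sub (.reg 16) (.reg 19)))
          (.load 5 (.add (.reg 18) (.reg 16)))))
        (.load 3 (.const 0))))
      (storeCoeff 7 (.reg 18) (.mul
        (.add (.load 5 (.sub (.reg 18) (.reg 16)))
          (.mul (.load 9 (.sub (.reg 16) (.sub (.reg 19) (.reg 16)))) (.load 5 (.reg 18))))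
        (.load 3 (.const 0))))))

def copyBack (src dst : ℕ) : Program :=
  forTo 15 (storeCoeff dst (.reg 18) (.load src (.reg 18)))

def transformStep : Program :=
  seq (setInt 16 (.div (.reg 16) (.const 2))) (seq rootPowers (seq stage
    (seq (copyBack 7 5) (seq (copyBack 8 6) (setInt 17 (.sub (.reg 17) (.const 1)))))))

def transform : Program :=
  seq (setInt 16 (.reg 15)) (seq (setInt 17 (.add (.reg 13) (.const 1)))
    (.while (.intLT (.const 0) (.reg 17)) transformStep))

def untransformStep : Program :=
  seq (setInt 17 (.add (.reg 17) (.const 1))) (seq rootPowers (seq unstage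
    (seq (copyBack 7 5) (setInt 16 (.add (.reg 16) (.reg 16))))))

def untransform : Program :=
  seq (setInt 16 (.const 1)) (seq (setInt 17 (.const 0))
    (.while (.intLT (.reg 17) (.add (.reg 13) (.const 1))) untransformStep))

def multiplyPointwise : Program :=
  forTo 15 (storeCoeff 5 (.reg 18) (.mul (.load 5 (.reg 18)) (.load 6 (.reg 18))))

def accumulate : Program :=
  forTo 15 (storeCoeff 4 (.add (.add (.reg 10) (.reg 11)) (.reg 18))
    (.add (.load 4 (.add (.add (.reg 10) (.reg 11)) (.reg 18))) (.load 5 (.reg 18))))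

def convolve : Program :=
  seq (setInt 15 (.add (.reg 12) (.reg 12))) (seq loadOperands (seq transform
    (seq multiplyPointwise (seq untransform accumulate))))

variable {K : Type*} [Field K]

/-- The inductive step of the loops that fill an array from left to right. -/
theorem forall_lt_update {f : ℤ → K} {g : ℕ → K} {i : ℕ} {v : K} (h : ∀ x < i, f x = g x)
    (hv : v = g i) : ∀ x < i + 1, Function.update f (i : ℤ) v (x : ℤ) = g x := by
  intro x hx
  rcases Nat.lt_succ_iff_lt_or_eq.1 hx with hx | rfl
  · rw [Function.update_of_ne (by exact_mod_cast hx.ne), h x hx]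
  · rw [Function.update_self, hv]

theorem haltsIn_loadOperands {W : ℕ} {s : MachineState K} {X Y : ℤ} {m L : ℕ}
    (hX : s.ireg 10 = X) (hY : s.ireg 11 = Y) (hm : s.ireg 12 = m) (hL : s.ireg 15 = L)
    (hW : |X| + |Y| + m + L + 1 ≤ W) :
    HaltsIn W loadOperands s (L * 40 + 6) fun s' =>
      (∀ x < L, s'.karr 5 (x : ℕ) = if x < m then s.karr 0 (X + x) else 0) ∧
      ∀ x < L, s'.karr 6 (x : ℕ) = if x < m then s.karr 1 (Y + x) else 0 := by
  have a1 := abs_le.1 (le_refl |X|)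
  have a2 := abs_le.1 (le_refl |Y|)
  -- Here and in the loops below `t` is a generous bound for the cost of the body, and `t + 8` is
  -- the time of one round.
  refine (haltsIn_forTo (t := 32) (fun i k =>
    (∀ x < i, k 5 (x : ℕ) = if x < m then s.karr 0 (X + x) else 0) ∧
      ∀ x < i, k 6 (x : ℕ) = if x < m then s.karr 1 (Y + x) else 0) hL (by omega) (by decide)
    rfl rfl (by simp) ?_).mono (by omega) fun _ _ h => h
  intro i hi s' f h18 hI
  have h10 := (f.ireg 10 rfl).trans hX
  have h11 := (f.ireg 11 rfl).trans hY
  have h12 := (f.ireg 12 rfl).trans hm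
  have h0 := f.karr 0 rfl
  have h1 := f.karr 1 rfl
  refine (wp.haltsIn ?_).mono (by decide) fun _ _ h => h
  simp only [wp, TestExp.Valid, TestExp.Holds, IntExp.Valid, IntExp.eval,
    CoeffExp.Valid, CoeffExp.eval, Function.update_self, Function.update_of_ne, ne_eq,
    Nat.reduceEqDiff, OfNat.ofNat_ne_zero, OfNat.zero_ne_ofNat, OfNat.ofNat_ne_one,
    OfNat.one_ne_ofNat, not_false_eq_true, abs_le, h18, h10, h11, h12, h0, h1, Nat.cast_lt]
  refine ⟨by omega, fun h => ⟨by omega, by omega, by omega, by omega, ?_, ?_⟩,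
    fun h => ⟨by omega, trivial, by omega, trivial, ?_, ?_⟩⟩
  · exact forall_lt_update (g := fun x => if x < m then s.karr 0 (X + x) else 0) hI.1 (by simp [h])
  · exact forall_lt_update (g := fun x => if x < m then s.karr 1 (Y + x) else 0) hI.2 (by simp [h])
  · exact forall_lt_update (g := fun x => if x < m then s.karr 0 (X + x) else 0) hI.1 (by simp [h])
  · exact forall_lt_update (g := fun x => if x < m then s.karr 1 (Y + x) else 0) hI.2 (by simp [h])

theorem haltsIn_rootPowers {W : ℕ} {s : MachineState K} {l k : ℕ} {z : K}
    (hk : s.ireg 16 = k) (hl : s.ireg 17 = l) (hz : s.karr 2 l = z) (hW : l + k + 1 ≤ W) :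
    HaltsIn W rootPowers s (k * 20 + 10) fun s' => ∀ x < k + 1, s'.karr 9 (x : ℕ) = z ^ x := by
  have h1 : wp W (storeCoeff 9 (.const 0) .one)
      (fun s' => ∀ x < 0 + 1, s'.karr 9 (x : ℕ) = z ^ x) s := by
    simp only [wp, TestExp.Valid, TestExp.Holds, IntExp.Valid, IntExp.eval,
    CoeffExp.Valid, CoeffExp.eval, Function.update_self, Function.update_of_ne, ne_eq,
    Nat.reduceEqDiff, OfNat.ofNat_ne_zero, OfNat.zero_ne_ofNat, OfNat.ofNat_ne_one,
    OfNat.one_ne_ofNat, not_false_eq_true, abs_le]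
    exact ⟨by omega, trivial, forall_lt_update (g := fun x => z ^ x) (by simp) (by simp)⟩
  refine (h1.haltsIn.seq (N' := k * 20 + 6) fun s1 f1 h1 => ?_).mono
    (by simp only [maxCost, IntExp.cost, CoeffExp.cost]; omega) fun _ _ h => h
  have hk1 := (f1.ireg 16 rfl).trans hk
  have hl1 := (f1.ireg 17 rfl).trans hl
  have hz1 := (congrFun (f1.karr 2 rfl) l).trans hz
  refine (haltsIn_forTo (t := 12) (fun i k => ∀ x < i + 1, k 9 (x : ℕ) = z ^ x) hk1 (by omega)
    (by decide) rfl rfl h1 ?_).mono (by omega) fun _ _ h => h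
  intro i hi s' f h18 hI
  have h17 := (f.ireg 17 rfl).trans hl1
  have h2 := (congrFun (f.karr 2 rfl) l).trans hz1
  refine (wp.haltsIn ?_).mono (by decide) fun _ _ h => h
  have e : (i : ℤ) + 1 = ((i + 1 : ℕ) : ℤ) := by push_cast; rfl
  simp only [wp, TestExp.Valid, TestExp.Holds, IntExp.Valid, IntExp.eval,
    CoeffExp.Valid, CoeffExp.eval, Function.update_self, Function.update_of_ne, ne_eq,
    Nat.reduceEqDiff, OfNat.ofNat_ne_zero, OfNat.zero_ne_ofNat, OfNat.ofNat_ne_one,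
    OfNat.one_ne_ofNat, not_false_eq_true, abs_le, h18, h17, h2]
  refine ⟨by omega, by omega, ?_⟩
  rw [e]
  exact forall_lt_update (g := fun x => z ^ x) hI (by rw [hI i (by omega), pow_succ])

theorem haltsIn_stage {W : ℕ} {s : MachineState K} {k L : ℕ} {z : K} {A B : ℕ → K}
    (hk0 : 0 < k) (hkL : k + k ∣ L) (hk : s.ireg 16 = k) (hL : s.ireg 15 = L)
    (hz : ∀ x < k + 1, s.karr 9 (x : ℕ) = z ^ x)
    (hA : ∀ x < L, s.karr 5 (x : ℕ) = A x) (hB : ∀ x < L, s.karr 6 (x : ℕ) = B x)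
    (hW : 2 * L + 1 ≤ W) :
    HaltsIn W stage s (L * 100 + 6) fun s' =>
      (∀ x < L, s'.karr 7 (x : ℕ) = fftStage k z A x) ∧
      ∀ x < L, s'.karr 8 (x : ℕ) = fftStage k z B x := by
  refine (haltsIn_forTo (t := 92) (fun i f => (∀ x < i, f 7 (x : ℕ) = fftStage k z A x) ∧
      ∀ x < i, f 8 (x : ℕ) = fftStage k z B x) hL (by omega) (by decide) rfl rfl (by simp)
      ?_).mono (by omega) fun _ _ h => h
  intro i hi s' f h18 hI
  have hkl : k + k ≤ L := Nat.le_of_dvd (by omega) hkL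
  have h16 := (f.ireg 16 rfl).trans hk
  have h5 := f.karr 5 rfl
  have h6 := f.karr 6 rfl
  have h9 := f.karr 9 rfl
  have e : (i : ℤ) % ((k : ℤ) + k) = ((i % (k + k) : ℕ) : ℤ) := by push_cast; rfl
  have hm : i % (k + k) < k + k := Nat.mod_lt _ (by omega)
  have hmi : i % (k + k) ≤ i := Nat.mod_le _ _
  refine (wp.haltsIn ?_).mono (by decide) fun _ _ h => h
  simp only [wp, TestExp.Valid, TestExp.Holds, IntExp.Valid, IntExp.eval,
    CoeffExp.Valid, CoeffExp.eval, Function.update_self, Function.update_of_ne, ne_eq,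
    Nat.reduceEqDiff, OfNat.ofNat_ne_zero, OfNat.zero_ne_ofNat, OfNat.ofNat_ne_one,
    OfNat.one_ne_ofNat, not_false_eq_true, abs_le, stageLow, stageHigh, h18, h16, h5, h6, h9, e, Nat.cast_lt]
  refine ⟨by omega, by omega, fun h => ⟨by omega, by omega, ?_⟩,
    fun h => ⟨by omega, by omega, ?_⟩⟩
  · have hl := add_lt_of_mod_lt hkL hi h
    refine ⟨by omega, by omega, forall_lt_update hI.1 ?_, forall_lt_update hI.2 ?_⟩
    · rw [fftStage, if_pos h, ← hA i hi, ← hA _ hl, Nat.cast_add]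
    · rw [fftStage, if_pos h, ← hB i hi, ← hB _ hl, Nat.cast_add]
  · have e1 : (i : ℤ) - k = ((i - k : ℕ) : ℤ) := by omega
    have e2 : ((i % (k + k) : ℕ) : ℤ) - k = ((i % (k + k) - k : ℕ) : ℤ) := by omega
    refine ⟨by omega, by omega, forall_lt_update hI.1 ?_, forall_lt_update hI.2 ?_⟩
    · rw [fftStage, if_neg h, ← hA i hi, ← hA _ (by omega), ← hz _ (by omega), e1, e2]
    · rw [fftStage, if_neg h, ← hB i hi, ← hB _ (by omega), ← hz _ (by omega), e1, e2]

theorem haltsIn_unstage {W : ℕ} {s : MachineState K} {k L : ℕ} {z half : K} {A : ℕ → K}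
    (hk0 : 0 < k) (hkL : k + k ∣ L) (hk : s.ireg 16 = k) (hL : s.ireg 15 = L)
    (hz : ∀ x < k + 1, s.karr 9 (x : ℕ) = z ^ x) (hh : s.karr 3 0 = half)
    (hA : ∀ x < L, s.karr 5 (x : ℕ) = A x) (hW : 2 * L + 1 ≤ W) :
    HaltsIn W unstage s (L * 100 + 6) fun s' =>
      ∀ x < L, s'.karr 7 (x : ℕ) = fftUnstage k z half A x := by
  refine (haltsIn_forTo (t := 92) (fun i f => ∀ x < i, f 7 (x : ℕ) = fftUnstage k z half A x)
    hL (by omega) (by decide) rfl rfl (by simp) ?_).mono (by omega) fun _ _ h => h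
  intro i hi s' f h18 hI
  have hkl : k + k ≤ L := Nat.le_of_dvd (by omega) hkL
  have h16 := (f.ireg 16 rfl).trans hk
  have h3 := (congrFun (f.karr 3 rfl) 0).trans hh
  have h5 := f.karr 5 rfl
  have h9 := f.karr 9 rfl
  have e : (i : ℤ) % ((k : ℤ) + k) = ((i % (k + k) : ℕ) : ℤ) := by push_cast; rfl
  have hm : i % (k + k) < k + k := Nat.mod_lt _ (by omega)
  have hmi : i % (k + k) ≤ i := Nat.mod_le _ _
  refine (wp.haltsIn ?_).mono (by decide) fun _ _ h => h
  simp only [wp, TestExp.Valid, TestExp.Holds, IntExp.Valid, IntExp.eval,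
    CoeffExp.Valid, CoeffExp.eval, Function.update_self, Function.update_of_ne, ne_eq,
    Nat.reduceEqDiff, OfNat.ofNat_ne_zero, OfNat.zero_ne_ofNat, OfNat.ofNat_ne_one,
    OfNat.one_ne_ofNat, not_false_eq_true, abs_le, h18, h16, h3, h5, h9, e, Nat.cast_lt]
  refine ⟨by omega, by omega, fun h => ⟨by omega, by omega, ?_⟩,
    fun h => ⟨by omega, by omega, ?_⟩⟩
  · have hl := add_lt_of_mod_lt hkL hi h
    refine forall_lt_update hI ?_
    have e2 : (k : ℤ) - ((i % (k + k) : ℕ) : ℤ) = ((k - i % (k + k) : ℕ) : ℤ) := by omega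
    rw [fftUnstage, if_pos h, ← hA i hi, ← hA _ hl, ← hz _ (by omega), e2, Nat.cast_add]
  · have e1 : (i : ℤ) - k = ((i - k : ℕ) : ℤ) := by omega
    have e2 : (k : ℤ) - (((i % (k + k) : ℕ) : ℤ) - k) = ((k - (i % (k + k) - k) : ℕ) : ℤ) := by
      omega
    refine forall_lt_update hI ?_
    rw [fftUnstage, if_neg h, ← hA i hi, ← hA _ (by omega), ← hz _ (by omega), e1, e2]

theorem haltsIn_copyBack {W : ℕ} {s : MachineState K} {L src dst : ℕ} {A : ℕ → K}
    (h : dst ≠ src) (hL : s.ireg 15 = L) (hA : ∀ x < L, s.karr src (x : ℕ) = A x)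
    (hW : L + 1 ≤ W) :
    HaltsIn W (copyBack src dst) s (L * 20 + 6) fun s' => ∀ x < L, s'.karr dst (x : ℕ) = A x := by
  refine (haltsIn_forTo (t := 12) (fun i f => ∀ x < i, f dst (x : ℕ) = A x)
    hL (by omega) (by decide) rfl rfl (by simp) ?_).mono (by omega) fun _ _ h => h
  intro i hi s' f h18 hI
  have h5 := f.karr src (by simpa [forTo, writesCoeff] using h)
  refine (wp.haltsIn ?_).mono (by simp [maxCost, IntExp.cost, CoeffExp.cost]) fun _ _ h => h
  simp only [wp, TestExp.Valid, TestExp.Holds, IntExp.Valid, IntExp.eval,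
    CoeffExp.Valid, CoeffExp.eval, Function.update_self, Function.update_of_ne, ne_eq,
    Nat.reduceEqDiff, OfNat.ofNat_ne_zero, OfNat.zero_ne_ofNat, OfNat.ofNat_ne_one,
    OfNat.one_ne_ofNat, not_false_eq_true, abs_le, h18, h5]
  exact ⟨by omega, by omega, forall_lt_update hI (hA i hi)⟩

theorem haltsIn_multiplyPointwise {W : ℕ} {s : MachineState K} {L : ℕ} {A B : ℕ → K}
    (hL : s.ireg 15 = L) (hA : ∀ x < L, s.karr 5 (x : ℕ) = A x)
    (hB : ∀ x < L, s.karr 6 (x : ℕ) = B x) (hW : L + 1 ≤ W) :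
    HaltsIn W multiplyPointwise s (L * 20 + 6) fun s' =>
      ∀ x < L, s'.karr 5 (x : ℕ) = A x * B x := by
  -- The product overwrites its first factor, so the invariant also records that the entries from
  -- `i` on are still the old ones.
  refine (haltsIn_forTo (t := 12) (fun i f => (∀ x < i, f 5 (x : ℕ) = A x * B x) ∧
    ∀ x < L, i ≤ x → f 5 (x : ℕ) = A x)
    hL (by omega) (by decide) rfl rfl ⟨by simp, fun x hx _ => hA x hx⟩ ?_).mono
    (by omega) fun _ _ h => h.1
  intro i hi s' f h18 hI
  have h6 := f.karr 6 rfl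
  refine (wp.haltsIn ?_).mono (by decide) fun _ _ h => h
  simp only [wp, TestExp.Valid, TestExp.Holds, IntExp.Valid, IntExp.eval,
    CoeffExp.Valid, CoeffExp.eval, Function.update_self, Function.update_of_ne, ne_eq,
    Nat.reduceEqDiff, OfNat.ofNat_ne_zero, OfNat.zero_ne_ofNat, OfNat.ofNat_ne_one,
    OfNat.one_ne_ofNat, not_false_eq_true, abs_le, h18, h6]
  refine ⟨by omega, by omega, forall_lt_update hI.1 ?_, fun x hx hix => ?_⟩
  · rw [hI.2 i hi le_rfl, hB i hi]
  · rw [Function.update_of_ne (by omega), hI.2 x hx (by omega)]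

/-- For each `k` at most one term of the sum is nonzero. Written in this way for all `k`, the
contributions of different squares simply add up. -/
theorem haltsIn_accumulate {W : ℕ} {s : MachineState K} {X Y : ℤ} {L : ℕ} {A : ℕ → K}
    (hX : s.ireg 10 = X) (hY : s.ireg 11 = Y) (hL : s.ireg 15 = L)
    (hA : ∀ x < L, s.karr 5 (x : ℕ) = A x) (hW : |X| + |Y| + L + 1 ≤ W) :
    HaltsIn W accumulate s (L * 40 + 6) fun s' => ∀ k : ℤ,
      s'.karr 4 k = s.karr 4 k + ∑ x ∈ Finset.range L, if X + Y + x = k then A x else 0 := by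
  have a1 := abs_le.1 (le_refl |X|)
  have a2 := abs_le.1 (le_refl |Y|)
  refine (haltsIn_forTo (t := 32) (fun i f => ∀ k : ℤ,
      f 4 k = s.karr 4 k + ∑ x ∈ Finset.range i, if X + Y + x = k then A x else 0)
    hL (by omega) (by decide) rfl rfl (by simp) ?_).mono (by omega) fun _ _ h => h
  intro i hi s' f h18 hI
  have h10 := (f.ireg 10 rfl).trans hX
  have h11 := (f.ireg 11 rfl).trans hY
  have h5 := f.karr 5 rfl
  refine (wp.haltsIn ?_).mono (by decide) fun _ _ h => h
  simp only [wp, TestExp.Valid, TestExp.Holds, IntExp.Valid, IntExp.eval,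
    CoeffExp.Valid, CoeffExp.eval, Function.update_self, Function.update_of_ne, ne_eq,
    Nat.reduceEqDiff, OfNat.ofNat_ne_zero, OfNat.zero_ne_ofNat, OfNat.ofNat_ne_one,
    OfNat.one_ne_ofNat, not_false_eq_true, abs_le, h18, h10, h11, h5]
  refine ⟨by omega, by omega, fun k => ?_⟩
  rw [Finset.sum_range_succ, ← add_assoc, ← hI]
  by_cases hk : X + Y + i = k
  · subst hk
    rw [Function.update_self, if_pos rfl, hA i hi]
  · rw [Function.update_of_ne (Ne.symm hk), if_neg hk, add_zero]

end Program

/-! ### The whole transform, its inverse, and the convolution of two blocks. -/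

namespace Program

variable {K : Type*} [Field K]

/-- The powers of the root cost about `20 * k ≤ 10 * L`, the butterflies `100 * L` and the two
copies `20 * L` each; this leaves room within `160 * L + 40`. -/
theorem haltsIn_transformStep {W : ℕ} {s : MachineState K} {k l L : ℕ} {z : K} {A B : ℕ → K}
    (hk0 : 0 < k) (hkL : k + k ∣ L) (h16 : s.ireg 16 = (k + k : ℕ))
    (h17 : s.ireg 17 = (l + 1 : ℕ)) (hL : s.ireg 15 = L) (hL0 : 0 < L)
    (hz : s.karr 2 ((l + 1 : ℕ) : ℤ) = z)
    (hA : ∀ x < L, s.karr 5 (x : ℕ) = A x) (hB : ∀ x < L, s.karr 6 (x : ℕ) = B x)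
    (hW : 2 * L + l + 3 ≤ W) :
    HaltsIn W transformStep s (L * 160 + 40) fun s' => s'.ireg 16 = k ∧ s'.ireg 17 = l ∧
      (∀ x < L, s'.karr 5 (x : ℕ) = fftStage k z A x) ∧
      ∀ x < L, s'.karr 6 (x : ℕ) = fftStage k z B x := by
  have hkl : k + k ≤ L := Nat.le_of_dvd hL0 hkL
  have c1 : wp W (setInt 16 (.div (.reg 16) (.const 2))) (fun s' => s'.ireg 16 = k) s := by
    simp only [wp, TestExp.Valid, TestExp.Holds, IntExp.Valid, IntExp.eval,
    CoeffExp.Valid, CoeffExp.eval, Function.update_self, Function.update_of_ne, ne_eq,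
    Nat.reduceEqDiff, OfNat.ofNat_ne_zero, OfNat.zero_ne_ofNat, OfNat.ofNat_ne_one,
    OfNat.one_ne_ofNat, not_false_eq_true, abs_le, h16, true_and]
    omega
  refine (c1.haltsIn.seq fun s1 f1 q1 => ((haltsIn_rootPowers (W := W) (l := l + 1) q1
    ((f1.ireg 17 rfl).trans h17) ((congrFun (f1.karr 2 rfl) _).trans hz) (by omega)).seq
    fun s2 f2 q2 => ((haltsIn_stage (W := W) (A := A) (B := B) hk0 hkL ((f2.ireg 16 rfl).trans q1)
      ((f2.ireg 15 rfl).trans ((f1.ireg 15 rfl).trans hL)) q2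
      (by rw [f2.karr 5 rfl, f1.karr 5 rfl]; exact hA)
      (by rw [f2.karr 6 rfl, f1.karr 6 rfl]; exact hB) (by omega)).seq
    fun s3 f3 q3 => ((haltsIn_copyBack (W := W) (src := 7) (dst := 5) (by decide)
      ((f3.ireg 15 rfl).trans ((f2.ireg 15 rfl).trans ((f1.ireg 15 rfl).trans hL))) q3.1
      (by omega)).seq
    fun s4 f4 q4 => ((haltsIn_copyBack (W := W) (src := 8) (dst := 6) (by decide)
      ((f4.ireg 15 rfl).trans
        ((f3.ireg 15 rfl).trans ((f2.ireg 15 rfl).trans ((f1.ireg 15 rfl).trans hL))))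
      (by rw [f4.karr 8 rfl]; exact q3.2) (by omega)).seq
    fun s5 f5 q5 => wp.haltsIn (Q := fun s' => s'.ireg 16 = k ∧ s'.ireg 17 = l ∧
      (∀ x < L, s'.karr 5 (x : ℕ) = fftStage k z A x) ∧
      ∀ x < L, s'.karr 6 (x : ℕ) = fftStage k z B x) ?_))))).mono ?_ fun _ _ h => h
  · have g17 : s5.ireg 17 = (l + 1 : ℕ) := by
      rw [f5.ireg 17 rfl, f4.ireg 17 rfl, f3.ireg 17 rfl, f2.ireg 17 rfl, f1.ireg 17 rfl, h17]
    have g16 : s5.ireg 16 = k := by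
      rw [f5.ireg 16 rfl, f4.ireg 16 rfl, f3.ireg 16 rfl, f2.ireg 16 rfl, q1]
    simp only [wp, TestExp.Valid, TestExp.Holds, IntExp.Valid, IntExp.eval,
    CoeffExp.Valid, CoeffExp.eval, Function.update_self, Function.update_of_ne, ne_eq,
    Nat.reduceEqDiff, OfNat.ofNat_ne_zero, OfNat.zero_ne_ofNat, OfNat.ofNat_ne_one,
    OfNat.one_ne_ofNat, not_false_eq_true, abs_le, g17, g16]
    refine ⟨by omega, trivial, by omega, ?_, q5⟩
    rw [f5.karr 5 rfl]
    exact q4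
  · simp only [maxCost, IntExp.cost]
    omega

theorem haltsIn_transform {W : ℕ} {s : MachineState K} {r : ℕ} {rt : ℕ → K} {A B : ℕ → K}
    (h13 : s.ireg 13 = r) (hL : s.ireg 15 = (2 ^ (r + 1) : ℕ))
    (hz : ∀ j < r + 1, s.karr 2 ((j + 1 : ℕ) : ℤ) = rt (j + 1))
    (hA : ∀ x < 2 ^ (r + 1), s.karr 5 (x : ℕ) = A x)
    (hB : ∀ x < 2 ^ (r + 1), s.karr 6 (x : ℕ) = B x) (hW : 2 * 2 ^ (r + 1) + r + 3 ≤ W) :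
    HaltsIn W transform s ((r + 1) * (2 ^ (r + 1) * 160 + 44) + 20) fun s' =>
      (∀ x < 2 ^ (r + 1), s'.karr 5 (x : ℕ) = fftSteps rt (r + 1) (r + 1) A x) ∧
      ∀ x < 2 ^ (r + 1), s'.karr 6 (x : ℕ) = fftSteps rt (r + 1) (r + 1) B x := by
  have hpos : 0 < 2 ^ (r + 1) := by positivity
  set L := 2 ^ (r + 1) with hLdef
  have c1 : wp W (setInt 16 (.reg 15)) (fun s' => s'.ireg 16 = (L : ℕ)) s := by
    simp only [wp, TestExp.Valid, TestExp.Holds, IntExp.Valid, IntExp.eval,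
    CoeffExp.Valid, CoeffExp.eval, Function.update_self, Function.update_of_ne, ne_eq,
    Nat.reduceEqDiff, OfNat.ofNat_ne_zero, OfNat.zero_ne_ofNat, OfNat.ofNat_ne_one,
    OfNat.one_ne_ofNat, not_false_eq_true, abs_le, hL, and_true]
    omega
  refine (c1.haltsIn.seq fun s1 f1 q1 => (wp.haltsIn (s := s1) (W := W)
    (c := setInt 17 (.add (.reg 13) (.const 1)))
    (Q := fun s' => s'.ireg 17 = (r + 1 : ℕ)) ?_).seq fun s2 f2 q2 =>
    -- Between rounds register `16` holds the full length of the current blocks (it is halved at the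
    -- start of a round), and register `17` the number of the root of that order.
    (haltsIn_while (t := L * 160 + 40) (N := r + 1) (fun j s' => s'.ireg 16 = (2 ^ (r + 1 - j) : ℕ) ∧
      s'.ireg 17 = (r + 1 - j : ℕ) ∧ (∀ x < L, s'.karr 5 (x : ℕ) = fftSteps rt (r + 1) j A x) ∧
      ∀ x < L, s'.karr 6 (x : ℕ) = fftSteps rt (r + 1) j B x) ?_ ?_ ?_)).mono ?_
    fun _ _ h => h.2.2
  · simp only [wp, TestExp.Valid, TestExp.Holds, IntExp.Valid, IntExp.eval,
    CoeffExp.Valid, CoeffExp.eval, Function.update_self, Function.update_of_ne, ne_eq,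
    Nat.reduceEqDiff, OfNat.ofNat_ne_zero, OfNat.zero_ne_ofNat, OfNat.ofNat_ne_one,
    OfNat.one_ne_ofNat, not_false_eq_true, abs_le, (f1.ireg 13 rfl).trans h13]
    omega
  · refine ⟨?_, by simpa using q2, ?_, ?_⟩
    · rw [f2.ireg 16 rfl, q1]; rfl
    · rw [f2.karr 5 rfl, f1.karr 5 rfl]; exact hA
    · rw [f2.karr 6 rfl, f1.karr 6 rfl]; exact hB
  · rintro j hj s3 f3 ⟨i1, i2, i3, i4⟩
    have e1 : r + 1 - j = r - j + 1 := by omega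
    have e2 : r + 1 - (j + 1) = r - j := by omega
    rw [e1] at i1 i2
    refine ⟨?_, ?_, ?_⟩
    · simp only [wp, TestExp.Valid, TestExp.Holds, IntExp.Valid, IntExp.eval,
    CoeffExp.Valid, CoeffExp.eval, Function.update_self, Function.update_of_ne, ne_eq,
    Nat.reduceEqDiff, OfNat.ofNat_ne_zero, OfNat.zero_ne_ofNat, OfNat.ofNat_ne_one,
    OfNat.one_ne_ofNat, not_false_eq_true, abs_le, i2]
      omega
    · simp only [wp, TestExp.Valid, TestExp.Holds, IntExp.Valid, IntExp.eval,
    CoeffExp.Valid, CoeffExp.eval, Function.update_self, Function.update_of_ne, ne_eq,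
    Nat.reduceEqDiff, OfNat.ofNat_ne_zero, OfNat.zero_ne_ofNat, OfNat.ofNat_ne_one,
    OfNat.one_ne_ofNat, not_false_eq_true, abs_le, i2]
      omega
    · rw [e2]
      refine (haltsIn_transformStep (W := W) (k := 2 ^ (r - j)) (l := r - j) (L := L)
        (z := rt (r - j + 1)) (A := fftSteps rt (r + 1) j A) (B := fftSteps rt (r + 1) j B)
        (by positivity) ?_ ?_ i2 ?_ hpos ?_ i3 i4 ?_).mono le_rfl fun s' _ h => ?_
      · rw [← mul_two, ← pow_succ]
        exact pow_dvd_pow 2 (by omega)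
      · rw [i1, pow_succ, mul_two]
      · rw [f3.ireg 15 rfl, f2.ireg 15 rfl, f1.ireg 15 rfl, hL]
      · rw [f3.karr 2 rfl, f2.karr 2 rfl, f1.karr 2 rfl, hz _ (by omega)]
      · omega
      · rw [fftSteps, fftSteps, e1, e2]
        exact h
  · rintro s3 f3 ⟨i1, i2, -⟩
    simp only [wp, TestExp.Valid, TestExp.Holds, IntExp.Valid, IntExp.eval,
    CoeffExp.Valid, CoeffExp.eval, Function.update_self, Function.update_of_ne, ne_eq,
    Nat.reduceEqDiff, OfNat.ofNat_ne_zero, OfNat.zero_ne_ofNat, OfNat.ofNat_ne_one,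
    OfNat.one_ne_ofNat, not_false_eq_true, abs_le, i2]
    omega
  · simp only [maxCost, IntExp.cost, TestExp.cost]
    have : (r + 1) * (1 + 1 + 1 + 1 + (L * 160 + 40)) = (r + 1) * (L * 160 + 44) := by ring
    omega

theorem haltsIn_untransformStep {W : ℕ} {s : MachineState K} {k l L : ℕ} {z half : K} {A : ℕ → K}
    (hk0 : 0 < k) (hkL : k + k ∣ L) (h16 : s.ireg 16 = (k : ℕ))
    (h17 : s.ireg 17 = (l : ℕ)) (hL : s.ireg 15 = L) (hL0 : 0 < L)
    (hz : s.karr 2 ((l + 1 : ℕ) : ℤ) = z) (hh : s.karr 3 0 = half)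
    (hA : ∀ x < L, s.karr 5 (x : ℕ) = A x) (hW : 2 * L + l + 3 ≤ W) :
    HaltsIn W untransformStep s (L * 160 + 40) fun s' =>
      s'.ireg 16 = (k + k : ℕ) ∧ s'.ireg 17 = (l + 1 : ℕ) ∧
      ∀ x < L, s'.karr 5 (x : ℕ) = fftUnstage k z half A x := by
  have hkl : k + k ≤ L := Nat.le_of_dvd hL0 hkL
  have c1 : wp W (setInt 17 (.add (.reg 17) (.const 1)))
      (fun s' => s'.ireg 17 = (l + 1 : ℕ)) s := by
    simp only [wp, TestExp.Valid, TestExp.Holds, IntExp.Valid, IntExp.eval,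
    CoeffExp.Valid, CoeffExp.eval, Function.update_self, Function.update_of_ne, ne_eq,
    Nat.reduceEqDiff, OfNat.ofNat_ne_zero, OfNat.zero_ne_ofNat, OfNat.ofNat_ne_one,
    OfNat.one_ne_ofNat, not_false_eq_true, abs_le, h17]
    omega
  refine (c1.haltsIn.seq fun s1 f1 q1 => ((haltsIn_rootPowers (W := W) (l := l + 1)
    ((f1.ireg 16 rfl).trans h16) q1 ((congrFun (f1.karr 2 rfl) _).trans hz) (by omega)).seq
    fun s2 f2 q2 => ((haltsIn_unstage (W := W) (A := A) (half := half) hk0 hkL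
      ((f2.ireg 16 rfl).trans ((f1.ireg 16 rfl).trans h16))
      ((f2.ireg 15 rfl).trans ((f1.ireg 15 rfl).trans hL)) q2
      (by rw [f2.karr 3 rfl, f1.karr 3 rfl]; exact hh)
      (by rw [f2.karr 5 rfl, f1.karr 5 rfl]; exact hA) (by omega)).seq
    fun s3 f3 q3 => ((haltsIn_copyBack (W := W) (src := 7) (dst := 5) (by decide)
      ((f3.ireg 15 rfl).trans ((f2.ireg 15 rfl).trans ((f1.ireg 15 rfl).trans hL))) q3
      (by omega)).seq
    fun s4 f4 q4 => wp.haltsIn (Q := fun s' => s'.ireg 16 = (k + k : ℕ) ∧ s'.ireg 17 = (l + 1 : ℕ) ∧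
      ∀ x < L, s'.karr 5 (x : ℕ) = fftUnstage k z half A x) ?_)))).mono ?_ fun _ _ h => h
  · have g17 : s4.ireg 17 = (l + 1 : ℕ) := by
      rw [f4.ireg 17 rfl, f3.ireg 17 rfl, f2.ireg 17 rfl, q1]
    have g16 : s4.ireg 16 = k := by
      rw [f4.ireg 16 rfl, f3.ireg 16 rfl, f2.ireg 16 rfl, f1.ireg 16 rfl, h16]
    simp only [wp, TestExp.Valid, TestExp.Holds, IntExp.Valid, IntExp.eval,
    CoeffExp.Valid, CoeffExp.eval, Function.update_self, Function.update_of_ne, ne_eq,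
    Nat.reduceEqDiff, OfNat.ofNat_ne_zero, OfNat.zero_ne_ofNat, OfNat.ofNat_ne_one,
    OfNat.one_ne_ofNat, not_false_eq_true, abs_le, g17, g16]
    exact ⟨by omega, by omega, trivial, q4⟩
  · simp only [maxCost, IntExp.cost]
    omega

theorem haltsIn_untransform {W : ℕ} {s : MachineState K} {r : ℕ} {rt : ℕ → K} {half : K}
    {A : ℕ → K} (h13 : s.ireg 13 = r) (hL : s.ireg 15 = (2 ^ (r + 1) : ℕ))
    (hz : ∀ j < r + 1, s.karr 2 ((j + 1 : ℕ) : ℤ) = rt (j + 1)) (hh : s.karr 3 0 = half)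
    (hA : ∀ x < 2 ^ (r + 1), s.karr 5 (x : ℕ) = A x) (hW : 2 * 2 ^ (r + 1) + r + 3 ≤ W) :
    HaltsIn W untransform s ((r + 1) * (2 ^ (r + 1) * 160 + 46) + 20) fun s' =>
      ∀ x < 2 ^ (r + 1), s'.karr 5 (x : ℕ) = fftUnsteps rt half (r + 1) A x := by
  have hpos : 0 < 2 ^ (r + 1) := by positivity
  set L := 2 ^ (r + 1) with hLdef
  have c1 : wp W (setInt 16 (.const 1)) (fun s' => s'.ireg 16 = (1 : ℕ)) s := by
    simp only [wp, TestExp.Valid, TestExp.Holds, IntExp.Valid, IntExp.eval,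
    CoeffExp.Valid, CoeffExp.eval, Function.update_self, Function.update_of_ne, ne_eq,
    Nat.reduceEqDiff, OfNat.ofNat_ne_zero, OfNat.zero_ne_ofNat, OfNat.ofNat_ne_one,
    OfNat.one_ne_ofNat, not_false_eq_true, abs_le]
    omega
  refine (c1.haltsIn.seq fun s1 f1 q1 => (wp.haltsIn (s := s1) (W := W)
    (c := setInt 17 (.const 0)) (Q := fun s' => s'.ireg 17 = (0 : ℕ)) ?_).seq fun s2 f2 q2 =>
    (haltsIn_while (t := L * 160 + 40) (N := r + 1) (fun j s' => s'.ireg 16 = (2 ^ j : ℕ) ∧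
      s'.ireg 17 = (j : ℕ) ∧ ∀ x < L, s'.karr 5 (x : ℕ) = fftUnsteps rt half j A x)
      ?_ ?_ ?_)).mono ?_ fun _ _ h => h.2.2
  · simp only [wp, TestExp.Valid, TestExp.Holds, IntExp.Valid, IntExp.eval,
    CoeffExp.Valid, CoeffExp.eval, Function.update_self, Function.update_of_ne, ne_eq,
    Nat.reduceEqDiff, OfNat.ofNat_ne_zero, OfNat.zero_ne_ofNat, OfNat.ofNat_ne_one,
    OfNat.one_ne_ofNat, not_false_eq_true, abs_le]
    omega
  · refine ⟨?_, q2, ?_⟩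
    · rw [f2.ireg 16 rfl, q1]; rfl
    · rw [f2.karr 5 rfl, f1.karr 5 rfl]; exact hA
  · rintro j hj s3 f3 ⟨i1, i2, i3⟩
    have g13 : s3.ireg 13 = r := by rw [f3.ireg 13 rfl, f2.ireg 13 rfl, f1.ireg 13 rfl, h13]
    refine ⟨?_, ?_, ?_⟩
    · simp only [wp, TestExp.Valid, TestExp.Holds, IntExp.Valid, IntExp.eval,
    CoeffExp.Valid, CoeffExp.eval, Function.update_self, Function.update_of_ne, ne_eq,
    Nat.reduceEqDiff, OfNat.ofNat_ne_zero, OfNat.zero_ne_ofNat, OfNat.ofNat_ne_one,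
    OfNat.one_ne_ofNat, not_false_eq_true, abs_le, i2, g13]
      omega
    · simp only [wp, TestExp.Valid, TestExp.Holds, IntExp.Valid, IntExp.eval,
    CoeffExp.Valid, CoeffExp.eval, Function.update_self, Function.update_of_ne, ne_eq,
    Nat.reduceEqDiff, OfNat.ofNat_ne_zero, OfNat.zero_ne_ofNat, OfNat.ofNat_ne_one,
    OfNat.one_ne_ofNat, not_false_eq_true, abs_le, i2, g13]
      omega
    · refine (haltsIn_untransformStep (W := W) (k := 2 ^ j) (l := j) (L := L)
        (z := rt (j + 1)) (half := half) (A := fftUnsteps rt half j A)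
        (by positivity) ?_ i1 i2 ?_ hpos ?_ ?_ i3 ?_).mono le_rfl fun s' _ h => ?_
      · rw [← mul_two, ← pow_succ]
        exact pow_dvd_pow 2 (by omega)
      · rw [f3.ireg 15 rfl, f2.ireg 15 rfl, f1.ireg 15 rfl, hL]
      · rw [f3.karr 2 rfl, f2.karr 2 rfl, f1.karr 2 rfl, hz _ (by omega)]
      · rw [f3.karr 3 rfl, f2.karr 3 rfl, f1.karr 3 rfl, hh]
      · omega
      · rw [pow_succ, mul_two]
        exact h
  · rintro s3 f3 ⟨i1, i2, -⟩
    have g13 : s3.ireg 13 = r := by rw [f3.ireg 13 rfl, f2.ireg 13 rfl, f1.ireg 13 rfl, h13]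
    simp only [wp, TestExp.Valid, TestExp.Holds, IntExp.Valid, IntExp.eval,
    CoeffExp.Valid, CoeffExp.eval, Function.update_self, Function.update_of_ne, ne_eq,
    Nat.reduceEqDiff, OfNat.ofNat_ne_zero, OfNat.zero_ne_ofNat, OfNat.ofNat_ne_one,
    OfNat.one_ne_ofNat, not_false_eq_true, abs_le, i2, g13]
    omega
  · simp only [maxCost, IntExp.cost, TestExp.cost]
    have : (r + 1) * (1 + (1 + 1 + 1) + 1 + 1 + (L * 160 + 40)) = (r + 1) * (L * 160 + 46) := by
      ring
    omega

/-- The contribution of the square with corner `(X, Y)` and `m ^ 2` lattice points to the sum over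
the diagonal `k`, restricted to a set of lattice points. -/
noncomputable def squareSum (a b : ℤ → K) (S : ℤ → ℤ → Prop) [DecidableRel S] (m : ℕ) (X Y k : ℤ) :
    K :=
  ∑ u ∈ Finset.range m, ∑ v ∈ Finset.range m,
    if (X + u) + (Y + v) = k ∧ S (X + u) (Y + v) then a (X + u) * b (Y + v) else 0

/-- When all points of the square belong to `S`, the restriction to `S` is void and the diagonal
sums are the coefficients of a product of two polynomials, shifted by `X + Y`. -/
theorem haltsIn_convolve {W : ℕ} {s : MachineState K} {X Y : ℤ} {r : ℕ} {rt : ℕ → K} {half : K}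
    (S : ℤ → ℤ → Prop) [DecidableRel S] (hS : ∀ u < 2 ^ r, ∀ v < 2 ^ r, S (X + (u : ℕ)) (Y + (v : ℕ)))
    (h10 : s.ireg 10 = X) (h11 : s.ireg 11 = Y) (h12 : s.ireg 12 = (2 ^ r : ℕ))
    (h13 : s.ireg 13 = r) (hz : ∀ j < r + 1, s.karr 2 ((j + 1 : ℕ) : ℤ) = rt (j + 1))
    (hrt : ∀ j < r + 1, rt (j + 1) ^ 2 ^ j = -1)
    (hh : s.karr 3 0 = half) (hhalf : 2 * half = 1)
    (hW : |X| + |Y| + 5 * 2 ^ r + r + 3 ≤ W) :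
    HaltsIn W convolve s (2 ^ r * (r + 1) * 1400) fun s' =>
      ∀ k : ℤ, s'.karr 4 k = s.karr 4 k + squareSum (s.karr 0) (s.karr 1) S (2 ^ r) X Y k := by
  have a1 := abs_nonneg X
  have a2 := abs_nonneg Y
  have hpos : 0 < 2 ^ r := by positivity
  have hLdef : 2 ^ (r + 1) = 2 ^ r + 2 ^ r := by rw [pow_succ, mul_two]
  have hWr : 2 * 2 ^ (r + 1) + r + 3 ≤ W := by
    zify
    zify at hLdef hpos
    linarith
  have c1 : wp W (setInt 15 (.add (.reg 12) (.reg 12)))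
      (fun s' => s'.ireg 15 = (2 ^ (r + 1) : ℕ)) s := by
    simp only [wp, TestExp.Valid, TestExp.Holds, IntExp.Valid, IntExp.eval,
    CoeffExp.Valid, CoeffExp.eval, Function.update_self, Function.update_of_ne, ne_eq,
    Nat.reduceEqDiff, OfNat.ofNat_ne_zero, OfNat.zero_ne_ofNat, OfNat.ofNat_ne_one,
    OfNat.one_ne_ofNat, not_false_eq_true, abs_le, h12, hLdef]
    omega
  have hWL : |X| + |Y| + ((2 ^ (r + 1) : ℕ) : ℤ) + 1 ≤ W := by
    zify at hLdef hpos
    push_cast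
    linarith
  have hWL' : |X| + |Y| + ((2 ^ r : ℕ) : ℤ) + ((2 ^ (r + 1) : ℕ) : ℤ) + 1 ≤ W := by
    zify at hLdef hpos
    push_cast
    linarith
  set A : ℕ → K := fun x => if x < 2 ^ r then s.karr 0 (X + x) else 0 with hA
  set B : ℕ → K := fun x => if x < 2 ^ r then s.karr 1 (Y + x) else 0 with hB
  have key : HaltsIn W convolve s (4 + (2 ^ (r + 1) * 40 + 6 + ((r + 1) * (2 ^ (r + 1) * 160 + 44)
      + 20 + (2 ^ (r + 1) * 20 + 6 + ((r + 1) * (2 ^ (r + 1) * 160 + 46) + 20 +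
      (2 ^ (r + 1) * 40 + 6)))))) fun s' =>
      ∀ k : ℤ, s'.karr 4 k = s.karr 4 k + squareSum (s.karr 0) (s.karr 1) S (2 ^ r) X Y k := by
    refine c1.haltsIn.seq fun s1 f1 q1 => (haltsIn_loadOperands (W := W) (X := X) (Y := Y)
      ((f1.ireg 10 rfl).trans h10) ((f1.ireg 11 rfl).trans h11) ((f1.ireg 12 rfl).trans h12) q1
      hWL').seq fun s2 f2 q2 => ?_
    rw [f1.karr 0 rfl, f1.karr 1 rfl] at q2
    have g15 : s2.ireg 15 = (2 ^ (r + 1) : ℕ) := (f2.ireg 15 rfl).trans q1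
    refine (haltsIn_transform (W := W) (r := r) (rt := rt) (A := A) (B := B)
      (by rw [f2.ireg 13 rfl, f1.ireg 13 rfl, h13]) g15
      (by rw [f2.karr 2 rfl, f1.karr 2 rfl]; exact hz) q2.1 q2.2 hWr).seq fun s3 f3 q3 => ?_
    refine (haltsIn_multiplyPointwise (W := W) ((f3.ireg 15 rfl).trans g15) q3.1 q3.2
      (by omega)).seq fun s4 f4 q4 => ?_
    have k15 : s4.ireg 15 = (2 ^ (r + 1) : ℕ) := by rw [f4.ireg 15 rfl, f3.ireg 15 rfl, g15]
    refine (haltsIn_untransform (W := W) (r := r) (rt := rt) (half := half)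
      (by rw [f4.ireg 13 rfl, f3.ireg 13 rfl, f2.ireg 13 rfl, f1.ireg 13 rfl, h13]) k15
      (by rw [f4.karr 2 rfl, f3.karr 2 rfl, f2.karr 2 rfl, f1.karr 2 rfl]; exact hz)
      (by rw [f4.karr 3 rfl, f3.karr 3 rfl, f2.karr 3 rfl, f1.karr 3 rfl]; exact hh) q4
      hWr).seq fun s5 f5 q5 => ?_
    refine (haltsIn_accumulate (W := W) (X := X) (Y := Y) (A := convolution (2 ^ r) A B)
      (by rw [f5.ireg 10 rfl, f4.ireg 10 rfl, f3.ireg 10 rfl, f2.ireg 10 rfl, f1.ireg 10 rfl, h10])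
      (by rw [f5.ireg 11 rfl, f4.ireg 11 rfl, f3.ireg 11 rfl, f2.ireg 11 rfl, f1.ireg 11 rfl, h11])
      ((f5.ireg 15 rfl).trans k15) (fun x hx => ?_) hWL).mono le_rfl fun s6 _ q6 k => ?_
    · rw [q5 x hx]
      refine fftUnsteps_mul hrt hhalf (fun y _ hy => ?_) (fun y _ hy => ?_) (fun _ _ => rfl) x hx
      · simp [hA, hy]
      · simp [hB, hy]
    · rw [q6, f5.karr 4 rfl, f4.karr 4 rfl, f3.karr 4 rfl, f2.karr 4 rfl, f1.karr 4 rfl]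
      congr 1
      simp only [convolution, squareSum]
      -- The diagonal condition moves inside, so that after exchanging the sums the one over `x`
      -- collapses to `x = u + v`.
      have : ∀ x ∈ Finset.range (2 ^ (r + 1)), (if X + Y + (x : ℤ) = k then
          ∑ u ∈ Finset.range (2 ^ r), ∑ v ∈ Finset.range (2 ^ r),
            (if u + v = x then A u * B v else 0) else 0) =
          ∑ u ∈ Finset.range (2 ^ r), ∑ v ∈ Finset.range (2 ^ r),
            if u + v = x then (if X + Y + (x : ℤ) = k then A u * B v else 0) else 0 := by
        intro x _
        split_ifs
        · rfl
        · simp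
      rw [Finset.sum_congr rfl this, Finset.sum_comm]
      refine Finset.sum_congr rfl fun u hu => ?_
      rw [Finset.sum_comm]
      refine Finset.sum_congr rfl fun v hv => ?_
      rw [Finset.mem_range] at hu hv
      rw [Finset.sum_ite_eq, if_pos (Finset.mem_range.2 (by omega))]
      have e : X + Y + ((u + v : ℕ) : ℤ) = X + u + (Y + v) := by push_cast; ring
      simp only [hA, hB, if_pos hu, if_pos hv, e, hS u hu v hv, and_true]
  · refine key.mono ?_ fun _ _ h => h
    rw [hLdef]
    -- All lower order terms of the time are absorbed by multiples of `2 ^ r * (r + 1)`.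
    have : 1 ≤ 2 ^ r * (r + 1) := Nat.mul_pos hpos (by omega)
    have h2 : 2 ^ r ≤ 2 ^ r * (r + 1) := Nat.le_mul_of_pos_right _ (by omega)
    have h3 : r + 1 ≤ 2 ^ r * (r + 1) := Nat.le_mul_of_pos_left _ hpos
    have h4 : (r + 1) * ((2 ^ r + 2 ^ r) * 160 + 44) = 2 ^ r * (r + 1) * 320 + (r + 1) * 44 := by
      ring
    have h5 : (r + 1) * ((2 ^ r + 2 ^ r) * 160 + 46) = 2 ^ r * (r + 1) * 320 + (r + 1) * 46 := by
      ring
    rw [h4, h5]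
    clear h4 h5
    generalize 2 ^ r * (r + 1) = Z at *
    generalize 2 ^ r = Y at *
    omega

end Program

/-! ### Position of a square relative to the triangle. -/

/-- The affine function number `k` whose coefficients are kept in real registers. -/
noncomputable def affineAt (c : ℕ → ℝ) (k : ℕ) (x y : ℤ) : ℝ :=
  c (7 + 3 * k) * x + c (8 + 3 * k) * y + c (9 + 3 * k)

/-- A property of an affine function that is to hold at the corners of a square with `m ^ 2` lattice
points. -/
def AtCorners (p : ℤ → ℤ → Prop) (m X Y : ℤ) : Prop :=
  p X Y ∧ p (X + (m - 1)) Y ∧ p X (Y + (m - 1)) ∧ p (X + (m - 1)) (Y + (m - 1))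

/-- The square lies in the interior of the triangle. -/
def IsInner (c : ℕ → ℝ) (m X Y : ℤ) : Prop :=
  AtCorners (fun x y => 0 < affineAt c 0 x y) m X Y ∧
  AtCorners (fun x y => 0 < affineAt c 1 x y) m X Y ∧
  AtCorners (fun x y => 0 < affineAt c 2 x y) m X Y

/-- The square lies on the outer side of one of the edges. -/
def IsOuter (c : ℕ → ℝ) (m X Y : ℤ) : Prop :=
  AtCorners (fun x y => affineAt c 0 x y < 0) m X Y ∨
  AtCorners (fun x y => affineAt c 1 x y < 0) m X Y ∨
  AtCorners (fun x y => affineAt c 2 x y < 0) m X Y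

/-- Membership in a triangle in terms of barycentric coordinates: the point is in the interior, in
one of the open edges singled out by `E`, or one of the vertices singled out by `V`. -/
def IsMember (E V : ℕ → Prop) (l₀ l₁ l₂ : ℝ) : Prop :=
  (0 < l₀ ∧ 0 < l₁ ∧ 0 < l₂) ∨
  (E 0 ∧ l₀ = 0 ∧ 0 < l₁ ∧ 0 < l₂) ∨ (E 1 ∧ l₁ = 0 ∧ 0 < l₂ ∧ 0 < l₀) ∨
  (E 2 ∧ l₂ = 0 ∧ 0 < l₀ ∧ 0 < l₁) ∨
  (V 0 ∧ 0 < l₀ ∧ l₁ = 0 ∧ l₂ = 0) ∨ (V 1 ∧ 0 < l₁ ∧ l₂ = 0 ∧ l₀ = 0) ∨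
  (V 2 ∧ 0 < l₂ ∧ l₀ = 0 ∧ l₁ = 0)

theorem IsMember.nonneg {E V : ℕ → Prop} {l₀ l₁ l₂ : ℝ} (h : IsMember E V l₀ l₁ l₂) :
    0 ≤ l₀ ∧ 0 ≤ l₁ ∧ 0 ≤ l₂ := by
  rcases h with h | h | h | h | h | h | h <;>
    exact ⟨by linarith [h.1, h.2], by linarith [h.1, h.2], by linarith [h.1, h.2]⟩

/-- An affine function attains its minimum over a square at a corner; the signs of `α` and `β` tell
which one. -/
theorem affine_pos_of_corners {α β γ X Y d u v : ℝ} (hu : 0 ≤ u) (hud : u ≤ d) (hv : 0 ≤ v)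
    (hvd : v ≤ d) (h1 : 0 < α * X + β * Y + γ) (h2 : 0 < α * (X + d) + β * Y + γ)
    (h3 : 0 < α * X + β * (Y + d) + γ) (h4 : 0 < α * (X + d) + β * (Y + d) + γ) :
    0 < α * (X + u) + β * (Y + v) + γ := by
  rcases le_total 0 α with ha | ha <;> rcases le_total 0 β with hb | hb
  · nlinarith [mul_nonneg ha hu, mul_nonneg hb hv]
  · nlinarith [mul_nonneg ha hu, mul_le_mul_of_nonpos_left hvd hb]
  · nlinarith [mul_le_mul_of_nonpos_left hud ha, mul_nonneg hb hv]
  · nlinarith [mul_le_mul_of_nonpos_left hud ha, mul_le_mul_of_nonpos_left hvd hb]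

theorem AtCorners.affine_pos {c : ℕ → ℝ} {k : ℕ} {m : ℕ} {X Y : ℤ}
    (h : AtCorners (fun x y => 0 < affineAt c k x y) m X Y) {u v : ℕ} (hu : u < m) (hv : v < m) :
    0 < affineAt c k (X + u) (Y + v) := by
  obtain ⟨h1, h2, h3, h4⟩ := h
  simp only [affineAt] at *
  push_cast at *
  have hu' : (u : ℝ) + 1 ≤ m := by exact_mod_cast hu
  have hv' : (v : ℝ) + 1 ≤ m := by exact_mod_cast hv
  exact affine_pos_of_corners (d := m - 1) (Nat.cast_nonneg _) (by linarith) (Nat.cast_nonneg _)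
    (by linarith) h1 h2 h3 h4

theorem AtCorners.affine_neg {c : ℕ → ℝ} {k : ℕ} {m : ℕ} {X Y : ℤ}
    (h : AtCorners (fun x y => affineAt c k x y < 0) m X Y) {u v : ℕ} (hu : u < m) (hv : v < m) :
    affineAt c k (X + u) (Y + v) < 0 := by
  have e : ∀ x y, affineAt (fun i => - c i) k x y = - affineAt c k x y := by
    intro x y
    simp only [affineAt]
    ring
  have h' : AtCorners (fun x y => 0 < affineAt (fun i => - c i) k x y) m X Y := by
    simpa only [AtCorners, e, neg_pos] using h
  have := h'.affine_pos hu hv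
  rw [e] at this
  linarith

/-- The lattice points of the triangle described by the registers of a state. -/
def IsMemberAt (c : ℕ → ℝ) (E V : ℕ → Prop) (x y : ℤ) : Prop :=
  IsMember E V (affineAt c 0 x y) (affineAt c 1 x y) (affineAt c 2 x y)

theorem IsInner.isMemberAt {c : ℕ → ℝ} {m : ℕ} {X Y : ℤ} (h : IsInner c m X Y) (E V : ℕ → Prop)
    {u v : ℕ} (hu : u < m) (hv : v < m) : IsMemberAt c E V (X + u) (Y + v) :=
  Or.inl ⟨h.1.affine_pos hu hv, h.2.1.affine_pos hu hv, h.2.2.affine_pos hu hv⟩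

theorem IsOuter.not_isMemberAt {c : ℕ → ℝ} {m : ℕ} {X Y : ℤ} (h : IsOuter c m X Y)
    (E V : ℕ → Prop) {u v : ℕ} (hu : u < m) (hv : v < m) :
    ¬ IsMemberAt c E V (X + u) (Y + v) := by
  intro hm
  obtain ⟨h0, h1, h2⟩ := IsMember.nonneg hm
  rcases h with h | h | h
  · exact (h.affine_neg hu hv).not_ge h0
  · exact (h.affine_neg hu hv).not_ge h1
  · exact (h.affine_neg hu hv).not_ge h2

/-! ### The geometric tests of the program. -/

namespace TestExp

/-- Disjunction. -/
def either (b c : TestExp) : TestExp := not (and (not b) (not c))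

variable {K : Type*} {s : MachineState K} {W : ℕ}

@[simp] theorem either_holds {b c : TestExp} : (either b c).Holds s ↔ b.Holds s ∨ c.Holds s := by
  simp only [either, Holds]
  tauto

@[simp] theorem either_valid {b c : TestExp} :
    (either b c).Valid W s ↔ b.Valid W s ∧ c.Valid W s := Iff.rfl

end TestExp

def affineExp (k : ℕ) (x y : IntExp) : RealExp :=
  .add (.add (.mul (.reg (7 + 3 * k)) (.ofInt x)) (.mul (.reg (8 + 3 * k)) (.ofInt y)))
    (.reg (9 + 3 * k))

def posTest (k : ℕ) (x y : IntExp) : TestExp := .realLT (.ofInt (.const 0)) (affineExp k x y)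

def negTest (k : ℕ) (x y : IntExp) : TestExp := .realLT (affineExp k x y) (.ofInt (.const 0))

/-- Strict comparison is the only primitive, so equality is tested by excluding both strict
inequalities. -/
def zeroTest (k : ℕ) (x y : IntExp) : TestExp := .and (.not (posTest k x y)) (.not (negTest k x y))

def bitTest (i : ℕ) : TestExp := .intLT (.const 0) (.reg i)

def farReg (i : ℕ) : IntExp := .add (.reg i) (.sub (.reg 12) (.const 1))

def cornersTest (p : IntExp → IntExp → TestExp) : TestExp :=
  .and (p (.reg 10) (.reg 11)) (.and (p (farReg 10) (.reg 11))
    (.and (p (.reg 10) (farReg 11)) (p (farReg 10) (farReg 11))))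

def innerTest : TestExp :=
  .and (cornersTest (posTest 0)) (.and (cornersTest (posTest 1)) (cornersTest (posTest 2)))

def outerTest : TestExp :=
  .either (cornersTest (negTest 0)) (.either (cornersTest (negTest 1)) (cornersTest (negTest 2)))

def posHere (k : ℕ) : TestExp := posTest k (.reg 10) (.reg 11)

def zeroHere (k : ℕ) : TestExp := zeroTest k (.reg 10) (.reg 11)

def edgeTest (i j k : ℕ) : TestExp :=
  .and (bitTest (1 + i)) (.and (zeroHere i) (.and (posHere j) (posHere k)))

def vertexTest (i j k : ℕ) : TestExp :=
  .and (bitTest (4 + i)) (.and (posHere i) (.and (zeroHere j) (zeroHere k)))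

def memberTest : TestExp :=
  .either (.and (posHere 0) (.and (posHere 1) (posHere 2)))
    (.either (edgeTest 0 1 2) (.either (edgeTest 1 2 0) (.either (edgeTest 2 0 1)
      (.either (vertexTest 0 1 2) (.either (vertexTest 1 2 0) (vertexTest 2 0 1))))))

section

variable {K : Type*} {s : MachineState K} {W : ℕ}

theorem posTest_valid {k : ℕ} {x y : IntExp} (hx : x.Valid W s) (hy : y.Valid W s) :
    (posTest k x y).Valid W s := by
  simp [posTest, affineExp, TestExp.Valid, RealExp.Valid, IntExp.Valid, hx, hy]

theorem negTest_valid {k : ℕ} {x y : IntExp} (hx : x.Valid W s) (hy : y.Valid W s) :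
    (negTest k x y).Valid W s := by
  simp [negTest, affineExp, TestExp.Valid, RealExp.Valid, IntExp.Valid, hx, hy]

theorem posTest_holds {k : ℕ} {x y : IntExp} :
    (posTest k x y).Holds s ↔ 0 < affineAt s.rreg k (x.eval s) (y.eval s) := by
  simp [posTest, affineExp, TestExp.Holds, RealExp.eval, IntExp.eval, affineAt]

theorem negTest_holds {k : ℕ} {x y : IntExp} :
    (negTest k x y).Holds s ↔ affineAt s.rreg k (x.eval s) (y.eval s) < 0 := by
  simp [negTest, affineExp, TestExp.Holds, RealExp.eval, IntExp.eval, affineAt]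

theorem zeroTest_holds {k : ℕ} {x y : IntExp} :
    (zeroTest k x y).Holds s ↔ affineAt s.rreg k (x.eval s) (y.eval s) = 0 := by
  simp only [zeroTest, TestExp.Holds, posTest_holds, negTest_holds, not_lt]
  exact le_antisymm_iff.symm

theorem innerTest_holds : innerTest.Holds s ↔
    IsInner s.rreg (s.ireg 12) (s.ireg 10) (s.ireg 11) := by
  simp only [innerTest, cornersTest, TestExp.Holds, posTest_holds, farReg, IntExp.eval, IsInner,
    AtCorners]

theorem outerTest_holds : outerTest.Holds s ↔
    IsOuter s.rreg (s.ireg 12) (s.ireg 10) (s.ireg 11) := by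
  simp only [outerTest, cornersTest, TestExp.Holds, TestExp.either_holds, negTest_holds, farReg,
    IntExp.eval, IsOuter, AtCorners]

theorem memberTest_holds : memberTest.Holds s ↔
    IsMemberAt s.rreg (fun i => 0 < s.ireg (1 + i)) (fun i => 0 < s.ireg (4 + i))
      (s.ireg 10) (s.ireg 11) := by
  simp only [memberTest, edgeTest, vertexTest, posHere, zeroHere, bitTest, TestExp.Holds,
    TestExp.either_holds, posTest_holds, zeroTest_holds, IntExp.eval, IsMemberAt, IsMember]

theorem cornersTest_valid {p : IntExp → IntExp → TestExp}
    (hp : ∀ x y : IntExp, x.Valid W s → y.Valid W s → (p x y).Valid W s)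
    (h : |s.ireg 10| + |s.ireg 11| + |s.ireg 12| + 1 ≤ W) : (cornersTest p).Valid W s := by
  have a1 := abs_le.1 (le_refl |s.ireg 10|)
  have a2 := abs_le.1 (le_refl |s.ireg 11|)
  have a3 := abs_le.1 (le_refl |s.ireg 12|)
  have v1 : (IntExp.reg 10).Valid W s := by
    simp only [IntExp.Valid, abs_le]; omega
  have v2 : (IntExp.reg 11).Valid W s := by
    simp only [IntExp.Valid, abs_le]; omega
  have v3 : (farReg 10).Valid W s := by
    simp only [farReg, IntExp.Valid, IntExp.eval, abs_le]; omega
  have v4 : (farReg 11).Valid W s := by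
    simp only [farReg, IntExp.Valid, IntExp.eval, abs_le]; omega
  exact ⟨hp _ _ v1 v2, hp _ _ v3 v2, hp _ _ v1 v4, hp _ _ v3 v4⟩

theorem innerTest_valid (h : |s.ireg 10| + |s.ireg 11| + |s.ireg 12| + 1 ≤ W) :
    innerTest.Valid W s :=
  ⟨cornersTest_valid (fun _ _ => posTest_valid) h, cornersTest_valid (fun _ _ => posTest_valid) h,
    cornersTest_valid (fun _ _ => posTest_valid) h⟩

theorem outerTest_valid (h : |s.ireg 10| + |s.ireg 11| + |s.ireg 12| + 1 ≤ W) :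
    outerTest.Valid W s :=
  ⟨cornersTest_valid (fun _ _ => negTest_valid) h, cornersTest_valid (fun _ _ => negTest_valid) h,
    cornersTest_valid (fun _ _ => negTest_valid) h⟩

theorem memberTest_valid (h10 : |s.ireg 10| ≤ W) (h11 : |s.ireg 11| ≤ W)
    (h : ∀ i < 7, |s.ireg i| ≤ W) : memberTest.Valid W s := by
  have hp : ∀ k, (posHere k).Valid W s := fun k => posTest_valid h10 h11
  have hn : ∀ k, (negTest k (.reg 10) (.reg 11)).Valid W s := fun k => negTest_valid h10 h11
  have hz : ∀ k, (zeroHere k).Valid W s := fun k => ⟨hp k, hn k⟩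
  have hb : ∀ i < 7, (bitTest i).Valid W s := fun i hi => by
    simpa [bitTest, TestExp.Valid, IntExp.Valid] using h i hi
  simp only [memberTest, edgeTest, vertexTest, TestExp.either_valid, TestExp.Valid, hp, hz,
    and_self, true_and, and_true]
  exact ⟨hb _ (by decide), hb _ (by decide), hb _ (by decide), hb _ (by decide), hb _ (by decide),
    hb _ (by decide)⟩

end

/-! ### The quadtree, traversed with an explicit stack. -/

namespace Program

/-! The square number `h` on the stack is kept in cell `h` of the integer arrays `0`, …, `3`: its
corner, its size `2 ^ r` and `r`. The height of the stack is in register `14`. -/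

def pop : Program :=
  seq (setInt 14 (.sub (.reg 14) (.const 1))) (seq (setInt 10 (.load 0 (.reg 14)))
    (seq (setInt 11 (.load 1 (.reg 14))) (seq (setInt 12 (.load 2 (.reg 14)))
      (setInt 13 (.load 3 (.reg 14))))))

def push (x y : IntExp) : Program :=
  seq (storeInt 0 (.reg 14) x) (seq (storeInt 1 (.reg 14) y)
    (seq (storeInt 2 (.reg 14) (.reg 22)) (seq (storeInt 3 (.reg 14) (.reg 13))
      (setInt 14 (.add (.reg 14) (.const 1))))))

def pushChildren : Program :=
  seq (setInt 22 (.div (.reg 12) (.const 2))) (seq (setInt 13 (.sub (.reg 13) (.const 1)))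
    (seq (push (.reg 10) (.reg 11)) (seq (push (.add (.reg 10) (.reg 22)) (.reg 11))
      (seq (push (.reg 10) (.add (.reg 11) (.reg 22)))
        (push (.add (.reg 10) (.reg 22)) (.add (.reg 11) (.reg 22)))))))

/-- Only here do the chosen edges and vertices matter: a square of one point is decided exactly,
whereas larger squares are settled by strict inequalities or split. -/
def leaf : Program :=
  ite memberTest (storeCoeff 4 (.add (.reg 10) (.reg 11))
    (.add (.load 4 (.add (.reg 10) (.reg 11))) (.mul (.load 0 (.reg 10)) (.load 1 (.reg 11))))) skip

def processSquare : Program :=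
  seq pop (ite (.intLT (.reg 13) (.const 1)) leaf
    (ite innerTest convolve (ite outerTest skip pushChildren)))

def stackTest : TestExp := .intLT (.const 0) (.reg 14)

/-- The square number `h` on the stack. -/
def OnStack {K : Type*} (s : MachineState K) (h : ℕ) (X Y : ℤ) (r : ℕ) : Prop :=
  s.iarr 0 h = X ∧ s.iarr 1 h = Y ∧ s.iarr 2 h = (2 ^ r : ℕ) ∧ s.iarr 3 h = r

variable {K : Type*} [Field K]

theorem OnStack.congr {s s' : MachineState K} {h : ℕ} {X Y : ℤ} {r : ℕ} (ho : OnStack s h X Y r)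
    (e : ∀ m, s'.iarr m h = s.iarr m h) : OnStack s' h X Y r := by
  simpa only [OnStack, e] using ho

theorem haltsIn_pop {W : ℕ} {s : MachineState K} {h : ℕ} {X Y : ℤ} {r : ℕ}
    (h14 : s.ireg 14 = (h + 1 : ℕ)) (ho : OnStack s h X Y r) (hh : h + 1 ≤ W) (hX : |X| ≤ W)
    (hY : |Y| ≤ W) (hr : 2 ^ r ≤ W) :
    HaltsIn W pop s 16 fun s' => s'.ireg 14 = h ∧ s'.ireg 10 = X ∧ s'.ireg 11 = Y ∧
      s'.ireg 12 = (2 ^ r : ℕ) ∧ s'.ireg 13 = r := by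
  obtain ⟨o1, o2, o3, o4⟩ := ho
  have hr' : r < 2 ^ r := Nat.lt_two_pow_self
  rw [abs_le] at hX hY
  refine (wp.haltsIn ?_).mono (by decide) fun _ _ h => h
  have e : ((h + 1 : ℕ) : ℤ) - 1 = h := by push_cast; ring
  simp only [pop, wp, TestExp.Valid, TestExp.Holds, IntExp.Valid, IntExp.eval,
    CoeffExp.Valid, CoeffExp.eval, Function.update_self, Function.update_of_ne, ne_eq,
    Nat.reduceEqDiff, OfNat.ofNat_ne_zero, OfNat.zero_ne_ofNat, OfNat.ofNat_ne_one,
    OfNat.one_ne_ofNat, not_false_eq_true, abs_le, h14, e, o1, o2, o3, o4, and_true]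
  omega

/-- The hypotheses on `x` and `y` range over all states with the same integer registers, because `y`
is evaluated after an array has already been changed. -/
theorem haltsIn_push {W : ℕ} {s : MachineState K} {h : ℕ} {x y : IntExp} {X Y : ℤ} {r : ℕ}
    (h14 : s.ireg 14 = (h : ℕ)) (h22 : s.ireg 22 = (2 ^ r : ℕ)) (h13 : s.ireg 13 = r)
    (hx : ∀ s' : MachineState K, s'.ireg = s.ireg → x.Valid W s' ∧ x.eval s' = X)
    (hy : ∀ s' : MachineState K, s'.ireg = s.ireg → y.Valid W s' ∧ y.eval s' = Y)
    (hh : h + 1 ≤ W) (hr : 2 ^ r ≤ W) :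
    HaltsIn W (push x y) s (x.cost + y.cost + 15) fun s' => s'.ireg 14 = (h + 1 : ℕ) ∧
      OnStack s' h X Y r ∧ ∀ m (j : ℕ), j ≠ h → s'.iarr m j = s.iarr m j := by
  have hr' : r < 2 ^ r := Nat.lt_two_pow_self
  refine (wp.haltsIn ?_).mono (by simp only [push, maxCost, IntExp.cost]; omega) fun _ _ h => h
  simp only [push, wp, TestExp.Valid, TestExp.Holds, IntExp.Valid, IntExp.eval,
    CoeffExp.Valid, CoeffExp.eval, Function.update_self, Function.update_of_ne, ne_eq,
    Nat.reduceEqDiff, OfNat.ofNat_ne_zero, OfNat.zero_ne_ofNat, OfNat.ofNat_ne_one,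
    OfNat.one_ne_ofNat, not_false_eq_true, abs_le, h14, h22, h13, hx s rfl]
  have hy' := fun s' e => (hy s' e).1
  have hy'' := fun s' e => (hy s' e).2
  refine ⟨by omega, trivial, by omega, hy' _ rfl, by omega, by omega, by omega, by omega,
    by omega, by push_cast; rfl, ?_, ?_⟩
  · simp [OnStack, Function.update_apply, hy'']
  · intro m j hj
    simp only [Function.update_apply]
    split_ifs <;> simp_all

theorem haltsIn_pushChildren {W : ℕ} {s : MachineState K} {h : ℕ} {X Y : ℤ} {r : ℕ}
    (h14 : s.ireg 14 = (h : ℕ)) (h10 : s.ireg 10 = X) (h11 : s.ireg 11 = Y)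
    (h12 : s.ireg 12 = (2 ^ (r + 1) : ℕ)) (h13 : s.ireg 13 = (r + 1 : ℕ))
    (hh : h + 4 ≤ W) (hX : |X| + 2 ^ (r + 1) ≤ W) (hY : |Y| + 2 ^ (r + 1) ≤ W) :
    HaltsIn W pushChildren s 100 fun s' => s'.ireg 14 = (h + 4 : ℕ) ∧
      OnStack s' h X Y r ∧ OnStack s' (h + 1) (X + (2 ^ r : ℕ)) Y r ∧
      OnStack s' (h + 2) X (Y + (2 ^ r : ℕ)) r ∧
      OnStack s' (h + 3) (X + (2 ^ r : ℕ)) (Y + (2 ^ r : ℕ)) r ∧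
      ∀ m (j : ℕ), j < h → s'.iarr m j = s.iarr m j := by
  have hr' : r < 2 ^ r := Nat.lt_two_pow_self
  have hp : (2 : ℤ) ^ (r + 1) = ((2 ^ r : ℕ) : ℤ) + (2 ^ r : ℕ) := by push_cast; ring
  have hp' : ((2 ^ (r + 1) : ℕ) : ℤ) = ((2 ^ r : ℕ) : ℤ) + (2 ^ r : ℕ) := by push_cast; ring
  rw [hp] at hX hY
  rw [hp'] at h12
  generalize hq : 2 ^ r = q at *
  have a1 := abs_le.1 (le_refl |X|)
  have a2 := abs_le.1 (le_refl |Y|)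
  have c1 : wp W (seq (setInt 22 (.div (.reg 12) (.const 2)))
      (setInt 13 (.sub (.reg 13) (.const 1))))
      (fun s' => s'.ireg 22 = q ∧ s'.ireg 13 = r) s := by
    simp only [wp, TestExp.Valid, TestExp.Holds, IntExp.Valid, IntExp.eval,
    CoeffExp.Valid, CoeffExp.eval, Function.update_self, Function.update_of_ne, ne_eq,
    Nat.reduceEqDiff, OfNat.ofNat_ne_zero, OfNat.zero_ne_ofNat, OfNat.ofNat_ne_one,
    OfNat.one_ne_ofNat, not_false_eq_true, abs_le, h12, h13, true_and]
    omega
  obtain ⟨T, s1, hrun, hT, q1, q2⟩ := c1.haltsIn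
  have f1 := hrun.frame
  -- Reassociation: the two initial assignments were verified as one block, but the program nests to
  -- the right.
  have hrun1 : ∀ {d N Q}, HaltsIn W d s1 N Q → HaltsIn W (seq (setInt 22 (.div (.reg 12) (.const 2)))
      (seq (setInt 13 (.sub (.reg 13) (.const 1))) d)) s (T + N) Q := by
    rintro d N Q ⟨T', s', hr', hT', hq'⟩
    cases hrun with
    | seq ha hb =>
      exact ⟨_, s', ha.seq (hb.seq hr'), by omega, hq'⟩
  -- Pushing does not change the registers `10`, `11`, `22`, so the corner expressions keep their
  -- values through all four pushes.
  have key : ∀ s2 : MachineState K, s2.ireg 10 = s1.ireg 10 → s2.ireg 11 = s1.ireg 11 →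
      s2.ireg 22 = s1.ireg 22 → ∀ s3 : MachineState K, s3.ireg = s2.ireg →
      ((IntExp.reg 10).Valid W s3 ∧ (IntExp.reg 10).eval s3 = X) ∧
      ((IntExp.reg 11).Valid W s3 ∧ (IntExp.reg 11).eval s3 = Y) ∧
      ((IntExp.add (.reg 10) (.reg 22)).Valid W s3 ∧
        (IntExp.add (.reg 10) (.reg 22)).eval s3 = X + q) ∧
      ((IntExp.add (.reg 11) (.reg 22)).Valid W s3 ∧
        (IntExp.add (.reg 11) (.reg 22)).eval s3 = Y + q) := by
    intro s2 e1 e2 e3 s3 e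
    rw [f1.ireg 10 rfl, h10] at e1
    rw [f1.ireg 11 rfl, h11] at e2
    rw [q1] at e3
    simp only [IntExp.Valid, IntExp.eval, e, e1, e2, e3, abs_le, and_true]
    omega
  refine (hrun1 (Q := fun s' => s'.ireg 14 = (h + 4 : ℕ) ∧
            OnStack s' h X Y r ∧ OnStack s' (h + 1) (X + q) Y r ∧
            OnStack s' (h + 2) X (Y + q) r ∧
            OnStack s' (h + 3) (X + q) (Y + q) r ∧
            ∀ m (j : ℕ), j < h → s'.iarr m j = s.iarr m j) ((haltsIn_push (h := h) (X := X) (Y := Y) (r := r) ?_ (by rw [q1, hq]) q2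
      (fun s' e => (key s1 rfl rfl rfl s' e).1) (fun s' e => (key s1 rfl rfl rfl s' e).2.1)
      (by omega) (by omega)).seq fun s2 f2 p2 =>
    (haltsIn_push (h := h + 1) (X := X + q) (Y := Y) (r := r) p2.1
      (by rw [f2.ireg 22 rfl, q1, hq]) (by rw [f2.ireg 13 rfl, q2])
      (fun s' e => (key s2 (f2.ireg 10 rfl) (f2.ireg 11 rfl) (f2.ireg 22 rfl) s' e).2.2.1)
      (fun s' e => (key s2 (f2.ireg 10 rfl) (f2.ireg 11 rfl) (f2.ireg 22 rfl) s' e).2.1)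
      (by omega) (by omega)).seq fun s3 f3 p3 =>
    (haltsIn_push (h := h + 2) (X := X) (Y := Y + q) (r := r) p3.1
      (by rw [f3.ireg 22 rfl, f2.ireg 22 rfl, q1, hq])
      (by rw [f3.ireg 13 rfl, f2.ireg 13 rfl, q2])
      (fun s' e => (key s3 (by rw [f3.ireg 10 rfl, f2.ireg 10 rfl])
        (by rw [f3.ireg 11 rfl, f2.ireg 11 rfl]) (by rw [f3.ireg 22 rfl, f2.ireg 22 rfl]) s' e).1)
      (fun s' e => (key s3 (by rw [f3.ireg 10 rfl, f2.ireg 10 rfl])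
        (by rw [f3.ireg 11 rfl, f2.ireg 11 rfl]) (by rw [f3.ireg 22 rfl, f2.ireg 22 rfl]) s'
        e).2.2.2)
      (by omega) (by omega)).seq fun s4 f4 p4 =>
    (haltsIn_push (h := h + 3) (X := X + q) (Y := Y + q) (r := r) p4.1
      (by rw [f4.ireg 22 rfl, f3.ireg 22 rfl, f2.ireg 22 rfl, q1, hq])
      (by rw [f4.ireg 13 rfl, f3.ireg 13 rfl, f2.ireg 13 rfl, q2])
      (fun s' e => (key s4 (by rw [f4.ireg 10 rfl, f3.ireg 10 rfl, f2.ireg 10 rfl])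
        (by rw [f4.ireg 11 rfl, f3.ireg 11 rfl, f2.ireg 11 rfl])
        (by rw [f4.ireg 22 rfl, f3.ireg 22 rfl, f2.ireg 22 rfl]) s' e).2.2.1)
      (fun s' e => (key s4 (by rw [f4.ireg 10 rfl, f3.ireg 10 rfl, f2.ireg 10 rfl])
        (by rw [f4.ireg 11 rfl, f3.ireg 11 rfl, f2.ireg 11 rfl])
        (by rw [f4.ireg 22 rfl, f3.ireg 22 rfl, f2.ireg 22 rfl]) s' e).2.2.2)
      (by omega) (by omega)).mono le_rfl fun s5 _ p5 => ?_)).mono (N' := 100) ?_ fun _ _ h => h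
  · rw [f1.ireg 14 rfl, h14]
  · obtain ⟨g2, o2, u2⟩ := p2
    obtain ⟨g3, o3, u3⟩ := p3
    obtain ⟨g4, o4, u4⟩ := p4
    obtain ⟨g5, o5, u5⟩ := p5
    refine ⟨g5, o2.congr fun m => ?_, o3.congr fun m => ?_, o4.congr fun m => ?_, o5,
      fun m j hj => ?_⟩
    · rw [u5 m _ (by omega), u4 m _ (by omega), u3 m _ (by omega)]
    · rw [u5 m _ (by omega), u4 m _ (by omega)]
    · rw [u5 m _ (by omega)]
    · rw [u5 m _ (by omega), u4 m _ (by omega), u3 m _ (by omega), u2 m _ (by omega),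
        f1.iarr m rfl]
  · simp only [maxCost, IntExp.cost] at hT ⊢
    omega

end Program

theorem HaltsIn.ite_pos {K : Type*} [Field K] {W : ℕ} {b : TestExp} {c d : Program}
    {s : MachineState K} {N : ℕ} {Q : MachineState K → Prop} (hv : b.Valid W s) (hb : b.Holds s)
    (h : HaltsIn W c s N Q) : HaltsIn W (.ite b c d) s (b.cost + 1 + N) Q :=
  HaltsIn.ite hv (fun _ => h) fun h' => (h' hb).elim

theorem HaltsIn.ite_neg {K : Type*} [Field K] {W : ℕ} {b : TestExp} {c d : Program}
    {s : MachineState K} {N : ℕ} {Q : MachineState K → Prop} (hv : b.Valid W s) (hb : ¬ b.Holds s)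
    (h : HaltsIn W d s N Q) : HaltsIn W (.ite b c d) s (b.cost + 1 + N) Q :=
  HaltsIn.ite hv (fun h' => (hb h').elim) fun _ => h

theorem HaltsIn.skip {K : Type*} [Field K] {W : ℕ} {s : MachineState K}
    {Q : MachineState K → Prop} (h : Q s) : HaltsIn W .skip s 1 Q :=
  ⟨1, s, .skip s, le_rfl, h⟩

open Classical in
/-- A bound for the time that is spent on a square and its subsquares. -/
noncomputable def treeCost (c : ℕ → ℝ) : ℕ → ℤ → ℤ → ℕ
  | 0, _, _ => 1500
  | r + 1, X, Y =>
    if IsInner c (2 ^ (r + 1) : ℕ) X Y then 1500 + 2 ^ (r + 1) * (r + 1 + 1) * 1400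
    else if IsOuter c (2 ^ (r + 1) : ℕ) X Y then 1500
    else 1500 + (treeCost c r X Y + treeCost c r (X + (2 ^ r : ℕ)) Y +
      treeCost c r X (Y + (2 ^ r : ℕ)) + treeCost c r (X + (2 ^ r : ℕ)) (Y + (2 ^ r : ℕ)))

namespace Program

variable {K : Type*} [Field K]

theorem squareSum_double (a b : ℤ → K) (S : ℤ → ℤ → Prop) [DecidableRel S] (m : ℕ) (X Y k : ℤ) :
    squareSum a b S (m + m) X Y k = squareSum a b S m X Y k + squareSum a b S m (X + m) Y k +
      squareSum a b S m X (Y + m) k + squareSum a b S m (X + m) (Y + m) k := by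
  simp only [squareSum, Finset.sum_range_add, Finset.sum_add_distrib, Nat.cast_add, ← add_assoc]

theorem squareSum_eq_zero {a b : ℤ → K} {S : ℤ → ℤ → Prop} [DecidableRel S] {m : ℕ} {X Y : ℤ}
    (h : ∀ u < m, ∀ v < m, ¬ S (X + (u : ℕ)) (Y + (v : ℕ))) (k : ℤ) :
    squareSum a b S m X Y k = 0 := by
  refine Finset.sum_eq_zero fun u hu => Finset.sum_eq_zero fun v hv => ?_
  rw [if_neg fun hk => h u (Finset.mem_range.1 hu) v (Finset.mem_range.1 hv) hk.2]

theorem haltsIn_leaf {W : ℕ} {s : MachineState K} {X Y : ℤ} (S : ℤ → ℤ → Prop) [DecidableRel S]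
    (hS : memberTest.Holds s ↔ S X Y) (h10 : s.ireg 10 = X) (h11 : s.ireg 11 = Y)
    (hW : |X| + |Y| ≤ W) (hb : ∀ i < 7, |s.ireg i| ≤ W) :
    HaltsIn W leaf s 1400 fun s' =>
      ∀ k, s'.karr 4 k = s.karr 4 k + squareSum (s.karr 0) (s.karr 1) S 1 X Y k := by
  have a1 := abs_nonneg X
  have a2 := abs_nonneg Y
  have hv : memberTest.Valid W s := memberTest_valid (by rw [h10]; omega) (by rw [h11]; omega) hb
  have hs : ∀ k, squareSum (s.karr 0) (s.karr 1) S 1 X Y k =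
      if X + Y = k ∧ S X Y then s.karr 0 X * s.karr 1 Y else 0 := by
    intro k
    simp [squareSum]
  simp only [hs]
  by_cases hm : memberTest.Holds s
  · refine (HaltsIn.ite_pos hv hm (wp.haltsIn ?_)).mono (by decide) fun _ _ h => h
    have b1 := abs_le.1 (le_refl |X|)
    have b2 := abs_le.1 (le_refl |Y|)
    simp only [wp, TestExp.Valid, TestExp.Holds, IntExp.Valid, IntExp.eval,
    CoeffExp.Valid, CoeffExp.eval, Function.update_self, Function.update_of_ne, ne_eq,
    Nat.reduceEqDiff, OfNat.ofNat_ne_zero, OfNat.zero_ne_ofNat, OfNat.ofNat_ne_one,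
    OfNat.one_ne_ofNat, not_false_eq_true, abs_le, h10, h11, hS.1 hm, and_true]
    refine ⟨by omega, by omega, fun k => ?_⟩
    by_cases hk : X + Y = k
    · subst hk
      rw [Function.update_self, if_pos rfl]
    · rw [Function.update_of_ne (Ne.symm hk), if_neg hk, add_zero]
  · refine (HaltsIn.ite_neg hv hm (HaltsIn.skip ?_)).mono (by decide) fun _ _ h => h
    have hm' : ¬ S X Y := fun h => hm (hS.2 h)
    simp [hm']

theorem Rounds.of_haltsIn {W : ℕ} {b : TestExp} {c : Program} {s : MachineState K} {N : ℕ}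
    {Q : MachineState K → Prop} (hv : b.Valid W s) (hb : b.Holds s) (h : HaltsIn W c s N Q) :
    ∃ T s', Rounds W b c s T s' ∧ T ≤ b.cost + 1 + N ∧ Q s' := by
  obtain ⟨T, s', hr, hT, hq⟩ := h
  exact ⟨_, s', .step hv hb hr (.refl _), by omega, hq⟩

/-- The common beginning of every round; the extra 20 are 4 for the loop test and 16 for `pop`. -/
theorem rounds_pop {W : ℕ} {s : MachineState K} {h : ℕ} {X Y : ℤ} {r N : ℕ}
    {Q : MachineState K → Prop} (h14 : s.ireg 14 = (h + 1 : ℕ)) (ho : OnStack s h X Y r)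
    (hh : h + 1 ≤ W) (hX : |X| ≤ W) (hY : |Y| ≤ W) (hr : 2 ^ r ≤ W)
    (H : ∀ s', Frame pop s s' → s'.ireg 14 = h → s'.ireg 10 = X → s'.ireg 11 = Y →
      s'.ireg 12 = (2 ^ r : ℕ) → s'.ireg 13 = r → HaltsIn W (ite (.intLT (.reg 13) (.const 1)) leaf
        (ite innerTest convolve (ite outerTest skip pushChildren))) s' N Q) :
    ∃ T s', Rounds W stackTest processSquare s T s' ∧ T ≤ N + 20 ∧ Q s' := by
  have hv : stackTest.Valid W s := by
    simp only [stackTest, wp, TestExp.Valid, TestExp.Holds, IntExp.Valid, IntExp.eval,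
    CoeffExp.Valid, CoeffExp.eval, Function.update_self, Function.update_of_ne, ne_eq,
    Nat.reduceEqDiff, OfNat.ofNat_ne_zero, OfNat.zero_ne_ofNat, OfNat.ofNat_ne_one,
    OfNat.one_ne_ofNat, not_false_eq_true, abs_le, h14]; omega
  have hb' : stackTest.Holds s := by
    simp only [stackTest, wp, TestExp.Valid, TestExp.Holds, IntExp.Valid, IntExp.eval,
    CoeffExp.Valid, CoeffExp.eval, Function.update_self, Function.update_of_ne, ne_eq,
    Nat.reduceEqDiff, OfNat.ofNat_ne_zero, OfNat.zero_ne_ofNat, OfNat.ofNat_ne_one,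
    OfNat.one_ne_ofNat, not_false_eq_true, abs_le, h14]; omega
  obtain ⟨T, s', hr, hT, hq⟩ := Rounds.of_haltsIn hv hb' (c := processSquare)
    ((haltsIn_pop (W := W) h14 ho hh hX hY hr).seq
      fun s1 f1 ⟨p14, p10, p11, p12, p13⟩ => H s1 f1 p14 p10 p11 p12 p13)
  refine ⟨T, s', hr, ?_, hq⟩
  simp only [stackTest, TestExp.cost, IntExp.cost] at hT
  omega

-- Stack discipline makes the four recursive calls compose: each ends with the stack as it was below
-- its square. All geometric data, operands and roots are compared with one fixed state `s₀`, as the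
-- loop body never writes to them. Each level keeps at most three siblings waiting, whence `3 * r`
-- in the bound on the height. The bounds by `M` pass to the quarters, since a corner moves by at
-- most the side that is lost.
open Classical in
theorem rounds_square {W t M : ℕ} {s₀ : MachineState K} {rt : ℕ → K} {half : K}
    (hz : ∀ j < t, s₀.karr 2 ((j + 1 : ℕ) : ℤ) = rt (j + 1))
    (hrt : ∀ j < t, rt (j + 1) ^ 2 ^ j = -1) (hh : s₀.karr 3 0 = half) (hhalf : 2 * half = 1)
    (hb : ∀ i < 7, |s₀.ireg i| ≤ W) (hM : 7 * M + 10 ≤ W) (S : ℤ → ℤ → Prop)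
    (hS : S = IsMemberAt s₀.rreg (fun i => 0 < s₀.ireg (1 + i)) fun i => 0 < s₀.ireg (4 + i)) :
    ∀ (r : ℕ), r + 1 ≤ t → ∀ (X Y : ℤ) (h : ℕ) (s : MachineState K), Frame processSquare s₀ s →
      s.ireg 14 = (h + 1 : ℕ) → OnStack s h X Y r → |X| + (2 ^ r : ℕ) ≤ M →
      |Y| + (2 ^ r : ℕ) ≤ M → h + 3 * r + 5 ≤ W →
      ∃ T s', Rounds W stackTest processSquare s T s' ∧ T ≤ treeCost s₀.rreg r X Y ∧
        s'.ireg 14 = h ∧ (∀ m (j : ℕ), j < h → s'.iarr m j = s.iarr m j) ∧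
        ∀ k, s'.karr 4 k = s.karr 4 k + squareSum (s₀.karr 0) (s₀.karr 1) S (2 ^ r) X Y k := by
  have facts : ∀ s s1 : MachineState K, Frame processSquare s₀ s → Frame pop s s1 →
      s1.rreg = s₀.rreg ∧ (∀ i < 7, s1.ireg i = s₀.ireg i) ∧ (∀ m < 4, s1.karr m = s₀.karr m) ∧
      s1.karr 4 = s.karr 4 ∧ s1.iarr = s.iarr := by
    intro s s1 f f1
    refine ⟨funext fun i => (f1.rreg i rfl).trans (f.rreg i rfl), fun i hi => ?_, fun m hm => ?_,
      f1.karr 4 rfl, funext fun i => f1.iarr i rfl⟩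
    · interval_cases i <;> exact (f1.ireg _ rfl).trans (f.ireg _ rfl)
    · interval_cases m <;> exact (f1.karr _ rfl).trans (f.karr _ rfl)
  intro r
  induction r with
  | zero =>
    intro ht X Y h s f h14 ho hX hY hW
    have a1 := abs_nonneg X
    have a2 := abs_nonneg Y
    obtain ⟨T, s', hr, hT, h1, h2, h3⟩ := rounds_pop (N := 1450) (Q := fun s' =>
      s'.ireg 14 = h ∧ (∀ m (j : ℕ), j < h → s'.iarr m j = s.iarr m j) ∧
      ∀ k, s'.karr 4 k = s.karr 4 k + squareSum (s₀.karr 0) (s₀.karr 1) S (2 ^ 0) X Y k)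
      h14 ho (W := W) (by omega) (by omega) (by omega) (by omega)
      fun s1 f1 p14 p10 p11 p12 p13 => by
        obtain ⟨e1, e2, e3, e4, e5⟩ := facts s s1 f f1
        refine HaltsIn.mono (HaltsIn.ite_pos ?_ ?_ ((haltsIn_leaf (W := W) S ?_ p10 p11 (by omega)
          fun i hi => by rw [e2 i hi]; exact hb i hi).mono le_rfl fun s2 f2 g => ⟨?_, ?_, ?_⟩))
          (by decide) fun _ _ h => h
        · simp only [wp, TestExp.Valid, TestExp.Holds, IntExp.Valid, IntExp.eval,
    CoeffExp.Valid, CoeffExp.eval, Function.update_self, Function.update_of_ne, ne_eq,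
    Nat.reduceEqDiff, OfNat.ofNat_ne_zero, OfNat.zero_ne_ofNat, OfNat.ofNat_ne_one,
    OfNat.one_ne_ofNat, not_false_eq_true, abs_le, p13]; omega
        · simp only [wp, TestExp.Valid, TestExp.Holds, IntExp.Valid, IntExp.eval,
    CoeffExp.Valid, CoeffExp.eval, Function.update_self, Function.update_of_ne, ne_eq,
    Nat.reduceEqDiff, OfNat.ofNat_ne_zero, OfNat.zero_ne_ofNat, OfNat.ofNat_ne_one,
    OfNat.one_ne_ofNat, not_false_eq_true, abs_le, p13]; omega
        · rw [memberTest_holds, p10, p11, hS]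
          simp only [IsMemberAt, IsMember, e1, e2 (1 + 0) (by decide), e2 (1 + 1) (by decide),
            e2 (1 + 2) (by decide), e2 (4 + 0) (by decide), e2 (4 + 1) (by decide),
            e2 (4 + 2) (by decide)]
        · rw [f2.ireg 14 rfl, p14]
        · intro m j _
          rw [f2.iarr m rfl, e5]
        · intro k
          rw [g k, e4, e3 0 (by decide), e3 1 (by decide), pow_zero]
    exact ⟨T, s', hr, hT.trans (by simp [treeCost]), h1, h2, h3⟩
  | succ r ih =>
    intro ht X Y h s f h14 ho hX hY hW
    have a1 := abs_nonneg X
    have a2 := abs_nonneg Y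
    have hpos : 0 < 2 ^ r := by positivity
    have hrr : r < 2 ^ r := Nat.lt_two_pow_self
    have hp : 2 ^ (r + 1) = 2 ^ r + 2 ^ r := by rw [pow_succ, mul_two]
    have hpc : (2 : ℤ) ^ (r + 1) = ((2 ^ (r + 1) : ℕ) : ℤ) := by push_cast; rfl
    have hvt : ∀ s1 : MachineState K, s1.ireg 13 = (r + 1 : ℕ) →
        (TestExp.intLT (.reg 13) (.const 1)).Valid W s1 ∧
        ¬ (TestExp.intLT (.reg 13) (.const 1)).Holds s1 := by
      intro s1 p13
      simp only [wp, TestExp.Valid, TestExp.Holds, IntExp.Valid, IntExp.eval,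
    CoeffExp.Valid, CoeffExp.eval, Function.update_self, Function.update_of_ne, ne_eq,
    Nat.reduceEqDiff, OfNat.ofNat_ne_zero, OfNat.zero_ne_ofNat, OfNat.ofNat_ne_one,
    OfNat.one_ne_ofNat, not_false_eq_true, abs_le, p13]; omega
    have hin : ∀ s1 : MachineState K, s1.ireg 10 = X → s1.ireg 11 = Y →
        s1.ireg 12 = (2 ^ (r + 1) : ℕ) → |s1.ireg 10| + |s1.ireg 11| + |s1.ireg 12| + 1 ≤ W := by
      intro s1 p10 p11 p12
      rw [p10, p11, p12, abs_of_nonneg (a := ((2 ^ (r + 1) : ℕ) : ℤ)) (by positivity)]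
      omega
    by_cases hI : IsInner s₀.rreg (2 ^ (r + 1) : ℕ) X Y
    · obtain ⟨T, s', hr, hT, h1, h2, h3⟩ := rounds_pop (N := 1450 + 2 ^ (r + 1) * (r + 1 + 1) * 1400)
        (Q := fun s' =>
        s'.ireg 14 = h ∧ (∀ m (j : ℕ), j < h → s'.iarr m j = s.iarr m j) ∧
        ∀ k, s'.karr 4 k = s.karr 4 k +
          squareSum (s₀.karr 0) (s₀.karr 1) S (2 ^ (r + 1)) X Y k)
        h14 ho (W := W) (by omega) (by omega) (by omega) (by omega)
        fun s1 f1 p14 p10 p11 p12 p13 => by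
          obtain ⟨e1, e2, e3, e4, e5⟩ := facts s s1 f f1
          refine HaltsIn.mono (HaltsIn.ite_neg (hvt s1 p13).1 (hvt s1 p13).2
            (HaltsIn.ite_pos (innerTest_valid (hin s1 p10 p11 p12)) ?_
            ((haltsIn_convolve (W := W) (rt := rt) (half := half) S ?_ p10 p11 p12 p13 ?_ ?_ ?_ hhalf
              ?_).mono le_rfl fun s2 f2 g => ⟨?_, ?_, ?_⟩))) ?_ fun _ _ h => h
          · rw [innerTest_holds, e1, p10, p11, p12]
            exact hI
          · intro u hu v hv
            rw [hS]
            exact hI.isMemberAt _ _ hu hv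
          · rw [e3 2 (by decide)]
            exact fun j hj => hz j (by omega)
          · exact fun j hj => hrt j (by omega)
          · rw [e3 3 (by decide), hh]
          · rw [hpc]
            omega
          · have : (TestExp.intLT (.reg 13) (.const 1)).cost + 1 + (innerTest.cost + 1) ≤ 1450 := by
              decide
            omega
          · rw [f2.ireg 14 rfl, p14]
          · intro m j _
            rw [f2.iarr m rfl, e5]
          · intro k
            rw [g k, e4, e3 0 (by decide), e3 1 (by decide)]
      refine ⟨T, s', hr, hT.trans ?_, h1, h2, h3⟩
      rw [treeCost, if_pos hI]
      omega
    by_cases hO : IsOuter s₀.rreg (2 ^ (r + 1) : ℕ) X Y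
    · obtain ⟨T, s', hr, hT, h1, h2, h3⟩ := rounds_pop (N := 1450)
        (Q := fun s' =>
        s'.ireg 14 = h ∧ (∀ m (j : ℕ), j < h → s'.iarr m j = s.iarr m j) ∧
        ∀ k, s'.karr 4 k = s.karr 4 k +
          squareSum (s₀.karr 0) (s₀.karr 1) S (2 ^ (r + 1)) X Y k)
        h14 ho (W := W) (by omega) (by omega) (by omega) (by omega)
        fun s1 f1 p14 p10 p11 p12 p13 => by
          obtain ⟨e1, e2, e3, e4, e5⟩ := facts s s1 f f1
          refine HaltsIn.mono (HaltsIn.ite_neg (hvt s1 p13).1 (hvt s1 p13).2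
            (HaltsIn.ite_neg (innerTest_valid (hin s1 p10 p11 p12)) ?_
            (HaltsIn.ite_pos (outerTest_valid (hin s1 p10 p11 p12)) ?_
            (HaltsIn.skip ⟨p14, ?_, ?_⟩)))) (by decide) fun _ _ h => h
          · rw [innerTest_holds, e1, p10, p11, p12]
            exact hI
          · rw [outerTest_holds, e1, p10, p11, p12]
            exact hO
          · intro m j _
            rw [e5]
          · intro k
            rw [e4, squareSum_eq_zero, add_zero]
            intro u hu v hv
            rw [hS]
            exact hO.not_isMemberAt _ _ hu hv
      refine ⟨T, s', hr, hT.trans ?_, h1, h2, h3⟩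
      rw [treeCost, if_neg hI, if_pos hO]
      omega
    obtain ⟨T, s', hr, hT, h1, o1, o2, o3, o4, h2, h3⟩ := rounds_pop (N := 1450)
      (Q := fun s' => s'.ireg 14 = (h + 4 : ℕ) ∧ OnStack s' h X Y r ∧
      OnStack s' (h + 1) (X + (2 ^ r : ℕ)) Y r ∧ OnStack s' (h + 2) X (Y + (2 ^ r : ℕ)) r ∧
      OnStack s' (h + 3) (X + (2 ^ r : ℕ)) (Y + (2 ^ r : ℕ)) r ∧
      (∀ m (j : ℕ), j < h → s'.iarr m j = s.iarr m j) ∧ s'.karr 4 = s.karr 4)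
      h14 ho (W := W) (by omega) (by omega) (by omega) (by omega)
      fun s1 f1 p14 p10 p11 p12 p13 => by
        obtain ⟨e1, e2, e3, e4, e5⟩ := facts s s1 f f1
        refine HaltsIn.mono (HaltsIn.ite_neg (hvt s1 p13).1 (hvt s1 p13).2
          (HaltsIn.ite_neg (innerTest_valid (hin s1 p10 p11 p12)) ?_
          (HaltsIn.ite_neg (outerTest_valid (hin s1 p10 p11 p12)) ?_
          ((haltsIn_pushChildren (W := W) p14 p10 p11 p12 p13 (by omega) ?_ ?_).mono le_rfl
            fun s2 f2 ⟨g1, g2, g3, g4, g5, g6⟩ => ⟨g1, g2, g3, g4, g5, ?_, ?_⟩)))) (by decide)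
            fun _ _ h => h
        · rw [innerTest_holds, e1, p10, p11, p12]
          exact hI
        · rw [outerTest_holds, e1, p10, p11, p12]
          exact hO
        · rw [hpc]
          omega
        · rw [hpc]
          omega
        · intro m j hj
          rw [g6 m j hj, e5]
        · rw [f2.karr 4 rfl, e4]
    have bX := abs_add_le X ((2 ^ r : ℕ) : ℤ)
    have bY := abs_add_le Y ((2 ^ r : ℕ) : ℤ)
    rw [abs_of_nonneg (a := ((2 ^ r : ℕ) : ℤ)) (by positivity)] at bX bY
    have F1 := f.trans hr.frame
    -- The quarter pushed last is treated first; the others lie below it on the stack and therefore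
    -- survive.
    obtain ⟨T4, s4, r4, t4, i4, k4, c4⟩ := ih (by omega) _ _ (h + 3) s' F1 h1 o4 (by omega) (by omega)
      (by omega)
    have F4 := F1.trans r4.frame
    obtain ⟨T3, s3, r3, t3, i3, k3, c3⟩ := ih (by omega) _ _ (h + 2) s4 F4 i4
      (o3.congr fun m => k4 m _ (by omega)) (by omega) (by omega) (by omega)
    have F3 := F4.trans r3.frame
    obtain ⟨T2, s2, r2, t2, i2, k2, c2⟩ := ih (by omega) _ _ (h + 1) s3 F3 i3
      (o2.congr fun m => by rw [k3 m _ (by omega), k4 m _ (by omega)]) (by omega) (by omega)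
      (by omega)
    have F2 := F3.trans r2.frame
    obtain ⟨T1, s1, r1, t1, i1, k1, c1⟩ := ih (by omega) _ _ h s2 F2 i2
      (o1.congr fun m => by rw [k2 m _ (by omega), k3 m _ (by omega), k4 m _ (by omega)])
      (by omega) (by omega) (by omega)
    refine ⟨_, s1, ((((hr.trans r4).trans r3).trans r2).trans r1), ?_, i1, fun m j hj => ?_,
      fun k => ?_⟩
    · rw [treeCost, if_neg hI, if_neg hO]
      omega
    · rw [k1 m j (by omega), k2 m j (by omega), k3 m j (by omega), k4 m j (by omega),
        h2 m j (by omega)]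
    · rw [c1, c2, c3, c4, h3, hp, squareSum_double]
      ring

end Program

/-! ### Counting the squares crossed by a line, and the cost of the quadtree. -/

/-- The line on which the affine function number `k` vanishes crosses the square. -/
def Crosses (c : ℕ → ℝ) (k : ℕ) (m X Y : ℤ) : Prop :=
  ¬ AtCorners (fun x y => 0 < affineAt c k x y) m X Y ∧
  ¬ AtCorners (fun x y => affineAt c k x y < 0) m X Y

theorem exists_of_not_atCorners {p : ℤ → ℤ → Prop} {m X Y : ℤ} (hm : 1 ≤ m)
    (h : ¬ AtCorners p m X Y) : ∃ x y, X ≤ x ∧ x < X + m ∧ Y ≤ y ∧ y < Y + m ∧ ¬ p x y := by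
  by_contra! h'
  exact h ⟨h' _ _ (by omega) (by omega) (by omega) (by omega),
    h' _ _ (by omega) (by omega) (by omega) (by omega),
    h' _ _ (by omega) (by omega) (by omega) (by omega),
    h' _ _ (by omega) (by omega) (by omega) (by omega)⟩

theorem affineAt_lt {c : ℕ → ℝ} {k : ℕ} {x y x' y' : ℤ}
    (h : 0 < c (7 + 3 * k) * ((x' : ℝ) - x) + c (8 + 3 * k) * ((y' : ℝ) - y)) :
    affineAt c k x y < affineAt c k x' y' := by
  simp only [affineAt]
  linarith

theorem linear_pos {α β x y : ℝ} (hα : 0 ≤ α * x) (hβ : 0 ≤ β * y) (hx : x ≠ 0) (hy : y ≠ 0)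
    (h : α ≠ 0 ∨ β ≠ 0) : 0 < α * x + β * y := by
  rcases h with h | h
  · exact add_pos_of_pos_of_nonneg (lt_of_le_of_ne hα (mul_ne_zero h hx).symm) hβ
  · exact add_pos_of_nonneg_of_pos hα (lt_of_le_of_ne hβ (mul_ne_zero h hy).symm)

/-- Of two squares in the same diagonal, at most one is crossed by a given line, unless the line is
close to that diagonal. -/
theorem not_crosses_of_diagonal {c : ℕ → ℝ} {k : ℕ} {m X Y X' Y' : ℤ} (hm : 1 ≤ m)
    (h : c (7 + 3 * k) ≠ 0 ∨ c (8 + 3 * k) ≠ 0) (hX : X + m ≤ X')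
    (hY : (0 ≤ c (7 + 3 * k) * c (8 + 3 * k) ∧ Y + m ≤ Y') ∨
      (c (7 + 3 * k) * c (8 + 3 * k) < 0 ∧ Y' + m ≤ Y))
    (hc : Crosses c k m X Y) : ¬ Crosses c k m X' Y' := by
  intro hc'
  obtain ⟨x₁, y₁, a₁, a₂, a₃, a₄, h₁⟩ := exists_of_not_atCorners hm hc.1
  obtain ⟨x₂, y₂, b₁, b₂, b₃, b₄, h₂⟩ := exists_of_not_atCorners hm hc.2
  obtain ⟨x₃, y₃, c₁, c₂, c₃, c₄, h₃⟩ := exists_of_not_atCorners hm hc'.1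
  obtain ⟨x₄, y₄, d₁, d₂, d₃, d₄, h₄⟩ := exists_of_not_atCorners hm hc'.2
  simp only [not_lt] at h₁ h₂ h₃ h₄
  -- The differences of the coordinates have the same signs for every pair of points from the two
  -- squares.
  have key : ∀ x y x' y' : ℤ, X ≤ x → x < X + m → Y ≤ y → y < Y + m → X' ≤ x' → x' < X' + m →
      Y' ≤ y' → y' < Y' + m → (0:ℝ) < (x' : ℝ) - x ∧ ((y' : ℝ) - y ≠ 0) ∧
      ((0 ≤ c (7 + 3 * k) * c (8 + 3 * k) ∧ (0 : ℝ) < (y' : ℝ) - y) ∨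
        (c (7 + 3 * k) * c (8 + 3 * k) < 0 ∧ (y' : ℝ) - y < 0)) := by
    intro x y x' y' e1 e2 e3 e4 e5 e6 e7 e8
    have : x < x' := by omega
    refine ⟨sub_pos.2 (by exact_mod_cast this), ?_⟩
    rcases hY with hY | hY
    · have : y < y' := by omega
      have : (0 : ℝ) < (y' : ℝ) - y := sub_pos.2 (by exact_mod_cast this)
      exact ⟨this.ne', Or.inl ⟨hY.1, this⟩⟩
    · have : y' < y := by omega
      have : (y' : ℝ) - y < 0 := sub_neg.2 (by exact_mod_cast this)
      exact ⟨this.ne, Or.inr ⟨hY.1, this⟩⟩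
  -- The direction is chosen so that the two slopes do not counteract, so the function strictly
  -- increases, or strictly decreases, from the first square to the second. But a crossed square has
  -- a point with value `≤ 0` and one with value `≥ 0`; a suitable pair contradicts the
  -- monotonicity.
  by_cases hs : 0 < c (7 + 3 * k) ∨ (c (7 + 3 * k) = 0 ∧ 0 < c (8 + 3 * k))
  · obtain ⟨k1, k2, k3⟩ := key x₂ y₂ x₃ y₃ b₁ b₂ b₃ b₄ c₁ c₂ c₃ c₄
    refine (affineAt_lt (c := c) (k := k) (linear_pos ?_ ?_ k1.ne' k2 h)).not_ge (h₃.trans h₂)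
    · rcases hs with hs | hs
      · positivity
      · rw [hs.1, zero_mul]
    · rcases k3 with ⟨k3, k4⟩ | ⟨k3, k4⟩
      · rcases hs with hs | hs
        · exact mul_nonneg (nonneg_of_mul_nonneg_right k3 hs) k4.le
        · exact mul_nonneg hs.2.le k4.le
      · rcases hs with hs | hs
        · exact mul_nonneg_of_nonpos_of_nonpos (neg_of_mul_neg_right k3 hs.le).le k4.le
        · rw [hs.1, zero_mul] at k3
          exact (lt_irrefl _ k3).elim
  · push Not at hs
    obtain ⟨k1, k2, k3⟩ := key x₁ y₁ x₄ y₄ a₁ a₂ a₃ a₄ d₁ d₂ d₃ d₄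
    have e1 : -((x₄ : ℝ) - x₁) = (x₁ : ℝ) - x₄ := by ring
    have e2 : -((y₄ : ℝ) - y₁) = (y₁ : ℝ) - y₄ := by ring
    refine (affineAt_lt (c := c) (k := k) (x := x₄) (y := y₄) (x' := x₁) (y' := y₁)
      (linear_pos ?_ ?_ (by linarith) (by rw [← e2]; exact neg_ne_zero.2 k2) h)).not_ge (h₁.trans h₄)
    · exact mul_nonneg_of_nonpos_of_nonpos hs.1 (by linarith)
    · rcases eq_or_lt_of_le hs.1 with h0 | h0
      · rw [h0, zero_mul] at k3
        have h8 := hs.2 h0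
        rcases k3 with ⟨-, k4⟩ | ⟨k3, -⟩
        · exact mul_nonneg_of_nonpos_of_nonpos h8 (by linarith)
        · exact (lt_irrefl _ k3).elim
      · rcases k3 with ⟨k3, k4⟩ | ⟨k3, k4⟩
        · exact mul_nonneg_of_nonpos_of_nonpos (nonpos_of_mul_nonneg_right k3 h0) (by linarith)
        · exact mul_nonneg (pos_of_mul_neg_right k3 h0.le).le (by linarith)

open Classical in
/-- The indicator function of `Crosses`. -/
noncomputable def crossIndicator (c : ℕ → ℝ) (k : ℕ) (m X Y : ℤ) : ℕ :=
  if Crosses c k m X Y then 1 else 0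

/-- The number of squares of size `2 ^ r` crossed by a line, in a square of size `M * 2 ^ r`. -/
noncomputable def crossCount (c : ℕ → ℝ) (k r M : ℕ) (X Y : ℤ) : ℕ :=
  ∑ u ∈ Finset.range M, ∑ v ∈ Finset.range M,
    crossIndicator c k (2 ^ r : ℕ) (X + 2 ^ r * u) (Y + 2 ^ r * v)

theorem crossCount_double (c : ℕ → ℝ) (k r M : ℕ) (X Y : ℤ) :
    crossCount c k r (M + M) X Y = crossCount c k r M X Y + crossCount c k r M (X + 2 ^ r * M) Y +
      crossCount c k r M X (Y + 2 ^ r * M) +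
      crossCount c k r M (X + 2 ^ r * M) (Y + 2 ^ r * M) := by
  simp only [crossCount, Finset.sum_range_add, Finset.sum_add_distrib, Nat.cast_add, mul_add,
    ← add_assoc]

/-- Among the two diagonal directions of the grid, the sign of the product of the slopes selects one
in which every diagonal contains at most one crossed square; there are fewer than `2 * M` diagonals.
-/
theorem crossCount_le {c : ℕ → ℝ} {k : ℕ} (h : c (7 + 3 * k) ≠ 0 ∨ c (8 + 3 * k) ≠ 0) (r M : ℕ)
    (X Y : ℤ) : crossCount c k r M X Y ≤ 2 * M := by
  classical
  simp only [crossCount, crossIndicator]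
  rw [← Finset.sum_product', ← Finset.card_filter]
  set p : ℝ := c (7 + 3 * k) * c (8 + 3 * k) with hp
  have hpos : (1 : ℤ) ≤ ((2 ^ r : ℕ) : ℤ) := by
    exact_mod_cast Nat.one_le_two_pow
  have hpc : (2 : ℤ) ^ r = ((2 ^ r : ℕ) : ℤ) := by push_cast; rfl
  rw [hpc]
  generalize 2 ^ r = q at *
  -- The number of the diagonal: `u - v` shifted by `M`, or `u + v`. It is injective on the crossed
  -- squares.
  refine (Finset.card_le_card_of_injOn (t := Finset.range (2 * M))
    (fun x => if 0 ≤ p then x.1 + (M - x.2) else x.1 + x.2) ?_ ?_).trans (by simp)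
  · intro x hx
    simp only [Finset.coe_filter, Finset.mem_product, Finset.mem_range, Set.mem_ofPred_eq] at hx
    simp only [Finset.coe_range, Set.mem_Iio]
    split_ifs <;> omega
  · have key : ∀ u v u' v' : ℕ, u < M → v < M → u' < M → v' < M →
        Crosses c k q (X + q * u) (Y + q * v) → Crosses c k q (X + q * u') (Y + q * v') →
        (if 0 ≤ p then u + (M - v) else u + v) = (if 0 ≤ p then u' + (M - v') else u' + v') →
        ¬ u < u' := by
      intro u v u' v' h1 h2 h3 h4 hc hc' he hu
      refine not_crosses_of_diagonal hpos h ?_ ?_ hc hc'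
      · have : (q : ℤ) * (u + 1) ≤ q * u' := by
          apply mul_le_mul_of_nonneg_left <;> omega
        linarith
      · split_ifs at he with hp0
        · refine Or.inl ⟨hp0, ?_⟩
          have : (q : ℤ) * (v + 1) ≤ q * v' := by
            apply mul_le_mul_of_nonneg_left <;> omega
          linarith
        · refine Or.inr ⟨not_le.1 hp0, ?_⟩
          have : (q : ℤ) * (v' + 1) ≤ q * v := by
            apply mul_le_mul_of_nonneg_left <;> omega
          linarith
    rintro ⟨u, v⟩ hx ⟨u', v'⟩ hx' he
    simp only [Finset.coe_filter, Finset.mem_product, Finset.mem_range, Set.mem_ofPred_eq] at hx hx'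
    simp only at he
    have k1 := key u v u' v' hx.1.1 hx.1.2 hx'.1.1 hx'.1.2 hx.2 hx'.2 he
    have k2 := key u' v' u v hx'.1.1 hx'.1.2 hx.1.1 hx.1.2 hx'.2 hx.2 he.symm
    have : u = u' := by omega
    subst this
    have : v = v' := by split_ifs at he <;> omega
    rw [this]

/-- A bound for the time spent on a square of size `2 ^ r` without its subsquares. -/
def squareCost (r : ℕ) : ℕ := 1500 + 2 ^ r * (r + 1) * 1400

/-- Every visited square other than the root is charged to its parent, which was split and hence is
crossed by one of the three lines. A crossed square of side `2 ^ (j + 1)` thus pays for four squares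
of side `2 ^ j`. -/
theorem treeCost_le_sum (c : ℕ → ℝ) : ∀ (r : ℕ) (X Y : ℤ), treeCost c r X Y ≤ squareCost r +
    ∑ j ∈ Finset.range r, 4 * squareCost j * ∑ k ∈ Finset.range 3,
      crossCount c k (j + 1) (2 ^ (r - (j + 1))) X Y := by
  intro r
  induction r with
  | zero =>
    intro X Y
    simp [treeCost, squareCost]
  | succ r ih =>
    intro X Y
    rw [treeCost]
    split_ifs with hI hO
    · exact Nat.le_add_right _ _
    · exact (Nat.le_add_right _ _).trans (Nat.le_add_right _ _)
    -- Not inner: some function is not positive at all corners. Not outer: none is negative at all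
    -- corners. So that function crosses.
    have hone : 1 ≤ ∑ k ∈ Finset.range 3, crossCount c k (r + 1) (2 ^ (r + 1 - (r + 1))) X Y := by
      have hone' : ∃ k < 3, Crosses c k (2 ^ (r + 1) : ℕ) X Y := by
        simp only [IsInner, IsOuter, not_and_or, not_or] at hI hO
        rcases hI with hI | hI | hI
        · exact ⟨0, by decide, hI, hO.1⟩
        · exact ⟨1, by decide, hI, hO.2.1⟩
        · exact ⟨2, by decide, hI, hO.2.2⟩
      obtain ⟨k, hk, hk'⟩ := hone'
      refine le_trans ?_ (Finset.single_le_sum (fun _ _ => Nat.zero_le _) (Finset.mem_range.2 hk))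
      simpa [crossCount, crossIndicator, Nat.one_le_iff_ne_zero] using hk'
    have hsplit : ∀ j ∈ Finset.range r, ∑ k ∈ Finset.range 3,
        crossCount c k (j + 1) (2 ^ (r + 1 - (j + 1))) X Y =
        ∑ k ∈ Finset.range 3, crossCount c k (j + 1) (2 ^ (r - (j + 1))) X Y +
        ∑ k ∈ Finset.range 3, crossCount c k (j + 1) (2 ^ (r - (j + 1))) (X + (2 ^ r : ℕ)) Y +
        ∑ k ∈ Finset.range 3, crossCount c k (j + 1) (2 ^ (r - (j + 1))) X (Y + (2 ^ r : ℕ)) +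
        ∑ k ∈ Finset.range 3,
          crossCount c k (j + 1) (2 ^ (r - (j + 1))) (X + (2 ^ r : ℕ)) (Y + (2 ^ r : ℕ)) := by
      intro j hj
      have hj' := Finset.mem_range.1 hj
      have e1 : r + 1 - (j + 1) = r - (j + 1) + 1 := by omega
      have e2 : (2 : ℤ) ^ (j + 1) * ((2 ^ (r - (j + 1)) : ℕ) : ℤ) = ((2 ^ r : ℕ) : ℤ) := by
        push_cast
        rw [← pow_add]
        congr 1
        omega
      rw [e1, pow_succ, mul_two]
      simp only [crossCount_double, e2, Finset.sum_add_distrib]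
    rw [Finset.sum_range_succ, Finset.sum_congr rfl fun j hj => by rw [hsplit j hj]]
    simp only [mul_add, Finset.sum_add_distrib]
    have i1 := ih X Y
    have i2 := ih (X + (2 ^ r : ℕ)) Y
    have i3 := ih X (Y + (2 ^ r : ℕ))
    have i4 := ih (X + (2 ^ r : ℕ)) (Y + (2 ^ r : ℕ))
    have i5 : 4 * squareCost r ≤ 4 * squareCost r *
        ∑ k ∈ Finset.range 3, crossCount c k (r + 1) (2 ^ (r + 1 - (r + 1))) X Y :=
      Nat.le_mul_of_pos_right _ hone
    have i6 : 1500 ≤ squareCost (r + 1) := Nat.le_add_right _ _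
    omega

theorem treeCost_le {c : ℕ → ℝ} (h : ∀ k < 3, c (7 + 3 * k) ≠ 0 ∨ c (8 + 3 * k) ≠ 0) (r : ℕ)
    (X Y : ℤ) : treeCost c r X Y ≤ 40000 * (2 ^ r * (r + 1) ^ 2) := by
  have hsq : ∀ j, squareCost j ≤ 2900 * (2 ^ j * (j + 1)) := by
    intro j
    have : 1 ≤ 2 ^ j * (j + 1) := Nat.mul_pos (by positivity) (by omega)
    rw [squareCost]
    omega
  -- Side and number of the crossed squares balance, so each level costs the same up to the factor
  -- `j + 1`. The constant is `4 * 2900 * 3 * 2 / 2`.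
  have hterm : ∀ j ∈ Finset.range r, 4 * squareCost j * ∑ k ∈ Finset.range 3,
      crossCount c k (j + 1) (2 ^ (r - (j + 1))) X Y ≤ 34800 * (2 ^ r * (r + 1)) := by
    intro j hj
    have hj' := Finset.mem_range.1 hj
    have h3 : ∑ k ∈ Finset.range 3, crossCount c k (j + 1) (2 ^ (r - (j + 1))) X Y ≤
        ∑ _k ∈ Finset.range 3, 2 * 2 ^ (r - (j + 1)) :=
      Finset.sum_le_sum fun k hk => crossCount_le (h k (Finset.mem_range.1 hk)) _ _ _ _
    rw [Finset.sum_const, Finset.card_range, smul_eq_mul] at h3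
    calc _ ≤ 4 * (2900 * (2 ^ j * (j + 1))) * (3 * (2 * 2 ^ (r - (j + 1)))) :=
          Nat.mul_le_mul (Nat.mul_le_mul_left _ (hsq j)) h3
      _ = 34800 * (2 ^ (j + 1 + (r - (j + 1))) * (j + 1)) := by
          rw [pow_add, pow_succ]
          ring
      _ ≤ 34800 * (2 ^ r * (r + 1)) := by
          have : j + 1 + (r - (j + 1)) = r := by omega
          rw [this]
          gcongr
  calc _ ≤ _ := treeCost_le_sum c r X Y
    _ ≤ 2900 * (2 ^ r * (r + 1)) + ∑ _j ∈ Finset.range r, 34800 * (2 ^ r * (r + 1)) :=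
        add_le_add (hsq r) (Finset.sum_le_sum hterm)
    _ ≤ 40000 * (2 ^ r * (r + 1) ^ 2) := by
        rw [Finset.sum_const, Finset.card_range, smul_eq_mul, pow_two, ← mul_assoc (2 ^ r)]
        generalize 2 ^ r * (r + 1) = z
        nlinarith [Nat.zero_le (z * r)]

/-! ### Preparation: barycentric coordinates and the enclosing square. -/

namespace Program

def diffExp (i j : ℕ) : RealExp := .sub (.reg i) (.reg j)

/-- The affine function with slopes `(i - j) / det`, `(k - l) / det` that vanishes at `(e, f)`. -/
def setAffine (u v w i j k l e f : ℕ) : Program :=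
  seq (setReal u (.div (diffExp i j) (.reg 6))) (seq (setReal v (.div (diffExp k l) (.reg 6)))
    (setReal w (.sub (.ofInt (.const 0)) (.add (.mul (.reg u) (.reg e)) (.mul (.reg v) (.reg f))))))

/-- Register `6` receives twice the signed area. Each barycentric coordinate is normalised at a
vertex on the edge where it vanishes: vertex `2` for the first two, vertex `0` for the third. -/
def setBarycentric : Program :=
  seq (setReal 6 (.add (.mul (diffExp 3 5) (diffExp 0 4)) (.mul (diffExp 4 2) (diffExp 1 5))))
    (seq (setAffine 7 8 9 3 5 4 2 4 5) (seq (setAffine 10 11 12 5 1 0 4 4 5)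
      (setAffine 13 14 15 1 3 2 0 0 1)))

def setMinFloor (x i j k : ℕ) : Program :=
  seq (setFloor x (.reg i)) (seq (setFloor 22 (.reg j))
    (seq (ite (.intLT (.reg 22) (.reg x)) (setInt x (.reg 22)) skip) (seq (setFloor 22 (.reg k))
      (ite (.intLT (.reg 22) (.reg x)) (setInt x (.reg 22)) skip))))

def spanTest (i x : ℕ) : TestExp := .realLT (.sub (.reg i) (.ofInt (.reg x))) (.ofInt (.reg 12))

def fitsTest : TestExp :=
  .and (.and (spanTest 0 20) (.and (spanTest 2 20) (spanTest 4 20)))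
    (.and (spanTest 1 21) (.and (spanTest 3 21) (spanTest 5 21)))

def setSize : Program :=
  seq (setInt 12 (.const 1)) (seq (setInt 13 (.const 0)) (.while (.not fitsTest)
    (seq (setInt 12 (.add (.reg 12) (.reg 12))) (setInt 13 (.add (.reg 13) (.const 1))))))

def prepare : Program :=
  seq setBarycentric (seq (setMinFloor 20 0 2 4) (seq (setMinFloor 21 1 3 5) (seq setSize
    (seq (setInt 22 (.reg 12)) (push (.reg 20) (.reg 21))))))

/-- The program: sum over the triangle by decomposition into squares. -/
def triangleConvolution : Program :=
  seq prepare (.while stackTest processSquare)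

variable {K : Type*} [Field K]

/-- The coefficients of the barycentric coordinates, in the registers `7`, …, `15`. -/
def HasBarycentric (c : ℕ → ℝ) (x₀ y₀ x₁ y₁ x₂ y₂ D : ℝ) : Prop :=
  (c 7 = (y₁ - y₂) / D ∧ c 8 = (x₂ - x₁) / D ∧ c 9 = 0 - (c 7 * x₂ + c 8 * y₂)) ∧
  (c 10 = (y₂ - y₀) / D ∧ c 11 = (x₀ - x₂) / D ∧ c 12 = 0 - (c 10 * x₂ + c 11 * y₂)) ∧
  (c 13 = (y₀ - y₁) / D ∧ c 14 = (x₁ - x₀) / D ∧ c 15 = 0 - (c 13 * x₀ + c 14 * y₀))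

theorem haltsIn_setBarycentric {W : ℕ} {s : MachineState K} {x₀ y₀ x₁ y₁ x₂ y₂ D : ℝ}
    (h0 : s.rreg 0 = x₀) (h1 : s.rreg 1 = y₀) (h2 : s.rreg 2 = x₁) (h3 : s.rreg 3 = y₁)
    (h4 : s.rreg 4 = x₂) (h5 : s.rreg 5 = y₂)
    (hD : D = (y₁ - y₂) * (x₀ - x₂) + (x₂ - x₁) * (y₀ - y₂)) (hD0 : D ≠ 0) :
    HaltsIn W setBarycentric s 200 fun s' => HasBarycentric s'.rreg x₀ y₀ x₁ y₁ x₂ y₂ D := by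
  refine (wp.haltsIn ?_).mono (by decide) fun _ _ h => h
  simp only [setBarycentric, setAffine, diffExp, RealExp.Valid, RealExp.eval, wp, TestExp.Valid, TestExp.Holds, IntExp.Valid, IntExp.eval,
    CoeffExp.Valid, CoeffExp.eval, Function.update_self, Function.update_of_ne, ne_eq,
    Nat.reduceEqDiff, OfNat.ofNat_ne_zero, OfNat.zero_ne_ofNat, OfNat.ofNat_ne_one,
    OfNat.one_ne_ofNat, not_false_eq_true, abs_le, h0, h1, h2,
    h3, h4, h5, ← hD, hD0, Int.cast_zero, abs_zero, HasBarycentric, and_self, true_and, and_true,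
    zero_ne_one, one_ne_zero]
  simp

theorem haltsIn_setMinFloor {W : ℕ} {s : MachineState K} {x i j k : ℕ} (hx : x ≠ 22)
    (hi : |⌊s.rreg i⌋| ≤ W) (hj : |⌊s.rreg j⌋| ≤ W) (hk : |⌊s.rreg k⌋| ≤ W) :
    HaltsIn W (setMinFloor x i j k) s 30 fun s' =>
      s'.ireg x ≤ ⌊s.rreg i⌋ ∧ s'.ireg x ≤ ⌊s.rreg j⌋ ∧ s'.ireg x ≤ ⌊s.rreg k⌋ ∧
      (s'.ireg x = ⌊s.rreg i⌋ ∨ s'.ireg x = ⌊s.rreg j⌋ ∨ s'.ireg x = ⌊s.rreg k⌋) := by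
  refine (wp.haltsIn ?_).mono
    (by simp [setMinFloor, maxCost, RealExp.cost, IntExp.cost, TestExp.cost]) fun _ _ h => h
  rw [abs_le] at hi hj hk
  simp only [setMinFloor, RealExp.Valid, RealExp.eval, wp, TestExp.Valid, TestExp.Holds, IntExp.Valid, IntExp.eval,
    CoeffExp.Valid, CoeffExp.eval, Function.update_self, Function.update_of_ne, ne_eq,
    Nat.reduceEqDiff, OfNat.ofNat_ne_zero, OfNat.zero_ne_ofNat, OfNat.ofNat_ne_one,
    OfNat.one_ne_ofNat, not_false_eq_true, abs_le, hx, hx.symm, true_and]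
  by_cases h1 : ⌊s.rreg j⌋ < ⌊s.rreg i⌋
  · simp only [h1, true_implies, not_true_eq_false, false_implies, Function.update_self,
      wp, TestExp.Valid, TestExp.Holds, IntExp.Valid, IntExp.eval,
    CoeffExp.Valid, CoeffExp.eval, Function.update_self, Function.update_of_ne, ne_eq,
    Nat.reduceEqDiff, OfNat.ofNat_ne_zero, OfNat.zero_ne_ofNat, OfNat.ofNat_ne_one,
    OfNat.one_ne_ofNat, not_false_eq_true, abs_le, hx, hx.symm, true_and, and_true, or_true, true_or]
    omega
  · simp only [h1, true_implies, not_false_eq_true, false_implies, Function.update_self,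
      wp, TestExp.Valid, TestExp.Holds, IntExp.Valid, IntExp.eval,
    CoeffExp.Valid, CoeffExp.eval, Function.update_self, Function.update_of_ne, ne_eq,
    Nat.reduceEqDiff, OfNat.ofNat_ne_zero, OfNat.zero_ne_ofNat, OfNat.ofNat_ne_one,
    OfNat.one_ne_ofNat, not_false_eq_true, abs_le, hx, hx.symm, true_and, and_true, or_true, true_or]
    omega

/-- The vertices lie to the left of `X + q` and below `Y + q`. -/
def Fits (x₀ y₀ x₁ y₁ x₂ y₂ : ℝ) (X Y : ℤ) (q : ℝ) : Prop :=
  (x₀ - X < q ∧ x₁ - X < q ∧ x₂ - X < q) ∧ y₀ - Y < q ∧ y₁ - Y < q ∧ y₂ - Y < q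

theorem Fits.mono {x₀ y₀ x₁ y₁ x₂ y₂ : ℝ} {X Y : ℤ} {q q' : ℝ} (h' : Fits x₀ y₀ x₁ y₁ x₂ y₂ X Y q)
    (h : q ≤ q') : Fits x₀ y₀ x₁ y₁ x₂ y₂ X Y q' :=
  ⟨⟨h'.1.1.trans_le h, h'.1.2.1.trans_le h, h'.1.2.2.trans_le h⟩, h'.2.1.trans_le h,
    h'.2.2.1.trans_le h, h'.2.2.2.trans_le h⟩

/-- The side is doubled until the triangle fits. Sides that do not fit are less than `B`, so no
value on the way exceeds `2 * B + 1`. The minimality of `m` is recorded since the time bound in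
terms of the perimeter rests on it. -/
theorem haltsIn_setSize {W B : ℕ} {s : MachineState K} {x₀ y₀ x₁ y₁ x₂ y₂ : ℝ} {X Y : ℤ}
    (h0 : s.rreg 0 = x₀) (h1 : s.rreg 1 = y₀) (h2 : s.rreg 2 = x₁) (h3 : s.rreg 3 = y₁)
    (h4 : s.rreg 4 = x₂) (h5 : s.rreg 5 = y₂) (h20 : s.ireg 20 = X) (h21 : s.ireg 21 = Y)
    (hX : |X| ≤ W) (hY : |Y| ≤ W) (hB : Fits x₀ y₀ x₁ y₁ x₂ y₂ X Y B) (hW : 2 * B + 3 ≤ W) :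
    ∃ m : ℕ, Fits x₀ y₀ x₁ y₁ x₂ y₂ X Y (2 ^ m) ∧
      (∀ i < m, ¬ Fits x₀ y₀ x₁ y₁ x₂ y₂ X Y (2 ^ i)) ∧
      HaltsIn W setSize s (100 * m + 100) fun s' => s'.ireg 12 = (2 ^ m : ℕ) ∧ s'.ireg 13 = m := by
  classical
  have hex : ∃ m : ℕ, Fits x₀ y₀ x₁ y₁ x₂ y₂ X Y (2 ^ m) :=
    ⟨B, hB.mono (by exact_mod_cast (Nat.lt_two_pow_self (n := B)).le)⟩
  refine ⟨Nat.find hex, Nat.find_spec hex, fun i hi => Nat.find_min hex hi, ?_⟩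
  have hlt : ∀ i < Nat.find hex, 2 ^ i ≤ B := by
    intro i hi
    by_contra! hlt
    exact Nat.find_min hex hi (hB.mono (by exact_mod_cast hlt.le))
  have hspec := Nat.find_spec hex
  have hmin := fun i (hi : i < Nat.find hex) => Nat.find_min hex hi
  generalize Nat.find hex = m at *
  have htop : 2 ^ m ≤ 2 * B + 1 := by
    rcases m with _ | m
    · simp
    · have := hlt m (by omega)
      rw [pow_succ]
      omega
  rw [abs_le] at hX hY
  have c1 : wp W (setInt 12 (.const 1)) (fun s' => s'.ireg 12 = 1) s := by
    simp only [wp, TestExp.Valid, TestExp.Holds, IntExp.Valid, IntExp.eval,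
    CoeffExp.Valid, CoeffExp.eval, Function.update_self, Function.update_of_ne, ne_eq,
    Nat.reduceEqDiff, OfNat.ofNat_ne_zero, OfNat.zero_ne_ofNat, OfNat.ofNat_ne_one,
    OfNat.one_ne_ofNat, not_false_eq_true, abs_le, and_true]
    omega
  have htest : ∀ (s' : MachineState K) (i : ℕ), s'.rreg = s.rreg → s'.ireg 20 = X →
      s'.ireg 21 = Y → s'.ireg 12 = (2 ^ i : ℕ) → i ≤ m → (TestExp.not fitsTest).Valid W s' ∧
      ((TestExp.not fitsTest).Holds s' ↔ ¬ Fits x₀ y₀ x₁ y₁ x₂ y₂ X Y (2 ^ i)) := by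
    intro s' i e e1 e2 e3 hi
    have : 2 ^ i ≤ 2 ^ m := Nat.pow_le_pow_right (by decide) hi
    constructor
    · simp only [fitsTest, spanTest, TestExp.Valid, RealExp.Valid, IntExp.Valid, e1, e2, e3, abs_le,
        true_and]
      generalize 2 ^ i = q at *
      omega
    · simp only [fitsTest, spanTest, TestExp.Holds, RealExp.eval, IntExp.eval, e, e1, e2, e3, h0, h1,
        h2, h3, h4, h5, Fits]
      push_cast
      rfl
  refine (c1.haltsIn.seq fun s1 f1 q1 => (wp.haltsIn (s := s1) (W := W) (c := setInt 13 (.const 0))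
    (Q := fun s' => s'.ireg 13 = (0 : ℕ)) ?_).seq fun s2 f2 q2 =>
    (haltsIn_while (N := m) (t := 8) (fun i s' => s'.ireg 12 = (2 ^ i : ℕ) ∧ s'.ireg 13 = i)
      ⟨by rw [f2.ireg 12 rfl, q1]; rfl, q2⟩ ?_ ?_)).mono ?_ fun _ _ h => h
  · simp only [wp, TestExp.Valid, TestExp.Holds, IntExp.Valid, IntExp.eval,
    CoeffExp.Valid, CoeffExp.eval, Function.update_self, Function.update_of_ne, ne_eq,
    Nat.reduceEqDiff, OfNat.ofNat_ne_zero, OfNat.zero_ne_ofNat, OfNat.ofNat_ne_one,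
    OfNat.one_ne_ofNat, not_false_eq_true, abs_le, and_true]
    omega
  · rintro i hi s3 f3 ⟨i1, i2⟩
    obtain ⟨t1, t2⟩ := htest s3 i (funext fun y => by rw [f3.rreg y rfl, f2.rreg y rfl, f1.rreg y rfl])
      (by rw [f3.ireg 20 rfl, f2.ireg 20 rfl, f1.ireg 20 rfl, h20])
      (by rw [f3.ireg 21 rfl, f2.ireg 21 rfl, f1.ireg 21 rfl, h21]) i1 hi.le
    refine ⟨t1, t2.2 (hmin i hi), (wp.haltsIn ?_).mono (by decide) fun _ _ h => h⟩
    have := hlt i hi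
    have hi2 : i < 2 ^ i := Nat.lt_two_pow_self
    have e : ((2 ^ (i + 1) : ℕ) : ℤ) = ((2 ^ i : ℕ) : ℤ) + (2 ^ i : ℕ) := by push_cast; ring
    simp only [wp, TestExp.Valid, TestExp.Holds, IntExp.Valid, IntExp.eval,
    CoeffExp.Valid, CoeffExp.eval, Function.update_self, Function.update_of_ne, ne_eq,
    Nat.reduceEqDiff, OfNat.ofNat_ne_zero, OfNat.zero_ne_ofNat, OfNat.ofNat_ne_one,
    OfNat.one_ne_ofNat, not_false_eq_true, abs_le, i1, i2, e, and_true, true_and]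
    omega
  · rintro s3 f3 ⟨i1, i2⟩
    obtain ⟨t1, t2⟩ := htest s3 m (funext fun y => by rw [f3.rreg y rfl, f2.rreg y rfl, f1.rreg y rfl])
      (by rw [f3.ireg 20 rfl, f2.ireg 20 rfl, f1.ireg 20 rfl, h20])
      (by rw [f3.ireg 21 rfl, f2.ireg 21 rfl, f1.ireg 21 rfl, h21]) i1 le_rfl
    exact ⟨t1, fun h => t2.1 h hspec⟩
  · have : (TestExp.not fitsTest).cost ≤ 80 := by decide
    simp only [maxCost, IntExp.cost]
    have := Nat.mul_le_mul_left m (show (TestExp.not fitsTest).cost + 1 + 8 ≤ 100 by omega)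
    omega

end Program

/-- `X` is the smallest of the rounded numbers. -/
def IsMinFloor (x₀ x₁ x₂ : ℝ) (X : ℤ) : Prop :=
  X ≤ ⌊x₀⌋ ∧ X ≤ ⌊x₁⌋ ∧ X ≤ ⌊x₂⌋ ∧ (X = ⌊x₀⌋ ∨ X = ⌊x₁⌋ ∨ X = ⌊x₂⌋)

theorem IsMinFloor.abs_le {x₀ x₁ x₂ : ℝ} {X : ℤ} {W : ℤ} (h : IsMinFloor x₀ x₁ x₂ X)
    (h0 : |⌊x₀⌋| ≤ W) (h1 : |⌊x₁⌋| ≤ W) (h2 : |⌊x₂⌋| ≤ W) : |X| ≤ W := by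
  rcases h.2.2.2 with h | h | h <;> rwa [h]

/-! ### The complete run of the program. -/

namespace Program

variable {K : Type*} [Field K]

theorem runs_prepare {W B : ℕ} {s : MachineState K} {x₀ y₀ x₁ y₁ x₂ y₂ D : ℝ}
    (h0 : s.rreg 0 = x₀) (h1 : s.rreg 1 = y₀) (h2 : s.rreg 2 = x₁) (h3 : s.rreg 3 = y₁)
    (h4 : s.rreg 4 = x₂) (h5 : s.rreg 5 = y₂) (h14 : s.ireg 14 = 0)
    (hD : D = (y₁ - y₂) * (x₀ - x₂) + (x₂ - x₁) * (y₀ - y₂)) (hD0 : D ≠ 0)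
    (hW : 2 * B + 3 ≤ W) (b0 : |⌊x₀⌋| ≤ W) (b1 : |⌊y₀⌋| ≤ W) (b2 : |⌊x₁⌋| ≤ W) (b3 : |⌊y₁⌋| ≤ W)
    (b4 : |⌊x₂⌋| ≤ W) (b5 : |⌊y₂⌋| ≤ W)
    (hB : ∀ X Y, IsMinFloor x₀ x₁ x₂ X → IsMinFloor y₀ y₁ y₂ Y →
      Fits x₀ y₀ x₁ y₁ x₂ y₂ X Y B) :
    ∃ T s' X Y m, Runs W prepare s T s' ∧ T ≤ 100 * m + 500 ∧ IsMinFloor x₀ x₁ x₂ X ∧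
      IsMinFloor y₀ y₁ y₂ Y ∧ Fits x₀ y₀ x₁ y₁ x₂ y₂ X Y (2 ^ m) ∧
      (∀ i < m, ¬ Fits x₀ y₀ x₁ y₁ x₂ y₂ X Y (2 ^ i)) ∧
      HasBarycentric s'.rreg x₀ y₀ x₁ y₁ x₂ y₂ D ∧ s'.ireg 14 = 1 ∧ OnStack s' 0 X Y m := by
  obtain ⟨T1, s1, r1, t1, g1⟩ := haltsIn_setBarycentric (W := W) h0 h1 h2 h3 h4 h5 hD hD0
  have f1 := r1.frame
  have e1 : ∀ i < 6, s1.rreg i = s.rreg i := fun i hi => by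
    interval_cases i <;> exact f1.rreg _ rfl
  obtain ⟨T2, s2, r2, t2, g2⟩ := haltsIn_setMinFloor (W := W) (s := s1) (x := 20) (i := 0) (j := 2)
    (k := 4) (by decide) (by rwa [e1 0 (by decide), h0]) (by rwa [e1 2 (by decide), h2])
    (by rwa [e1 4 (by decide), h4])
  have f2 := r2.frame
  have e2 : s2.rreg = s1.rreg := funext fun i => f2.rreg i rfl
  obtain ⟨T3, s3, r3, t3, g3⟩ := haltsIn_setMinFloor (W := W) (s := s2) (x := 21) (i := 1) (j := 3)
    (k := 5) (by decide) (by rwa [e2, e1 1 (by decide), h1]) (by rwa [e2, e1 3 (by decide), h3])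
    (by rwa [e2, e1 5 (by decide), h5])
  have f3 := r3.frame
  have e3 : s3.rreg = s1.rreg := (funext fun i => f3.rreg i rfl : s3.rreg = s2.rreg).trans e2
  rw [e1 0 (by decide), e1 2 (by decide), e1 4 (by decide), h0, h2, h4] at g2
  rw [e2, e1 1 (by decide), e1 3 (by decide), e1 5 (by decide), h1, h3, h5] at g3
  set X := s2.ireg 20 with hX
  set Y := s3.ireg 21 with hY
  have bX : |X| ≤ W := IsMinFloor.abs_le g2 b0 b2 b4
  have bY : |Y| ≤ W := IsMinFloor.abs_le g3 b1 b3 b5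
  obtain ⟨m, m1, m2, T4, s4, r4, t4, g4, g4'⟩ := haltsIn_setSize (W := W) (B := B) (s := s3)
    (X := X) (Y := Y) (by rw [e3, e1 0 (by decide), h0]) (by rw [e3, e1 1 (by decide), h1])
    (by rw [e3, e1 2 (by decide), h2]) (by rw [e3, e1 3 (by decide), h3])
    (by rw [e3, e1 4 (by decide), h4]) (by rw [e3, e1 5 (by decide), h5]) (f3.ireg 20 rfl) hY.symm
    bX bY (hB X Y g2 g3) hW
  have f4 := r4.frame
  -- For `m > 0` half the side does not fit, hence is at most `B`.
  have hm : 2 ^ m ≤ W := by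
    rcases m with _ | m
    · rw [pow_zero]; omega
    · have : 2 ^ m ≤ B := by
        by_contra! hlt
        exact m2 m (by omega) ((hB X Y g2 g3).mono (by exact_mod_cast hlt.le))
      rw [pow_succ]
      omega
  have c5 : wp W (setInt 22 (.reg 12)) (fun s' => s'.ireg 22 = (2 ^ m : ℕ)) s4 := by
    simp only [wp, TestExp.Valid, TestExp.Holds, IntExp.Valid, IntExp.eval,
    CoeffExp.Valid, CoeffExp.eval, Function.update_self, Function.update_of_ne, ne_eq,
    Nat.reduceEqDiff, OfNat.ofNat_ne_zero, OfNat.zero_ne_ofNat, OfNat.ofNat_ne_one,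
    OfNat.one_ne_ofNat, not_false_eq_true, abs_le, g4, and_true]
    exact ⟨by linarith [Nat.cast_nonneg (α := ℤ) (2 ^ m), Nat.cast_nonneg (α := ℤ) W],
      by exact_mod_cast hm⟩
  obtain ⟨T5, s5, r5, t5, g5⟩ := c5.haltsIn
  have f5 := r5.frame
  have k14 : s5.ireg 14 = (0 : ℕ) := by
    rw [f5.ireg 14 rfl, f4.ireg 14 rfl, f3.ireg 14 rfl, f2.ireg 14 rfl, f1.ireg 14 rfl, h14]; rfl
  have k20 : s5.ireg 20 = X := by rw [f5.ireg 20 rfl, f4.ireg 20 rfl, f3.ireg 20 rfl]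
  have k21 : s5.ireg 21 = Y := by rw [f5.ireg 21 rfl, f4.ireg 21 rfl]
  obtain ⟨T6, s6, r6, t6, g6, g6', -⟩ := haltsIn_push (W := W) (x := .reg 20) (y := .reg 21)
    (X := X) (Y := Y) (r := m) k14 g5 (by rw [f5.ireg 13 rfl, g4'])
    (fun s' e => ⟨by simp only [IntExp.Valid, e, k20]; exact bX, by simp only [IntExp.eval, e, k20]⟩)
    (fun s' e => ⟨by simp only [IntExp.Valid, e, k21]; exact bY, by simp only [IntExp.eval, e, k21]⟩)
    (by omega) hm
  have e6 : s6.rreg = s1.rreg := by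
    refine funext fun i => ?_
    rw [r6.frame.rreg i rfl, f5.rreg i rfl, f4.rreg i rfl, e3]
  refine ⟨_, s6, X, Y, m, r1.seq (r2.seq (r3.seq (r4.seq (r5.seq r6)))), ?_, g2, g3, m1, m2, ?_,
    g6, g6'⟩
  · simp only [maxCost, IntExp.cost] at t5 t6
    omega
  · rw [e6]
    exact g1

open Classical in
theorem runs_triangleConvolution {W B M t : ℕ} {s : MachineState K} {rt : ℕ → K} {half : K}
    {x₀ y₀ x₁ y₁ x₂ y₂ D : ℝ}
    (hz : ∀ j < t, s.karr 2 ((j + 1 : ℕ) : ℤ) = rt (j + 1))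
    (hrt : ∀ j < t, rt (j + 1) ^ 2 ^ j = -1) (hh : s.karr 3 0 = half) (hhalf : 2 * half = 1)
    (hb : ∀ i < 7, |s.ireg i| ≤ W) (hM : 7 * M + 10 ≤ W)
    (h0 : s.rreg 0 = x₀) (h1 : s.rreg 1 = y₀) (h2 : s.rreg 2 = x₁) (h3 : s.rreg 3 = y₁)
    (h4 : s.rreg 4 = x₂) (h5 : s.rreg 5 = y₂) (h14 : s.ireg 14 = 0)
    (hD : D = (y₁ - y₂) * (x₀ - x₂) + (x₂ - x₁) * (y₀ - y₂)) (hD0 : D ≠ 0)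
    (hW : 2 * B + 3 ≤ W) (b0 : |⌊x₀⌋| ≤ W) (b1 : |⌊y₀⌋| ≤ W) (b2 : |⌊x₁⌋| ≤ W) (b3 : |⌊y₁⌋| ≤ W)
    (b4 : |⌊x₂⌋| ≤ W) (b5 : |⌊y₂⌋| ≤ W)
    (hB : ∀ X Y, IsMinFloor x₀ x₁ x₂ X → IsMinFloor y₀ y₁ y₂ Y →
      Fits x₀ y₀ x₁ y₁ x₂ y₂ X Y B)
    (hmt : ∀ X Y m, IsMinFloor x₀ x₁ x₂ X → IsMinFloor y₀ y₁ y₂ Y →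
      (∀ i < m, ¬ Fits x₀ y₀ x₁ y₁ x₂ y₂ X Y (2 ^ i)) →
      m + 1 ≤ t ∧ |X| + (2 ^ m : ℕ) ≤ M ∧ |Y| + (2 ^ m : ℕ) ≤ M) :
    ∃ T s' X Y m, Runs W triangleConvolution s T s' ∧ T ≤ 41000 * (2 ^ m * (m + 1) ^ 2) ∧
      IsMinFloor x₀ x₁ x₂ X ∧ IsMinFloor y₀ y₁ y₂ Y ∧ Fits x₀ y₀ x₁ y₁ x₂ y₂ X Y (2 ^ m) ∧
      (∀ i < m, ¬ Fits x₀ y₀ x₁ y₁ x₂ y₂ X Y (2 ^ i)) ∧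
      ∃ c, HasBarycentric c x₀ y₀ x₁ y₁ x₂ y₂ D ∧ ∀ k, s'.karr 4 k = s.karr 4 k +
        squareSum (s.karr 0) (s.karr 1) (IsMemberAt c (fun i => 0 < s.ireg (1 + i))
          fun i => 0 < s.ireg (4 + i)) (2 ^ m) X Y k := by
  obtain ⟨T1, s1, X, Y, m, r1, t1, hX, hY, hF, hm, hc, g14, ho⟩ := runs_prepare h0 h1 h2 h3 h4 h5
    h14 hD hD0 hW b0 b1 b2 b3 b4 b5 hB
  obtain ⟨mt, mX, mY⟩ := hmt X Y m hX hY hm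
  have f1 := r1.frame
  have e1 : ∀ i < 7, s1.ireg i = s.ireg i := fun i hi => by
    interval_cases i <;> exact f1.ireg _ rfl
  have hmm : m < 2 ^ m := Nat.lt_two_pow_self
  have hX0 := abs_nonneg X
  obtain ⟨T2, s2, r2, t2, k14, -, k4⟩ := rounds_square (W := W) (t := t) (M := M) (s₀ := s1)
    (rt := rt) (half := half) (by rw [f1.karr 2 rfl]; exact hz) hrt (by rw [f1.karr 3 rfl, hh]) hhalf
    (fun i hi => by rw [e1 i hi]; exact hb i hi) hM _ rfl m mt X Y 0 s1 (Frame.refl _ _)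
    (by rw [g14]; rfl) ho mX mY (by omega)
  have hend : stackTest.Valid W s2 ∧ ¬ stackTest.Holds s2 := by
    simp only [stackTest, wp, TestExp.Valid, TestExp.Holds, IntExp.Valid, IntExp.eval,
    CoeffExp.Valid, CoeffExp.eval, Function.update_self, Function.update_of_ne, ne_eq,
    Nat.reduceEqDiff, OfNat.ofNat_ne_zero, OfNat.zero_ne_ofNat, OfNat.ofNat_ne_one,
    OfNat.one_ne_ofNat, not_false_eq_true, abs_le, k14]
    omega
  refine ⟨_, s2, X, Y, m, r1.seq (r2.runs hend.1 hend.2), ?_, hX, hY, hF, hm, s1.rreg, hc, fun k => ?_⟩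
  -- If both slopes of a barycentric coordinate vanished, the ends of the opposite edge would
  -- coincide and `D` would be zero.
  · have hne : ∀ k < 3, s1.rreg (7 + 3 * k) ≠ 0 ∨ s1.rreg (8 + 3 * k) ≠ 0 := by
      obtain ⟨⟨c1, c2, -⟩, ⟨c3, c4, -⟩, c5, c6, -⟩ := hc
      intro k hk
      by_contra! hzero
      apply hD0
      rw [hD]
      interval_cases k <;> simp only [Nat.reduceMul, Nat.reduceAdd] at hzero
      · rw [c1, c2, div_eq_zero_iff, div_eq_zero_iff, or_iff_left hD0, or_iff_left hD0] at hzero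
        rw [hzero.1, hzero.2]; ring
      · rw [c3, c4, div_eq_zero_iff, div_eq_zero_iff, or_iff_left hD0, or_iff_left hD0] at hzero
        linear_combination (y₁ - y₂) * hzero.2 - (x₂ - x₁) * hzero.1
      · rw [c5, c6, div_eq_zero_iff, div_eq_zero_iff, or_iff_left hD0, or_iff_left hD0] at hzero
        linear_combination (x₀ - x₂) * -hzero.1 - (y₀ - y₂) * hzero.2
    have h3 := treeCost_le hne m X Y
    -- The preparation and the last loop test, at most `100 * m + 504`, fit into the difference
    -- between `40000` and `41000`.
    have h4 : 2 ^ m * 1 ≤ 2 ^ m * (m + 1) ^ 2 := Nat.mul_le_mul_left _ (Nat.one_le_pow _ _ (by omega))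
    simp only [stackTest, TestExp.cost, IntExp.cost]
    omega
  · rw [k4, f1.karr 4 rfl, f1.karr 0 rfl, f1.karr 1 rfl]
    have hS : (IsMemberAt s1.rreg (fun i => 0 < s1.ireg (1 + i)) fun i => 0 < s1.ireg (4 + i)) =
        IsMemberAt s1.rreg (fun i => 0 < s.ireg (1 + i)) fun i => 0 < s.ireg (4 + i) := by
      funext x y
      simp only [IsMemberAt, IsMember, e1 (1 + 0) (by decide), e1 (1 + 1) (by decide),
        e1 (1 + 2) (by decide), e1 (4 + 0) (by decide), e1 (4 + 1) (by decide),
        e1 (4 + 2) (by decide)]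
    rw [hS]

end Program

/-! ### The region in barycentric coordinates, and the sum over the enclosing square. -/

theorem barycentric_unique {x₀ y₀ x₁ y₁ x₂ y₂ D X Y w₀ w₁ w₂ : ℝ} {c : ℕ → ℝ}
    (hc : Program.HasBarycentric c x₀ y₀ x₁ y₁ x₂ y₂ D)
    (hD : D = (y₁ - y₂) * (x₀ - x₂) + (x₂ - x₁) * (y₀ - y₂)) (hD0 : D ≠ 0)
    (hw : w₀ + w₁ + w₂ = 1) (hX : w₀ * x₀ + w₁ * x₁ + w₂ * x₂ = X)
    (hY : w₀ * y₀ + w₁ * y₁ + w₂ * y₂ = Y) :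
    c 7 * X + c 8 * Y + c 9 = w₀ ∧ c 10 * X + c 11 * Y + c 12 = w₁ ∧
      c 13 * X + c 14 * Y + c 15 = w₂ := by
  obtain ⟨⟨c1, c2, c3⟩, ⟨c4, c5, c6⟩, c7, c8, c9⟩ := hc
  rw [c3, c6, c9, c1, c2, c4, c5, c7, c8, ← hX, ← hY]
  obtain rfl : w₂ = 1 - w₀ - w₁ := by linarith
  refine ⟨?_, ?_, ?_⟩ <;> field_simp <;> rw [hD] <;> ring

theorem barycentric_eq {x₀ y₀ x₁ y₁ x₂ y₂ D X Y : ℝ} {c : ℕ → ℝ}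
    (hc : Program.HasBarycentric c x₀ y₀ x₁ y₁ x₂ y₂ D)
    (hD : D = (y₁ - y₂) * (x₀ - x₂) + (x₂ - x₁) * (y₀ - y₂)) (hD0 : D ≠ 0) :
    (c 7 * X + c 8 * Y + c 9) + (c 10 * X + c 11 * Y + c 12) + (c 13 * X + c 14 * Y + c 15) = 1 ∧
    (c 7 * X + c 8 * Y + c 9) * x₀ + (c 10 * X + c 11 * Y + c 12) * x₁ +
      (c 13 * X + c 14 * Y + c 15) * x₂ = X ∧
    (c 7 * X + c 8 * Y + c 9) * y₀ + (c 10 * X + c 11 * Y + c 12) * y₁ +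
      (c 13 * X + c 14 * Y + c 15) * y₂ = Y := by
  obtain ⟨⟨c1, c2, c3⟩, ⟨c4, c5, c6⟩, c7, c8, c9⟩ := hc
  rw [c3, c6, c9, c1, c2, c4, c5, c7, c8]
  refine ⟨?_, ?_, ?_⟩ <;> field_simp <;> rw [hD] <;> ring

namespace PlaneTriangle

/-- Twice the signed area. -/
noncomputable def det (P : PlaneTriangle) : ℝ :=
  (P.points 1 1 - P.points 2 1) * (P.points 0 0 - P.points 2 0) +
    (P.points 2 0 - P.points 1 0) * (P.points 0 1 - P.points 2 1)

theorem eq_zero_of_weights (P : PlaneTriangle) {a b c : ℝ} (h : a + b + c = 0)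
    (hx : a * P.points 0 0 + b * P.points 1 0 + c * P.points 2 0 = 0)
    (hy : a * P.points 0 1 + b * P.points 1 1 + c * P.points 2 1 = 0) : a = 0 ∧ b = 0 := by
  have := affineIndependent_iff.1 P.independent Finset.univ ![a, b, c]
    (by simpa [Fin.sum_univ_three] using h) (by
      ext i
      fin_cases i
      · simpa [Fin.sum_univ_three] using hx
      · simpa [Fin.sum_univ_three] using hy)
  exact ⟨this 0 (Finset.mem_univ _), this 1 (Finset.mem_univ _)⟩

/-- The cyclic differences of the `x`-coordinates sum to zero and annihilate the `x`-coordinates; if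
`det` vanished, they would annihilate the `y`-coordinates as well. Independence then makes all
`x`-coordinates equal, and in the same way all `y`-coordinates, so the vertices would coincide. -/
theorem det_ne_zero (P : PlaneTriangle) : P.det ≠ 0 := by
  intro h
  rw [det] at h
  obtain ⟨h1, h2⟩ := P.eq_zero_of_weights (a := P.points 2 0 - P.points 1 0)
    (b := P.points 0 0 - P.points 2 0) (c := P.points 1 0 - P.points 0 0) (by ring) (by ring)
    (by linear_combination h)
  obtain ⟨h3, h4⟩ := P.eq_zero_of_weights (a := P.points 2 1 - P.points 1 1)
    (b := P.points 0 1 - P.points 2 1) (c := P.points 1 1 - P.points 0 1) (by ring)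
    (by linear_combination -h) (by ring)
  have h5 := (P.eq_zero_of_weights (a := 1) (b := -1) (c := 0) (by ring)
    (by linear_combination h1 + h2) (by linear_combination h3 + h4)).1
  exact one_ne_zero h5

theorem mem_region_iff (P : PlaneTriangle) (E V : Finset (Fin 3)) {c : ℕ → ℝ}
    (hc : Program.HasBarycentric c (P.points 0 0) (P.points 0 1) (P.points 1 0) (P.points 1 1)
      (P.points 2 0) (P.points 2 1) P.det) {E' V' : ℕ → Prop}
    (hE : ∀ i : Fin 3, E' i ↔ i ∈ E) (hV : ∀ i : Fin 3, V' i ↔ i ∈ V) (x y : ℤ) :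
    !₂[(x : ℝ), (y : ℝ)] ∈ P.region E V ↔ IsMemberAt c E' V' x y := by
  have hrep := barycentric_eq (X := x) (Y := y) hc rfl P.det_ne_zero
  have huniq := fun w₀ w₁ w₂ => barycentric_unique (X := x) (Y := y) (w₀ := w₀) (w₁ := w₁)
    (w₂ := w₂) hc rfl P.det_ne_zero
  have e0 : affineAt c 0 x y = c 7 * x + c 8 * y + c 9 := rfl
  have e1 : affineAt c 1 x y = c 10 * x + c 11 * y + c 12 := rfl
  have e2 : affineAt c 2 x y = c 13 * x + c 14 * y + c 15 := rfl
  rw [← e0, ← e1, ← e2] at hrep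
  simp only [← e0, ← e1, ← e2] at huniq
  unfold IsMemberAt
  generalize affineAt c 0 x y = l₀ at *
  generalize affineAt c 1 x y = l₁ at *
  generalize affineAt c 2 x y = l₂ at *
  -- Interior, open edges and vertices are all given by weights of sum one; existence and uniqueness
  -- of the barycentric coordinates reduce each piece to sign conditions.
  have key : ∀ w₀ w₁ w₂ : ℝ, w₀ + w₁ + w₂ = 1 →
      (w₀ • P.points 0 + w₁ • P.points 1 + w₂ • P.points 2 = !₂[(x : ℝ), (y : ℝ)] ↔
        l₀ = w₀ ∧ l₁ = w₁ ∧ l₂ = w₂) := by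
    intro w₀ w₁ w₂ hw
    constructor
    · intro h
      have hx := congrArg (fun v : Plane => v 0) h
      have hy := congrArg (fun v : Plane => v 1) h
      exact huniq w₀ w₁ w₂ hw (by simpa using hx) (by simpa using hy)
    · rintro ⟨rfl, rfl, rfl⟩
      ext i
      fin_cases i
      · simpa using hrep.2.1
      · simpa using hrep.2.2
  have hint : !₂[(x : ℝ), (y : ℝ)] ∈ P.interior ↔ 0 < l₀ ∧ 0 < l₁ ∧ 0 < l₂ := by
    constructor
    · rintro ⟨w, hw, hw01, h⟩
      rw [Finset.affineCombination_eq_linear_combination _ _ _ hw, Fin.sum_univ_three] at h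
      rw [Fin.sum_univ_three] at hw
      obtain ⟨rfl, rfl, rfl⟩ := (key _ _ _ hw).1 h
      exact ⟨(hw01 0).1, (hw01 1).1, (hw01 2).1⟩
    · rintro ⟨h0, h1, h2⟩
      have hw : ∑ i, ![l₀, l₁, l₂] i = 1 := by simpa [Fin.sum_univ_three] using hrep.1
      -- The interior also asks for weights less than one; this follows from positivity and sum one.
      refine ⟨![l₀, l₁, l₂], hw, fun i => ?_, ?_⟩
      · fin_cases i
        · exact ⟨h0, show l₀ < 1 by linarith [hrep.1]⟩
        · exact ⟨h1, show l₁ < 1 by linarith [hrep.1]⟩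
        · exact ⟨h2, show l₂ < 1 by linarith [hrep.1]⟩
      · rw [Finset.affineCombination_eq_linear_combination _ _ _ hw, Fin.sum_univ_three]
        exact (key _ _ _ hrep.1).2 ⟨rfl, rfl, rfl⟩
  have hedge0 : !₂[(x : ℝ), (y : ℝ)] ∈ P.openEdge 0 ↔ l₀ = 0 ∧ 0 < l₁ ∧ 0 < l₂ := by
    constructor
    · rintro ⟨a, b, ha, hb, hab, h⟩
      obtain ⟨h0, rfl, rfl⟩ := (key 0 a b (by linarith)).1 (by rw [← h, zero_smul, zero_add]; rfl)
      exact ⟨h0, ha, hb⟩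
    · rintro ⟨h0, h1, h2⟩
      refine ⟨l₁, l₂, h1, h2, by linarith [hrep.1], ?_⟩
      change l₁ • P.points 1 + l₂ • P.points 2 = _
      rw [← (key l₀ l₁ l₂ hrep.1).2 ⟨rfl, rfl, rfl⟩, h0, zero_smul, zero_add]
  have hedge1 : !₂[(x : ℝ), (y : ℝ)] ∈ P.openEdge 1 ↔ l₁ = 0 ∧ 0 < l₂ ∧ 0 < l₀ := by
    constructor
    · rintro ⟨a, b, ha, hb, hab, h⟩
      obtain ⟨rfl, h0, rfl⟩ := (key b 0 a (by linarith)).1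
        (by rw [← h, zero_smul, add_zero, add_comm]; rfl)
      exact ⟨h0, ha, hb⟩
    · rintro ⟨h0, h1, h2⟩
      refine ⟨l₂, l₀, h1, h2, by linarith [hrep.1], ?_⟩
      rw [← (key l₀ l₁ l₂ hrep.1).2 ⟨rfl, rfl, rfl⟩, h0, zero_smul, add_zero, add_comm]
      rfl
  have hedge2 : !₂[(x : ℝ), (y : ℝ)] ∈ P.openEdge 2 ↔ l₂ = 0 ∧ 0 < l₀ ∧ 0 < l₁ := by
    constructor
    · rintro ⟨a, b, ha, hb, hab, h⟩
      obtain ⟨rfl, rfl, h0⟩ := (key a b 0 (by linarith)).1 (by rw [← h, zero_smul, add_zero]; rfl)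
      exact ⟨h0, ha, hb⟩
    · rintro ⟨h0, h1, h2⟩
      refine ⟨l₀, l₁, h1, h2, by linarith [hrep.1], ?_⟩
      rw [← (key l₀ l₁ l₂ hrep.1).2 ⟨rfl, rfl, rfl⟩, h0, zero_smul, add_zero]
      rfl
  have hv0 : P.points 0 = !₂[(x : ℝ), (y : ℝ)] ↔ 0 < l₀ ∧ l₁ = 0 ∧ l₂ = 0 := by
    have := key 1 0 0 (by ring)
    rw [zero_smul, zero_smul, one_smul, add_zero, add_zero] at this
    rw [this]
    exact ⟨fun h => ⟨by rw [h.1]; exact one_pos, h.2⟩, fun h => ⟨by linarith [hrep.1, h.2.1, h.2.2],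
      h.2⟩⟩
  have hv1 : P.points 1 = !₂[(x : ℝ), (y : ℝ)] ↔ 0 < l₁ ∧ l₂ = 0 ∧ l₀ = 0 := by
    have := key 0 1 0 (by ring)
    rw [zero_smul, zero_smul, one_smul, zero_add, add_zero] at this
    rw [this]
    exact ⟨fun h => ⟨by rw [h.2.1]; exact one_pos, h.2.2, h.1⟩,
      fun h => ⟨h.2.2, by linarith [hrep.1, h.2.1, h.2.2], h.2.1⟩⟩
  have hv2 : P.points 2 = !₂[(x : ℝ), (y : ℝ)] ↔ 0 < l₂ ∧ l₀ = 0 ∧ l₁ = 0 := by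
    have := key 0 0 1 (by ring)
    rw [zero_smul, zero_smul, one_smul, zero_add, zero_add] at this
    rw [this]
    exact ⟨fun h => ⟨by rw [h.2.2]; exact one_pos, h.1, h.2.1⟩,
      fun h => ⟨h.2.1, h.2.2, by linarith [hrep.1, h.2.1, h.2.2]⟩⟩
  have E0 := hE 0
  have E1 := hE 1
  have E2 := hE 2
  have V0 := hV 0
  have V1 := hV 1
  have V2 := hV 2
  simp only [Fin.isValue, Fin.val_zero, Fin.val_one, Fin.val_two] at E0 E1 E2 V0 V1 V2
  simp only [region, Set.mem_union, Set.mem_iUnion, Set.mem_image, Fin.exists_fin_succ,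
    exists_prop, Finset.mem_coe, IsMember, hint, E0, E1, E2, V0, V1, V2]
  simp only [Fin.succ_zero_eq_one, Fin.succ_one_eq_two, Fin.isValue, or_false,
    IsEmpty.exists_iff, hedge0, hedge1, hedge2, hv0, hv1, hv2, or_assoc]

end PlaneTriangle

-- Both sides are the sum of one function `g` over all of `ℤ × ℤ`. Its support lies in the square by
-- `hbox`, and in `{0, …, n} × {0, …, n}` because the arrays vanish elsewhere; so the square may
-- stick out of the index range, even to negative indices.
open Classical in
theorem squareSum_eq_diagonalSum {K : Type*} [Field K] {n : ℕ} (a b : Fin (n + 1) → K)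
    {S : Set Plane} {S' : ℤ → ℤ → Prop} {X Y : ℤ} {m : ℕ}
    (hS : ∀ x y : ℤ, !₂[(x : ℝ), (y : ℝ)] ∈ S ↔ S' x y)
    (hbox : ∀ x y, S' x y → (X ≤ x ∧ x < X + m) ∧ Y ≤ y ∧ y < Y + m) (k : ℤ) :
    Program.squareSum (arrayOf a) (arrayOf b) S' m X Y k = diagonalSum a b S k := by
  set g : ℤ × ℤ → K := fun z =>
    if z.1 + z.2 = k ∧ S' z.1 z.2 then arrayOf a z.1 * arrayOf b z.2 else 0 with hg
  have hs : Program.squareSum (arrayOf a) (arrayOf b) S' m X Y k = ∑ᶠ z, g z := by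
    rw [finsum_eq_sum_of_support_subset (s := (Finset.range m ×ˢ Finset.range m).image
      fun z => (X + (z.1 : ℤ), Y + (z.2 : ℤ))), Finset.sum_image, Finset.sum_product]
    · rfl
    · rintro ⟨u, v⟩ _ ⟨u', v'⟩ _ h
      simp only [Prod.mk.injEq] at h ⊢
      omega
    · rintro ⟨x, y⟩ h
      have h' : x + y = k ∧ S' x y := by
        by_contra hne
        exact h (if_neg hne)
      obtain ⟨⟨h1, h2⟩, h3, h4⟩ := hbox x y h'.2
      simp only [Finset.coe_image, Set.mem_image, Finset.coe_product, Set.mem_prod, Finset.coe_range,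
        Set.mem_Iio, Prod.exists, Prod.mk.injEq]
      exact ⟨(x - X).toNat, (y - Y).toNat, by omega, by omega, by omega⟩
  have hval : ∀ (c : Fin (n + 1) → K) (i : Fin (n + 1)), arrayOf c ((i : ℕ) : ℤ) = c i := by
    intro c i
    have hi : (0 : ℤ) ≤ (i : ℕ) ∧ ((i : ℕ) : ℤ).toNat < n + 1 := ⟨by omega, by omega⟩
    rw [arrayOf, dif_pos hi]
    exact congrArg c (Fin.ext (Int.toNat_natCast _))
  have hzero : ∀ (c : Fin (n + 1) → K) (x : ℤ), arrayOf c x ≠ 0 → ∃ i : Fin (n + 1), ((i : ℕ) : ℤ) = x := by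
    intro c x hx
    by_contra! hne
    refine hx (dif_neg ?_)
    rintro ⟨h0, h1⟩
    exact hne ⟨x.toNat, h1⟩ (Int.toNat_of_nonneg h0)
  rw [hs, finsum_eq_sum_of_support_subset (s := (Finset.univ : Finset (Fin (n + 1) × Fin (n + 1))).image
      fun z => (((z.1 : ℕ) : ℤ), ((z.2 : ℕ) : ℤ))), Finset.sum_image, diagonalSum, Finset.sum_filter]
  · refine Finset.sum_congr rfl fun z _ => ?_
    have hSz := hS (z.1 : ℕ) (z.2 : ℕ)
    rw [Int.cast_natCast, Int.cast_natCast] at hSz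
    simp only [hg, hval, hSz]
  · rintro ⟨u, v⟩ _ ⟨u', v'⟩ _ h
    simp only [Prod.mk.injEq, Nat.cast_inj] at h ⊢
    exact ⟨Fin.ext h.1, Fin.ext h.2⟩
  · rintro ⟨x, y⟩ h
    have h' : arrayOf a x * arrayOf b y ≠ 0 := by
      intro h0
      refine h ?_
      simp [hg, h0]
    obtain ⟨i, hi⟩ := hzero a x (left_ne_zero_of_mul h')
    obtain ⟨j, hj⟩ := hzero b y (right_ne_zero_of_mul h')
    simp only [Finset.coe_image, Set.mem_image, Finset.coe_univ, Set.mem_univ, true_and,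
      Prod.exists, Prod.mk.injEq]
    exact ⟨i, j, hi, hj⟩

/-! ### Estimates in terms of the perimeter and the size of the input. -/

namespace PlaneTriangle

/-- Each side is at most the sum of the other two. -/
theorem two_mul_dist_le (P : PlaneTriangle) (i j : Fin 3) :
    2 * dist (P.points i) (P.points j) ≤ P.perimeter := by
  have h01 := dist_triangle (P.points 0) (P.points 2) (P.points 1)
  have h12 := dist_triangle (P.points 1) (P.points 0) (P.points 2)
  have h20 := dist_triangle (P.points 2) (P.points 1) (P.points 0)
  have n01 := dist_nonneg (x := P.points 0) (y := P.points 1)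
  have n12 := dist_nonneg (x := P.points 1) (y := P.points 2)
  have n20 := dist_nonneg (x := P.points 2) (y := P.points 0)
  rw [perimeter]
  rw [dist_comm (P.points 0) (P.points 2), dist_comm (P.points 2) (P.points 1)] at h01
  rw [dist_comm (P.points 1) (P.points 0), dist_comm (P.points 0) (P.points 2)] at h12
  rw [dist_comm (P.points 2) (P.points 1), dist_comm (P.points 1) (P.points 0)] at h20
  fin_cases i <;> fin_cases j <;>
    simp only [Fin.zero_eta, Fin.mk_one, Fin.reduceFinMk, Fin.isValue, dist_self]
  · linarith
  · linarith
  · rw [dist_comm]; linarith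
  · rw [dist_comm]; linarith
  · linarith
  · linarith
  · linarith
  · rw [dist_comm]; linarith
  · linarith

theorem coord_sub_le (P : PlaneTriangle) (i j : Fin 3) (k : Fin 2) :
    P.points i k - P.points j k ≤ P.perimeter / 2 := by
  have h1 := PiLp.norm_apply_le (P.points i - P.points j) k
  rw [PiLp.sub_apply, Real.norm_eq_abs, ← dist_eq_norm] at h1
  linarith [le_abs_self (P.points i k - P.points j k), P.two_mul_dist_le i j]

theorem norm_le (P : PlaneTriangle) (i : Fin 3) : ‖P.points i‖ ≤ ⌈∑ i, ‖P.points i‖⌉₊ :=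
  (Finset.single_le_sum (f := fun i => ‖P.points i‖) (fun _ _ => norm_nonneg _)
    (Finset.mem_univ i)).trans (Nat.le_ceil _)

theorem abs_floor_le (P : PlaneTriangle) (i : Fin 3) (k : Fin 2) :
    |⌊P.points i k⌋| ≤ (⌈∑ i, ‖P.points i‖⌉₊ : ℤ) := by
  have h1 := (PiLp.norm_apply_le (P.points i) k).trans (P.norm_le i)
  rw [Real.norm_eq_abs, abs_le] at h1
  rw [abs_le]
  constructor
  · rw [Int.le_floor]
    push_cast
    exact h1.1
  · have := (Int.floor_le _).trans h1.2
    exact_mod_cast this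

theorem perimeter_nonneg (P : PlaneTriangle) : 0 ≤ P.perimeter := by
  rw [perimeter]
  positivity

theorem perimeter_le (P : PlaneTriangle) : P.perimeter ≤ 2 * ⌈∑ i, ‖P.points i‖⌉₊ := by
  have h := Nat.le_ceil (∑ i, ‖P.points i‖)
  rw [Fin.sum_univ_three] at h ⊢
  rw [perimeter]
  linarith [dist_le_norm_add_norm (P.points 0) (P.points 1),
    dist_le_norm_add_norm (P.points 1) (P.points 2),
    dist_le_norm_add_norm (P.points 2) (P.points 0)]

/-- Coordinates of two vertices differ by at most half the perimeter, and rounding down loses less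
than one. -/
theorem fits (P : PlaneTriangle) {X Y : ℤ}
    (hX : IsMinFloor (P.points 0 0) (P.points 1 0) (P.points 2 0) X)
    (hY : IsMinFloor (P.points 0 1) (P.points 1 1) (P.points 2 1) Y) :
    Program.Fits (P.points 0 0) (P.points 0 1) (P.points 1 0) (P.points 1 1) (P.points 2 0)
      (P.points 2 1) X Y (P.perimeter / 2 + 1) := by
  have key : ∀ (k : Fin 2) (Z : ℤ), IsMinFloor (P.points 0 k) (P.points 1 k) (P.points 2 k) Z →
      ∀ i, P.points i k - Z < P.perimeter / 2 + 1 := by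
    rintro k Z ⟨-, -, -, h⟩ i
    obtain ⟨j, hj⟩ : ∃ j, Z = ⌊P.points j k⌋ := by
      rcases h with h | h | h
      exacts [⟨0, h⟩, ⟨1, h⟩, ⟨2, h⟩]
    rw [hj]
    linarith [P.coord_sub_le i j k, Int.lt_floor_add_one (P.points j k)]
  exact ⟨⟨key 0 X hX 0, key 0 X hX 1, key 0 X hX 2⟩, key 1 Y hY 0, key 1 Y hY 1, key 1 Y hY 2⟩

end PlaneTriangle

theorem IsMinFloor.le_and_lt_add {z₀ z₁ z₂ l₀ l₁ l₂ : ℝ} {Z z : ℤ} {m : ℕ}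
    (hZ : IsMinFloor z₀ z₁ z₂ Z) (h₀ : z₀ - Z < m) (h₁ : z₁ - Z < m) (h₂ : z₂ - Z < m)
    (n₀ : 0 ≤ l₀) (n₁ : 0 ≤ l₁) (n₂ : 0 ≤ l₂) (hl : l₀ + l₁ + l₂ = 1)
    (hz : l₀ * z₀ + l₁ * z₁ + l₂ * z₂ = z) : Z ≤ z ∧ z < Z + m := by
  obtain ⟨a₀, a₁, a₂, -⟩ := hZ
  rw [Int.le_floor] at a₀ a₁ a₂
  constructor
  · have q₀ := mul_nonneg n₀ (sub_nonneg.2 a₀)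
    have q₁ := mul_nonneg n₁ (sub_nonneg.2 a₁)
    have q₂ := mul_nonneg n₂ (sub_nonneg.2 a₂)
    have e : (z : ℝ) - Z = l₀ * (z₀ - Z) + l₁ * (z₁ - Z) + l₂ * (z₂ - Z) := by
      linear_combination (Z : ℝ) * hl - hz
    have : (Z : ℝ) ≤ z := by linarith
    exact_mod_cast this
  · have p₀ : (0 : ℝ) < Z + m - z₀ := by linarith
    have p₁ : (0 : ℝ) < Z + m - z₁ := by linarith
    have p₂ : (0 : ℝ) < Z + m - z₂ := by linarith
    have e : (Z : ℝ) + m - z = l₀ * (Z + m - z₀) + l₁ * (Z + m - z₁) + l₂ * (Z + m - z₂) := by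
      linear_combination hz - (Z + m : ℝ) * hl
    -- The inequality is strict because at least one of the weights is positive.
    have hpos : 0 < l₀ * (Z + m - z₀) + l₁ * (Z + m - z₁) + l₂ * (Z + m - z₂) := by
      rcases n₀.lt_or_eq with h | rfl
      · positivity
      rcases n₁.lt_or_eq with h | rfl
      · positivity
      have : 0 < l₂ := by linarith
      positivity
    have : (z : ℝ) < Z + m := by linarith
    exact_mod_cast this

theorem mem_box_of_isMemberAt {x₀ y₀ x₁ y₁ x₂ y₂ D : ℝ} {c : ℕ → ℝ}
    (hc : Program.HasBarycentric c x₀ y₀ x₁ y₁ x₂ y₂ D)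
    (hD : D = (y₁ - y₂) * (x₀ - x₂) + (x₂ - x₁) * (y₀ - y₂)) (hD0 : D ≠ 0) {X Y : ℤ} {m : ℕ}
    (hX : IsMinFloor x₀ x₁ x₂ X) (hY : IsMinFloor y₀ y₁ y₂ Y)
    (hF : Program.Fits x₀ y₀ x₁ y₁ x₂ y₂ X Y m) {E V : ℕ → Prop} {x y : ℤ}
    (h : IsMemberAt c E V x y) : (X ≤ x ∧ x < X + m) ∧ Y ≤ y ∧ y < Y + m := by
  obtain ⟨n0, n1, n2⟩ := IsMember.nonneg h
  obtain ⟨h1, h2, h3⟩ := barycentric_eq (X := x) (Y := y) hc hD hD0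
  have e0 : affineAt c 0 x y = c 7 * x + c 8 * y + c 9 := rfl
  have e1 : affineAt c 1 x y = c 10 * x + c 11 * y + c 12 := rfl
  have e2 : affineAt c 2 x y = c 13 * x + c 14 * y + c 15 := rfl
  rw [← e0, ← e1, ← e2] at h1 h2 h3
  exact ⟨hX.le_and_lt_add hF.1.1 hF.1.2.1 hF.1.2.2 n0 n1 n2 h1 h2,
    hY.le_and_lt_add hF.2.1 hF.2.2.1 hF.2.2.2 n0 n1 n2 h1 h3⟩

/-- For `p < 2` one has `m ≤ 1`, and the maximum with `1` dominates the left side, which is at most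
`8`. For `p ≥ 2` both `2 ^ m < 2 * p` and `m + 1 ≤ 5 * log p` hold, and `2 * 5 ^ 2 = 50`. -/
theorem two_pow_mul_sq_le {m : ℕ} {p : ℝ} (hp : (2 : ℝ) ^ m < p + 2) :
    (2 : ℝ) ^ m * (m + 1) ^ 2 ≤ 50 * max 1 (p * Real.log p ^ 2) := by
  rcases lt_or_ge p 2 with h | h
  · have hm : m ≤ 1 := by
      by_contra! h2
      have : (2 : ℝ) ^ 2 ≤ 2 ^ m := pow_le_pow_right₀ (by norm_num) h2
      linarith
    have : (2 : ℝ) ^ m * (m + 1) ^ 2 ≤ 8 := by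
      interval_cases m <;> norm_num
    linarith [le_max_left 1 (p * Real.log p ^ 2)]
  · have h2 : (2 : ℝ) ^ m < 2 * p := by linarith
    have hl2 : 0.6931471803 < Real.log 2 := Real.log_two_gt_d9
    have hlog : Real.log 2 ≤ Real.log p := Real.log_le_log (by norm_num) h
    have h3 : m * Real.log 2 < Real.log 2 + Real.log p := by
      rw [← Real.log_pow, ← Real.log_mul (by norm_num) (by linarith)]
      exact Real.log_lt_log (by positivity) h2
    -- By `h3` and `hlog`, `(m + 1) * log 2 < 2 * log 2 + log p ≤ 3 * log p`, and `3 / log 2 < 5`.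
    have h4 : (m : ℝ) + 1 ≤ 5 * Real.log p := by
      have hm0 : (0 : ℝ) ≤ m := Nat.cast_nonneg m
      nlinarith
    have h5 : ((m : ℝ) + 1) ^ 2 ≤ (5 * Real.log p) ^ 2 :=
      pow_le_pow_left₀ (by positivity) h4 2
    calc (2 : ℝ) ^ m * (m + 1) ^ 2 ≤ 2 * p * (5 * Real.log p) ^ 2 := by gcongr
      _ = 50 * (p * Real.log p ^ 2) := by ring
      _ ≤ _ := by gcongr; exact le_max_right _ _

/-- The power equals `ω ^ 2 ^ (t - 1)`, a primitive square root of unity. This is the only property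
of the table that the transform uses. -/
theorem rootTable_pow {K : Type*} [Field K] {t : ℕ} {ω : K} (hω : IsPrimitiveRoot ω (2 ^ t)) {j : ℕ}
    (hj : j < t) : rootTable t ω ((j + 1 : ℕ) : ℤ) ^ 2 ^ j = -1 := by
  have h2 : IsPrimitiveRoot (ω ^ 2 ^ (t - 1)) 2 := by
    refine hω.pow (by positivity) ?_
    rw [← pow_succ]
    congr 1
    omega
  rw [rootTable, if_pos (by omega), ← pow_mul, ← pow_add, Int.toNat_natCast]
  have : t - (j + 1) + j = t - 1 := by omega
  rw [this]
  exact h2.eq_neg_one_of_two_right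

theorem mainTheorem2 :
    ∃ (prog : Program) (C D : ℕ),
      ∀ (K : Type*) [Field K] (t : ℕ) (ω : K), IsPrimitiveRoot ω (2 ^ t) →
      ∀ (n : ℕ) (a b : Fin (n + 1) → K) (P : PlaneTriangle) (E V : Finset (Fin 3)),
        2 * (P.perimeter + 1) ≤ (2 : ℝ) ^ t →
        ∃ (T : ℕ) (s : MachineState K),
          Runs (P.size n ^ D) prog (initialState a b P E V t ω) T s ∧
          (T : ℝ) ≤ C * max 1 (P.perimeter * Real.log P.perimeter ^ 2) ∧
          ∀ k : ℤ, s.karr 4 k = diagonalSum a b (P.region E V) k := by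
  -- The factor `41000` is the cost per unit of `2 ^ m * (m + 1) ^ 2`, and `50` comes from
  -- `two_pow_mul_sq_le`. All integers are bounded by a fixed multiple of the size; as the size is
  -- at least `2`, its tenth power is at least `512` times the size.
  refine ⟨Program.triangleConvolution, 41000 * 50, 10, ?_⟩
  intro K _ t ω hω n a b P E V ht
  have hp0 := P.perimeter_nonneg
  have hpR := P.perimeter_le
  have hfl := P.abs_floor_le
  have hsize : P.size n = n + 2 + ⌈∑ i, ‖P.points i‖⌉₊ := rfl
  have hW : 512 * P.size n ≤ P.size n ^ 10 := by
    rw [pow_succ]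
    refine Nat.mul_le_mul_right _ ?_
    calc 512 = 2 ^ 9 := by norm_num
      _ ≤ _ := Nat.pow_le_pow_left (by omega) 9
  -- Half of the minimal side does not fit, so it is smaller than `P.perimeter / 2 + 1`.
  have hmlt : ∀ X Y m, IsMinFloor (P.points 0 0) (P.points 1 0) (P.points 2 0) X →
      IsMinFloor (P.points 0 1) (P.points 1 1) (P.points 2 1) Y →
      (∀ i < m, ¬ Program.Fits (P.points 0 0) (P.points 0 1) (P.points 1 0) (P.points 1 1)
        (P.points 2 0) (P.points 2 1) X Y (2 ^ i)) → (2 : ℝ) ^ m < P.perimeter + 2 := by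
    intro X Y m hX hY hm
    rcases m with _ | m
    · rw [pow_zero]; linarith
    · have h1 : (2 : ℝ) ^ m < P.perimeter / 2 + 1 := by
        by_contra! hle
        exact hm m (by omega) ((P.fits hX hY).mono hle)
      rw [pow_succ]
      linarith
  have ht1 : 1 ≤ t := by
    by_contra! h0
    obtain rfl : t = 0 := by omega
    rw [pow_zero] at ht
    linarith
  -- In characteristic two there is no primitive root of even order; here `t ≥ 1` enters.
  have hhalf : (2 : K) * 2⁻¹ = 1 := by
    refine mul_inv_cancel₀ fun h0 => ?_
    have : NeZero ((2 ^ t : ℕ) : K) := hω.neZero'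
    refine this.out ?_
    push_cast
    rw [h0, zero_pow (by omega)]
  generalize hR : ⌈∑ i, ‖P.points i‖⌉₊ = R at *
  have hflW : ∀ i k, |⌊P.points i k⌋| ≤ ((P.size n ^ 10 : ℕ) : ℤ) := fun i k =>
    (hfl i k).trans (by exact_mod_cast (by omega : R ≤ P.size n ^ 10))
  -- With `R` the rounded sum of the norms, the perimeter is at most `2 * R`. So `B = R + 1` bounds
  -- a side that fits, and `M = 3 * R + 2` bounds `|X| + 2 ^ m`, as `|X| ≤ R` and `2 ^ m ≤ 2 * R +
  -- 2`.
  obtain ⟨T, s, X, Y, m, hrun, hT, hX, hY, hF, hm, c, hc, hk⟩ :=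
    Program.runs_triangleConvolution (W := P.size n ^ 10) (B := R + 1) (M := 3 * R + 2) (t := t)
      (s := initialState a b P E V t ω) (rt := fun l => rootTable t ω (l : ℤ)) (half := 2⁻¹)
      (D := P.det)
      (fun _ _ => rfl) (fun j hj => rootTable_pow hω hj) (by simp [initialState]) hhalf
      (by
        have h1 : (1 : ℤ) ≤ (P.size n ^ 10 : ℕ) := by
          exact_mod_cast (by omega : 1 ≤ P.size n ^ 10)
        intro i hi
        interval_cases i
        · change |(n : ℤ)| ≤ _
          rw [Nat.abs_cast]
          exact_mod_cast (by omega : n ≤ P.size n ^ 10)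
        all_goals
          simp only [initialState]
          split_ifs
          · simpa using h1
          · simp)
      (by omega) rfl rfl rfl rfl rfl rfl rfl rfl P.det_ne_zero (by omega)
      (hflW 0 0) (hflW 0 1) (hflW 1 0) (hflW 1 1) (hflW 2 0) (hflW 2 1)
      (fun X Y hX hY => (P.fits hX hY).mono (by push_cast; linarith))
      (by
        intro X Y m hX hY hm
        have h1 := hmlt X Y m hX hY hm
        refine ⟨?_, ?_, ?_⟩
        -- Here `p + 2 ≤ 2 * (p + 1) ≤ 2 ^ t`, so the table contains the roots for every transform
        -- that may occur.
        · have : (2 : ℝ) ^ m < 2 ^ t := by linarith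
          exact (pow_lt_pow_iff_right₀ (by norm_num)).1 this
        · have h2 : 2 ^ m ≤ 2 * R + 2 := by
            have : (2 : ℝ) ^ m ≤ 2 * R + 2 := by linarith
            exact_mod_cast this
          have := hX.abs_le (hfl 0 0) (hfl 1 0) (hfl 2 0)
          omega
        · have h2 : 2 ^ m ≤ 2 * R + 2 := by
            have : (2 : ℝ) ^ m ≤ 2 * R + 2 := by linarith
            exact_mod_cast this
          have := hY.abs_le (hfl 0 1) (hfl 1 1) (hfl 2 1)
          omega)
  refine ⟨T, s, hrun, ?_, fun k => ?_⟩
  · have h1 : (T : ℝ) ≤ 41000 * ((2 : ℝ) ^ m * (m + 1) ^ 2) := by exact_mod_cast hT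
    have h2 := two_pow_mul_sq_le (hmlt X Y m hX hY hm)
    push_cast
    linarith
  · have h0 : (initialState a b P E V t ω).karr 4 k = 0 := rfl
    rw [hk, h0, zero_add]
    refine squareSum_eq_diagonalSum a b (fun x y => P.mem_region_iff E V hc ?_ ?_ x y) (fun x y h =>
      mem_box_of_isMemberAt hc rfl P.det_ne_zero hX hY (by push_cast; exact hF) h) k
    all_goals
      intro i
      fin_cases i <;> simp only [initialState] <;> split_ifs <;> simp_all
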